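/- **Setting.** Let $n\ge 1$, $m\ge 0$, let $\mathcal N=[n]$ be a set of agents and $\mathcal M=[m]$ a set of items, and let $v_i(c)\in\mathbb R$ be the utility of agent $i$ for item $c$, with $v_i(S)=\sum_{c\in S}v_i(c)$ for $S\subseteq\mathcal M$. The instance is a *chore division instance with bivalued utilities* if there are reals $0>a>b$ with $v_i(c)\in\{a,b\}$ for all $i,c$. An *allocation* $\mathbf x=(\mathbf x_1,\dots,\mathbf x_n)$ is a family of pairwise disjoint bundles with union $\mathcal M$. It is *EF1* if for all $i,j\in\mathcal N$ with $\mathbf x_i\cup\mathbf x_j\ne\emptyset$ there is $r\in\mathbf x_i\cup\mathbf x_j$ with $v_i(\mathbf x_i\setminus\{r\})\ge v_i(\mathbf x_j\setminus\{r\})$. It is *Pareto optimal* (PO) if there is no allocation $\mathbf y$ with $v_i(\mathbf y_i)\ge v_i(\mathbf x_i)$ for all $i$ and with strict inequality for some $i$. **Scaling.** The utilities of each agent are first multiplied by a positive factor so that, for some $p>1$, all scaled utilities $w_i(c)$ lie in $\{-1,-p\}$ and (if $m\ge 1$) every agent $i$ has some $c$ with $w_i(c)=-1$. **Notation.** Given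 an allocation $\mathbf x$ and positive prices $\mathbf p(c)$, put $\mathbf p(S)=\sum_{c\in S}\mathbf p(c)$, $\mathbf p_{-1}(S)=\mathbf p(S)-\max_{c\in S}\mathbf p(c)$ for $S\neq\emptyset$, $\mathbf p_{-1}(\emptyset)=0$, $\mathrm{PB}_i(c)=|w_i(c)|/\mathbf p(c)$ and $\mathrm{MPB}_i=\min_{c}\mathrm{PB}_i(c)$. A *least spender* is an agent minimizing $\mathbf p(\mathbf x_i)$. An *MPB alternating path* of length $d$ from $i_d$ to $i_0$ is a sequence $i_0,c_1,i_1,\dots,c_d,i_d$ with $c_t\in\mathbf x_{i_t}$ and $\mathrm{PB}_{i_{t-1}}(c_t)=\mathrm{MPB}_{i_{t-1}}$ for $1\le t\le d$. The pair $(\mathbf x,\mathbf p)$ is *pEF1* if for all $i,j$ with $\mathbf x_i\ne\emptyset$ there is $c\in\mathbf x_i$ with $\mathbf p(\mathbf x_i\setminus\{c\})\le\mathbf p(\mathbf x_j)$. **Algorithm.** * *Phase 1.* Let $\mathbf x$ maximize $\sum_i w_i(\mathbf x_i)$, let $\mathbf p(c)=p\cdot|\max_i w_i(c)|$ and $k=1$;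 no chore is entitled, $E(i)=\emptyset$ for all $i$. * *Phase 2a.* For $\ell=k-2,k-3,\dots,1$ repeat: choose $i\in H_\ell$ maximizing $\mathbf p_{-1}(\mathbf x_i)$ and $j\in H_{\ell+1}\cup\dots\cup H_{k-1}$ minimizing $\mathbf p(\mathbf x_j)$; if $\mathbf p_{-1}(\mathbf x_i)>\mathbf p(\mathbf x_j)$, transfer some $c\in\mathbf x_i\setminus E(i)$ from $i$ to $j$; otherwise go on to the next $\ell$. * *Phase 2b.* As long as there is an MPB alternating path from an agent $i_d$ to some least spender $i_0$ with $\mathbf p_{-1}(\mathbf x_{i_d})>\mathbf p(\mathbf x_{i_0})$, choose such a path of minimum length $d$ (over all least spenders and all such $i_d$) and transfer $c_d$ from $i_d$ to $i_{d-1}$. When there is none: if $(\mathbf x,\mathbf p)$ is pEF1, return $\mathbf x$; otherwise go to Phase 3. * *Phase 3.* Let $H_k$ be the set of agents $i$ from which there is an MPB alternating path (possibly of length $0$) to some least spender, and let $\alpha=\min\{\mathrm{PB}_i(c)/\mathrm{MPB}_i: i\in H_k,\ c\in\mathbf x_j \text{ for some } j\notin H_k\}$. For every $i\in H_k$ set $E(i)=\mathbf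 x_i$ and multiply the prices of all $c\in\mathbf x_i$ by $1/\alpha$. Increase $k$ by $1$ and go to Phase 2a. **Theorem.** There is a polynomial $q$ such that for every chore division instance with bivalued utilities, with $n\ge1$ agents and $m$ items, the following hold. 1. For every admissible scaling, Phase 1 can be carried out, and however the choices left open above are made, the algorithm never gets stuck (a required agent, chore or $\alpha$ always exists), halts after at most $q(n+m)$ steps (a step being a single loop test with the transfer it triggers, a change of phase, or one Phase 3), and the allocation it returns is EF1 and PO for $v$. 2. The algorithm runs in $\mathrm{poly}(n,m)$ time: there is one fixed program for a random access machine with unit-cost exact real arithmetic ($+,-,\times,/$ and comparison, integer constants, separate integer memory for indices) which on input $n,m,(v_i(c))_{i,c}$ computes a scaling, carries out an execution of the algorithm step by step, and halts after at most $q(n+m)$ operations with an allocation that is EF1 and PO. In particular, every chore division instance with bivalued utilities (and at least one agent) has an allocation that is EF1 and Pareto optimal. -/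

import Mathlib

noncomputable section

namespace BivaluedChores

/-! ### Instances, allocations, fairness and efficiency -/

/-- A utility profile `v`, where `v i c` is the utility of agent `i` for item `c`. -/
abbrev Profile (n m : ℕ) := Fin n → Fin m → ℝ

/-- An allocation, given by the owner of each item. -/
abbrev Allocation (n m : ℕ) := Fin m → Fin n

/-- The bundle of agent `i`. The bundles are pairwise disjoint and cover all items, and each such
family of bundles comes from exactly one owner function. -/
def bundle {n m : ℕ} (x : Allocation n m) (i : Fin n) : Finset (Fin m) :=
  Finset.univ.filter (fun c => x c = i)

/-- Additive utility of agent `i` for the set `S`. -/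
def utility {n m : ℕ} (v : Profile n m) (i : Fin n) (S : Finset (Fin m)) : ℝ :=
  ∑ c ∈ S, v i c

/-- Bivalued chores: all utilities lie in `{a, b}` for common reals `0 > a > b`. -/
def IsBivaluedChores {n m : ℕ} (v : Profile n m) : Prop :=
  ∃ a b : ℝ, 0 > a ∧ a > b ∧ ∀ i c, v i c = a ∨ v i c = b

/-- Envy-freeness up to one item. -/
def EF1 {n m : ℕ} (v : Profile n m) (x : Allocation n m) : Prop :=
  ∀ i j : Fin n, (bundle x i ∪ bundle x j).Nonempty →
    ∃ r ∈ bundle x i ∪ bundle x j,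
      utility v i (bundle x i \ {r}) ≥ utility v i (bundle x j \ {r})

/-- `x` is Pareto dominated by `y`. -/
def ParetoDominatedBy {n m : ℕ} (v : Profile n m) (x y : Allocation n m) : Prop :=
  (∀ i, utility v i (bundle x i) ≤ utility v i (bundle y i)) ∧
    ∃ i, utility v i (bundle x i) < utility v i (bundle y i)

/-- Pareto optimality. -/
def ParetoOptimal {n m : ℕ} (v : Profile n m) (x : Allocation n m) : Prop :=
  ¬ ∃ y : Allocation n m, ParetoDominatedBy v x y

/-- `w` is obtained from `v` by scaling the utilities of each agent by a positive factor so that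
all values lie in `{-1, -p}`, where `p > 1`, and every agent values some item at `-1`
(if there are items at all). -/
def IsScaling {n m : ℕ} (v : Profile n m) (p : ℝ) (w : Profile n m) : Prop :=
  1 < p ∧ (∀ i, ∃ s : ℝ, 0 < s ∧ ∀ c, w i c = s * v i c) ∧
    (∀ i c, w i c = -1 ∨ w i c = -p) ∧ ∀ i, 0 < m → ∃ c, w i c = -1

/-! ### Fisher markets for chores -/

/-- The price of a set of chores. -/
def setPrice {m : ℕ} (price : Fin m → ℝ) (S : Finset (Fin m)) : ℝ :=
  ∑ c ∈ S, price c

/-- The price of a set without its most expensive chore; `0` for the empty set. -/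
def priceUpToOne {m : ℕ} (price : Fin m → ℝ) (S : Finset (Fin m)) : ℝ :=
  if h : S.Nonempty then setPrice price S - S.sup' h price else 0

/-- The pain per buck ratio. -/
def painPerBuck {n m : ℕ} (w : Profile n m) (price : Fin m → ℝ) (i : Fin n) (c : Fin m) : ℝ :=
  |w i c| / price c

/-- The minimum pain per buck ratio (only used when there is a chore). -/
def minPainPerBuck {n m : ℕ} (w : Profile n m) (price : Fin m → ℝ) (i : Fin n) : ℝ :=
  ⨅ c, painPerBuck w price i c

/-- `c` is an MPB chore for agent `i`. -/
def IsMPBChore {n m : ℕ} (w : Profile n m) (price : Fin m → ℝ) (i : Fin n) (c : Fin m) : Prop :=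
  painPerBuck w price i c = minPainPerBuck w price i

/-- Price envy-freeness up to one item. -/
def PriceEF1 {n m : ℕ} (x : Allocation n m) (price : Fin m → ℝ) : Prop :=
  ∀ i j : Fin n, (bundle x i).Nonempty →
    ∃ c ∈ bundle x i, setPrice price (bundle x i \ {c}) ≤ setPrice price (bundle x j)

/-! ### The algorithm -/

/-- The part of the algorithm that is executed next; `done` means that the current allocation has
been returned. -/
inductive Phase where
  | phase2a
  | phase2b
  | phase3
  | done

/-- The variables of the algorithm: the allocation, the prices, the iteration number `k`, the loop
counter `l` of Phase 2a, the agent sets `H`, and the entitled chores of each agent. -/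
structure Config (n m : ℕ) where
  phase : Phase
  alloc : Allocation n m
  price : Fin m → ℝ
  k : ℕ
  l : ℕ
  H : ℕ → Finset (Fin n)
  entitled : Fin n → Finset (Fin m)

namespace Config

variable {n m : ℕ}

/-- The price of the bundle of agent `i`. -/
def spending (s : Config n m) (i : Fin n) : ℝ :=
  setPrice s.price (bundle s.alloc i)

/-- The price of the bundle of agent `i` up to one chore. -/
def spendingUpToOne (s : Config n m) (i : Fin n) : ℝ :=
  priceUpToOne s.price (bundle s.alloc i)

/-- `i` is a least spender. -/
def LeastSpender (s : Config n m) (i : Fin n) : Prop :=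
  ∀ j, s.spending i ≤ s.spending j

/-- Agent `i` owns `c`, and `c` is an MPB chore for `j`. -/
def Arrow (w : Profile n m) (s : Config n m) (j : Fin n) (c : Fin m) (i : Fin n) : Prop :=
  s.alloc c = i ∧ IsMPBChore w s.price j c

/-- `AltPath w s i₀ d i`: there is an MPB alternating path of length `d` from `i` to `i₀`. -/
inductive AltPath (w : Profile n m) (s : Config n m) (i₀ : Fin n) : ℕ → Fin n → Prop
  | refl : AltPath w s i₀ 0 i₀
  | snoc {d : ℕ} {j i : Fin n} {c : Fin m} :
      AltPath w s i₀ d j → Arrow w s j c i → AltPath w s i₀ (d + 1) i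

/-- There is an MPB alternating path of length `d` from a violator `i` to a least spender `ls`. -/
def ViolatorPath (w : Profile n m) (s : Config n m) (ls : Fin n) (d : ℕ) (i : Fin n) : Prop :=
  s.LeastSpender ls ∧ AltPath w s ls d i ∧ s.spendingUpToOne i > s.spending ls

/-- The agents `i`, `j` that Phase 2a selects: `i` has maximum spending up to one chore in `H l`,
and `j` has minimum spending in `H (l + 1) ∪ ⋯ ∪ H (k - 1)`. -/
def Selects (s : Config n m) (i j : Fin n) : Prop :=
  let later := (Finset.Ioo s.l s.k).biUnion s.H
  (i ∈ s.H s.l ∧ ∀ i' ∈ s.H s.l, s.spendingUpToOne i' ≤ s.spendingUpToOne i) ∧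
    (j ∈ later ∧ ∀ j' ∈ later, s.spending j ≤ s.spending j')

end Config

/-- Phase 1: a welfare-maximizing allocation, the initial prices, and the first iteration.
No agent set `H` is defined yet, and no chore is entitled. -/
def IsInitial {n m : ℕ} (p : ℝ) (w : Profile n m) (s : Config n m) : Prop :=
  s.phase = Phase.phase2a ∧ s.k = 1 ∧ s.l = 0 ∧
    (∀ t, s.H t = ∅) ∧ (∀ i, s.entitled i = ∅) ∧
    (∀ c, s.price c = p * |⨆ i, w i c|) ∧
    ∀ y : Allocation n m,
      ∑ i, utility w i (bundle y i) ≤ ∑ i, utility w i (bundle s.alloc i)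

/-- One step of the algorithm after Phase 1. All choices the algorithm leaves open are left open
here. The loop counter of Phase 2a runs through `k - 2, …, 1`; it is set when the phase is entered,
and value `0` means that the loop is over. -/
inductive Step {n m : ℕ} (w : Profile n m) : Config n m → Config n m → Prop
  | transfer2a (s : Config n m) (i j : Fin n) (c : Fin m) :
      s.phase = Phase.phase2a → 1 ≤ s.l → s.Selects i j →
      s.spendingUpToOne i > s.spending j →
      c ∈ bundle s.alloc i \ s.entitled i →
      Step w s { s with alloc := Function.update s.alloc c j }
  | next2a (s : Config n m) (i j : Fin n) :
      s.phase = Phase.phase2a → 1 ≤ s.l → s.Selects i j →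
      ¬ s.spendingUpToOne i > s.spending j →
      Step w s { s with l := s.l - 1 }
  | end2a (s : Config n m) :
      s.phase = Phase.phase2a → s.l = 0 →
      Step w s { s with phase := Phase.phase2b }
  | transfer2b (s : Config n m) (ls j i : Fin n) (c : Fin m) (d : ℕ) :
      s.phase = Phase.phase2b →
      Config.AltPath w s ls d j → Config.Arrow w s j c i → s.ViolatorPath w ls (d + 1) i →
      (∀ ls' d' i', s.ViolatorPath w ls' d' i' → d + 1 ≤ d') →
      Step w s { s with alloc := Function.update s.alloc c j }
  | return2b (s : Config n m) :
      s.phase = Phase.phase2b → (¬ ∃ ls d i, s.ViolatorPath w ls d i) →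
      PriceEF1 s.alloc s.price →
      Step w s { s with phase := Phase.done }
  | break2b (s : Config n m) :
      s.phase = Phase.phase2b → (¬ ∃ ls d i, s.ViolatorPath w ls d i) →
      ¬ PriceEF1 s.alloc s.price →
      Step w s { s with phase := Phase.phase3 }
  | reduce (s : Config n m) (Hk : Finset (Fin n)) (α : ℝ) :
      s.phase = Phase.phase3 →
      (∀ i, i ∈ Hk ↔ ∃ ls d, s.LeastSpender ls ∧ Config.AltPath w s ls d i) →
      IsLeast {a : ℝ | ∃ i ∈ Hk, ∃ c, s.alloc c ∉ Hk ∧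
        a = painPerBuck w s.price i c / minPainPerBuck w s.price i} α →
      Step w s
        { phase := Phase.phase2a
          alloc := s.alloc
          price := fun c => if s.alloc c ∈ Hk then 1 / α * s.price c else s.price c
          k := s.k + 1
          l := s.k + 1 - 2
          H := Function.update s.H s.k Hk
          entitled := fun i => if i ∈ Hk then bundle s.alloc i else s.entitled i }

/-- `σ 0, …, σ L` is an initial segment of an execution of the algorithm. -/
def IsRun {n m : ℕ} (p : ℝ) (w : Profile n m) (L : ℕ) (σ : ℕ → Config n m) : Prop :=
  IsInitial p w (σ 0) ∧ ∀ s < L, Step w (σ s) (σ (s + 1))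

/-! ### The machine model

A random access machine over the reals: integer memory for indices and flags, real memory for
utilities and prices, unit-cost arithmetic and comparisons, no rounding from real to integer
memory, and no real constants other than integers. Programs are finite and structured. The time
of an execution is the number of operations carried out. -/

/-- Memory: arrays addressed by a name (fixed in the program), a row and a column. -/
structure Mem where
  nat : ℕ → ℕ → ℕ → ℕ
  real : ℕ → ℕ → ℕ → ℝ

/-- Integer expressions. Subtraction is truncated. -/
inductive NExp where
  | const (z : ℕ)
  | read (a : ℕ) (row col : NExp)
  | plus (e f : NExp)
  | minus (e f : NExp)

/-- Real expressions. Division by zero gives zero. -/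
inductive RExp where
  | const (z : ℤ)
  | read (a : ℕ) (row col : NExp)
  | plus (e f : RExp)
  | minus (e f : RExp)
  | times (e f : RExp)
  | divide (e f : RExp)

/-- Tests. -/
inductive BExp where
  | natLt (e f : NExp)
  | realLt (e f : RExp)
  | neg (b : BExp)
  | both (b c : BExp)

/-- Programs. -/
inductive Prog where
  | skip
  | setNat (a : ℕ) (row col e : NExp)
  | setReal (a : ℕ) (row col : NExp) (e : RExp)
  | seq (P Q : Prog)
  | cond (b : BExp) (P Q : Prog)
  | loop (b : BExp) (P : Prog)

namespace NExp

def eval (μ : Mem) : NExp → ℕ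
  | const z => z
  | read a r c => μ.nat a (eval μ r) (eval μ c)
  | plus e f => eval μ e + eval μ f
  | minus e f => eval μ e - eval μ f

/-- The number of operations needed to evaluate the expression. -/
def cost : NExp → ℕ
  | const _ => 1
  | read _ r c => cost r + cost c + 1
  | plus e f => cost e + cost f + 1
  | minus e f => cost e + cost f + 1

end NExp

namespace RExp

def eval (μ : Mem) : RExp → ℝ
  | const z => (z : ℝ)
  | read a r c => μ.real a (r.eval μ) (c.eval μ)
  | plus e f => eval μ e + eval μ f
  | minus e f => eval μ e - eval μ f
  | times e f => eval μ e * eval μ f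
  | divide e f => eval μ e / eval μ f

/-- The number of operations needed to evaluate the expression. -/
def cost : RExp → ℕ
  | const _ => 1
  | read _ r c => r.cost + c.cost + 1
  | plus e f => cost e + cost f + 1
  | minus e f => cost e + cost f + 1
  | times e f => cost e + cost f + 1
  | divide e f => cost e + cost f + 1

end RExp

namespace BExp

def holds (μ : Mem) : BExp → Prop
  | natLt e f => e.eval μ < f.eval μ
  | realLt e f => e.eval μ < f.eval μ
  | neg b => ¬ holds μ b
  | both b c => holds μ b ∧ holds μ c

/-- The number of operations needed to evaluate the test. -/
def cost : BExp → ℕ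
  | natLt e f => e.cost + f.cost + 1
  | realLt e f => e.cost + f.cost + 1
  | neg b => cost b + 1
  | both b c => cost b + cost c + 1

end BExp

/-- Writing one cell of an array family. -/
def setCell {α : Type} (A : ℕ → ℕ → ℕ → α) (a r c : ℕ) (z : α) : ℕ → ℕ → ℕ → α :=
  fun a' r' c' => if a' = a ∧ r' = r ∧ c' = c then z else A a' r' c'

/-- `Exec P μ μ' t`: started in memory `μ`, the program `P` halts after exactly `t` operations
with memory `μ'`. -/
inductive Exec : Prog → Mem → Mem → ℕ → Prop
  | skip (μ : Mem) : Exec Prog.skip μ μ 1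
  | setNat (μ : Mem) (a : ℕ) (r c e : NExp) :
      Exec (Prog.setNat a r c e) μ
        { μ with nat := setCell μ.nat a (r.eval μ) (c.eval μ) (e.eval μ) }
        (r.cost + c.cost + e.cost + 1)
  | setReal (μ : Mem) (a : ℕ) (r c : NExp) (e : RExp) :
      Exec (Prog.setReal a r c e) μ
        { μ with real := setCell μ.real a (r.eval μ) (c.eval μ) (e.eval μ) }
        (r.cost + c.cost + e.cost + 1)
  | seq {P Q : Prog} {μ₁ μ₂ μ₃ : Mem} {s t : ℕ} :
      Exec P μ₁ μ₂ s → Exec Q μ₂ μ₃ t → Exec (Prog.seq P Q) μ₁ μ₃ (s + t)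
  | condTrue {b : BExp} {P Q : Prog} {μ μ' : Mem} {t : ℕ} :
      b.holds μ → Exec P μ μ' t → Exec (Prog.cond b P Q) μ μ' (b.cost + t)
  | condFalse {b : BExp} {P Q : Prog} {μ μ' : Mem} {t : ℕ} :
      ¬ b.holds μ → Exec Q μ μ' t → Exec (Prog.cond b P Q) μ μ' (b.cost + t)
  | loopDone {b : BExp} {P : Prog} {μ : Mem} :
      ¬ b.holds μ → Exec (Prog.loop b P) μ μ b.cost
  | loopStep {b : BExp} {P : Prog} {μ₁ μ₂ μ₃ : Mem} {s t : ℕ} :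
      b.holds μ₁ → Exec P μ₁ μ₂ s → Exec (Prog.loop b P) μ₂ μ₃ t →
      Exec (Prog.loop b P) μ₁ μ₃ (b.cost + s + t)

/-! ### Running the algorithm on the machine -/

/-- The input: integer arrays `0` and `1` hold `n` and `m`, real array `0` holds the utilities,
and all other cells are zero. -/
def inputMem {n m : ℕ} (v : Profile n m) : Mem where
  nat := setCell (setCell (fun _ _ _ => 0) 0 0 0 n) 1 0 0 m
  real := fun a r c =>
    if h : a = 0 ∧ r < n ∧ c < m then v ⟨r, h.2.1⟩ ⟨c, h.2.2⟩ else 0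

/-- The code of a phase in memory. -/
def Phase.code : Phase → ℕ
  | Phase.phase2a => 0
  | Phase.phase2b => 1
  | Phase.phase3 => 2
  | Phase.done => 3

/-- The memory `μ` holds the scaled utilities `w` and the variables `s` of the algorithm. Cells
that are not mentioned may be used freely. The allocation is in integer array `2`. -/
def Represents {n m : ℕ} (w : Profile n m) (s : Config n m) (μ : Mem) : Prop :=
  μ.nat 0 0 0 = n ∧ μ.nat 1 0 0 = m ∧
    (∀ c : Fin m, μ.nat 2 0 c = (s.alloc c : ℕ)) ∧
    μ.nat 3 0 0 = s.phase.code ∧ μ.nat 4 0 0 = s.k ∧ μ.nat 5 0 0 = s.l ∧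
    (∀ (t : ℕ) (i : Fin n), μ.nat 6 t i = if i ∈ s.H t then 1 else 0) ∧
    (∀ (i : Fin n) (c : Fin m), μ.nat 7 i c = if c ∈ s.entitled i then 1 else 0) ∧
    (∀ (i : Fin n) (c : Fin m), μ.real 1 i c = w i c) ∧
    ∀ c : Fin m, μ.real 2 0 c = s.price c

/-- The test whether the algorithm has not returned yet. -/
def running : BExp :=
  BExp.natLt (NExp.read 3 (NExp.const 0) (NExp.const 0)) (NExp.const Phase.done.code)

/-- The program that carries out Phase 1 by `start`, and then one step of the algorithm after
another by `body` until the algorithm returns. -/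
def mainProgram (start body : Prog) : Prog :=
  Prog.seq start (Prog.loop running body)

/-- On input `v`, the successive memory contents `mem 0, …, mem L` after `start` and after each
execution of `body` hold the configurations `σ 0, …, σ L`. -/
def Implements {n m : ℕ} (start body : Prog) (v w : Profile n m) (L : ℕ)
    (σ : ℕ → Config n m) (mem : ℕ → Mem) : Prop :=
  (∃ t, Exec start (inputMem v) (mem 0) t) ∧
    (∀ s < L, ∃ t, Exec body (mem s) (mem (s + 1)) t) ∧
    ∀ s ≤ L, Represents w (σ s) (mem s)

end BivaluedChores

end

open BivaluedChores

noncomputable section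

namespace BivaluedChores

/-! ### Bundles and prices -/

section Price

variable {m : ℕ} {price : Fin m → ℝ}

theorem setPrice_nonneg (h : ∀ c, 0 < price c) (S : Finset (Fin m)) : 0 ≤ setPrice price S :=
  Finset.sum_nonneg fun c _ => (h c).le

theorem setPrice_mono (h : ∀ c, 0 < price c) {S T : Finset (Fin m)} (hST : S ⊆ T) :
    setPrice price S ≤ setPrice price T :=
  Finset.sum_le_sum_of_subset_of_nonneg hST fun c _ _ => (h c).le

theorem setPrice_erase {S : Finset (Fin m)} {c : Fin m} (hc : c ∈ S) :
    setPrice price (S.erase c) = setPrice price S - price c := by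
  have := Finset.sum_erase_add S price hc
  unfold setPrice; linarith

theorem setPrice_insert {S : Finset (Fin m)} {c : Fin m} (hc : c ∉ S) :
    setPrice price (insert c S) = setPrice price S + price c := by
  unfold setPrice; rw [Finset.sum_insert hc]; ring

theorem priceUpToOne_empty : priceUpToOne price ∅ = 0 := by simp [priceUpToOne]

/-- Removing the most expensive chore. -/
theorem exists_priceUpToOne_eq {S : Finset (Fin m)} (hS : S.Nonempty) :
    ∃ c ∈ S, priceUpToOne price S = setPrice price (S.erase c) ∧ ∀ c' ∈ S, price c' ≤ price c := by
  obtain ⟨c, hc, h⟩ := Finset.exists_mem_eq_sup' hS price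
  refine ⟨c, hc, ?_, fun c' hc' => h ▸ Finset.le_sup' price hc'⟩
  rw [priceUpToOne, dif_pos hS, h, setPrice_erase hc]

theorem priceUpToOne_le_erase {S : Finset (Fin m)} {c : Fin m} (hc : c ∈ S) :
    priceUpToOne price S ≤ setPrice price (S.erase c) := by
  obtain ⟨c', hc', h, hm⟩ := exists_priceUpToOne_eq (price := price) ⟨c, hc⟩
  rw [h, setPrice_erase hc, setPrice_erase hc']
  linarith [hm c hc]

theorem priceUpToOne_nonneg (h : ∀ c, 0 < price c) (S : Finset (Fin m)) :
    0 ≤ priceUpToOne price S := by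
  rcases S.eq_empty_or_nonempty with rfl | hS
  · rw [priceUpToOne_empty]
  · obtain ⟨c, -, hc, -⟩ := exists_priceUpToOne_eq (price := price) hS
    rw [hc]; exact setPrice_nonneg h _

theorem priceUpToOne_le (h : ∀ c, 0 < price c) (S : Finset (Fin m)) :
    priceUpToOne price S ≤ setPrice price S := by
  rcases S.eq_empty_or_nonempty with rfl | hS
  · rw [priceUpToOne_empty]; exact setPrice_nonneg h _
  · obtain ⟨c, -, hc, -⟩ := exists_priceUpToOne_eq (price := price) hS
    rw [hc]; exact setPrice_mono h (Finset.erase_subset _ _)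

theorem priceUpToOne_mono (h : ∀ c, 0 < price c) {S T : Finset (Fin m)} (hST : S ⊆ T) :
    priceUpToOne price S ≤ priceUpToOne price T := by
  rcases S.eq_empty_or_nonempty with rfl | hS
  · rw [priceUpToOne_empty]; exact priceUpToOne_nonneg h _
  · obtain ⟨c, hc, hT, -⟩ := exists_priceUpToOne_eq (price := price) (hS.mono hST)
    rw [hT]
    by_cases hcS : c ∈ S
    · exact (priceUpToOne_le_erase hcS).trans
        (setPrice_mono h (Finset.erase_subset_erase _ hST))
    · refine (priceUpToOne_le h S).trans (setPrice_mono h fun d hd => ?_)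
      exact Finset.mem_erase.2 ⟨fun e => hcS (e ▸ hd), hST hd⟩

theorem priceUpToOne_insert_le {S : Finset (Fin m)} {c : Fin m} (hc : c ∉ S) :
    priceUpToOne price (insert c S) ≤ setPrice price S := by
  simpa [Finset.erase_insert hc] using
    priceUpToOne_le_erase (price := price) (Finset.mem_insert_self c S)

theorem priceUpToOne_insert_of_max {S : Finset (Fin m)} {c : Fin m} (hc : c ∉ S)
    (hm : ∀ d ∈ S, price d ≤ price c) :
    priceUpToOne price (insert c S) = setPrice price S := by
  refine le_antisymm (priceUpToOne_insert_le hc) ?_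
  obtain ⟨d, hd, h, -⟩ := exists_priceUpToOne_eq (price := price) (Finset.insert_nonempty c S)
  rw [h, setPrice_erase hd, setPrice_insert hc]
  rcases Finset.mem_insert.1 hd with rfl | hd
  · simp
  · linarith [hm d hd]

/-- Exchanging a chore for one of the same price. -/
theorem priceUpToOne_exchange {S : Finset (Fin m)} {c d : Fin m} (hc : c ∉ S)
    (hd : d ∈ insert c S) (hcd : price c = price d) :
    priceUpToOne price ((insert c S).erase d) ≤ priceUpToOne price S := by
  rcases Finset.mem_insert.1 hd with rfl | hdS
  · rw [Finset.erase_insert hc]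
  have hne : d ≠ c := fun e => hc (e ▸ hdS)
  obtain ⟨e, he, h, -⟩ := exists_priceUpToOne_eq (price := price) ⟨d, hdS⟩
  rw [h, setPrice_erase he]
  have hT : setPrice price ((insert c S).erase d) = setPrice price S := by
    rw [setPrice_erase hd, setPrice_insert hc]; linarith
  by_cases hed : e = d
  · subst hed
    refine (priceUpToOne_le_erase (c := c) (by simp [hne.symm])).trans ?_
    rw [setPrice_erase (by simp [hne.symm]), hT, hcd]
  · refine (priceUpToOne_le_erase (c := e) (by simp [hed, he])).trans ?_
    rw [setPrice_erase (by simp [hed, he]), hT]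

theorem priceUpToOne_const_mul {S : Finset (Fin m)} {q : Fin m → ℝ} {a : ℝ} (ha : 0 < a)
    (hq : ∀ c ∈ S, q c = a * price c) :
    priceUpToOne q S = a * priceUpToOne price S := by
  rcases S.eq_empty_or_nonempty with rfl | hS
  · simp [priceUpToOne_empty]
  have hsum : ∀ T ⊆ S, setPrice q T = a * setPrice price T := fun T hT => by
    unfold setPrice
    rw [Finset.mul_sum]
    exact Finset.sum_congr rfl fun c hc => hq c (hT hc)
  obtain ⟨c, hc, h, hm⟩ := exists_priceUpToOne_eq (price := price) hS
  obtain ⟨d, hd, h', hm'⟩ := exists_priceUpToOne_eq (price := q) hS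
  have h1 := priceUpToOne_le_erase (price := q) hc
  have h2 := priceUpToOne_le_erase (price := price) hd
  rw [hsum _ (Finset.erase_subset _ _)] at h1 h'
  apply le_antisymm
  · rw [h]; exact h1
  · rw [h']; exact mul_le_mul_of_nonneg_left h2 ha.le

theorem setPrice_congr {S : Finset (Fin m)} {q : Fin m → ℝ} (hq : ∀ c ∈ S, q c = price c) :
    setPrice q S = setPrice price S :=
  Finset.sum_congr rfl hq

theorem priceUpToOne_congr {S : Finset (Fin m)} {q : Fin m → ℝ} (hq : ∀ c ∈ S, q c = price c) :
    priceUpToOne q S = priceUpToOne price S := by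
  simpa using priceUpToOne_const_mul (a := 1) one_pos (by simpa using hq)

theorem card_le_setPrice (h : ∀ c, 1 ≤ price c) (S : Finset (Fin m)) :
    (S.card : ℝ) ≤ setPrice price S := by
  unfold setPrice
  simpa using Finset.sum_le_sum (s := S) fun c _ => h c

theorem card_sub_one_le_priceUpToOne (h : ∀ c, 1 ≤ price c) (S : Finset (Fin m)) :
    (S.card : ℝ) - 1 ≤ priceUpToOne price S := by
  rcases S.eq_empty_or_nonempty with rfl | hS
  · simp [priceUpToOne_empty]
  obtain ⟨c, hc, h', -⟩ := exists_priceUpToOne_eq (price := price) hS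
  rw [h']
  refine le_trans ?_ (card_le_setPrice h _)
  rw [Finset.card_erase_of_mem hc, Nat.cast_sub (Finset.card_pos.2 hS)]
  simp

end Price

section Bundle

variable {n m : ℕ} {x : Allocation n m} {c : Fin m} {i j : Fin n}

@[simp] theorem mem_bundle : c ∈ bundle x i ↔ x c = i := by simp [bundle]

theorem bundle_update_self (h : x c ≠ j) :
    bundle (Function.update x c j) j = insert c (bundle x j) ∧ c ∉ bundle x j := by
  refine ⟨?_, by simpa using h⟩
  ext d
  by_cases hd : d = c <;> simp [hd]

theorem bundle_update_donor (h : x c ≠ j) :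
    bundle (Function.update x c j) (x c) = (bundle x (x c)).erase c := by
  ext d
  by_cases hd : d = c <;> simp [hd, h.symm]

theorem bundle_update_other (h₁ : i ≠ x c) (h₂ : i ≠ j) :
    bundle (Function.update x c j) i = bundle x i := by
  ext d
  by_cases hd : d = c <;> simp [hd, h₁.symm, h₂.symm]

/-- Price envy-freeness up to one item, in terms of the price up to one chore. -/
theorem priceEF1_iff {price : Fin m → ℝ} (h : ∀ c, 0 < price c) :
    PriceEF1 x price ↔
      ∀ i j, priceUpToOne price (bundle x i) ≤ setPrice price (bundle x j) := by
  refine forall_congr' fun i => forall_congr' fun j => ⟨fun H => ?_, fun H hi => ?_⟩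
  · rcases (bundle x i).eq_empty_or_nonempty with he | hne
    · rw [he, priceUpToOne_empty]; exact setPrice_nonneg h _
    · obtain ⟨c, hc, hle⟩ := H hne
      rw [Finset.sdiff_singleton_eq_erase] at hle
      exact (priceUpToOne_le_erase hc).trans hle
  · obtain ⟨c, hc, he, -⟩ := exists_priceUpToOne_eq (price := price) hi
    exact ⟨c, hc, by rw [Finset.sdiff_singleton_eq_erase, ← he]; exact H⟩

end Bundle

end BivaluedChores

end
noncomputable section

namespace BivaluedChores

/-! ### Scaled profiles -/

/-- The profiles the algorithm works with. -/
structure IsScaled {n m : ℕ} (p : ℝ) (w : Profile n m) : Prop where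
  one_lt : 1 < p
  val : ∀ i c, w i c = -1 ∨ w i c = -p
  easy : ∀ i, 0 < m → ∃ c, w i c = -1

theorem IsScaling.isScaled {n m : ℕ} {v w : Profile n m} {p : ℝ} (h : IsScaling v p w) :
    IsScaled p w :=
  ⟨h.1, h.2.2.1, h.2.2.2⟩

/-- The smallest cost of a chore, over all agents. -/
def baseCost {n m : ℕ} (w : Profile n m) (c : Fin m) : ℝ := |⨆ i, w i c|

namespace IsScaled

variable {n m : ℕ} {p : ℝ} {w : Profile n m} (hw : IsScaled p w)
include hw

theorem pos : 0 < p := one_pos.trans hw.one_lt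

theorem cost_eq (i : Fin n) (c : Fin m) : |w i c| = 1 ∨ |w i c| = p := by
  rcases hw.val i c with h | h
  · left; simp [h]
  · right; rw [h, abs_neg, abs_of_pos hw.pos]

theorem abs_eq_neg (i : Fin n) (c : Fin m) : |w i c| = -w i c := by
  refine abs_of_nonpos ?_
  rcases hw.val i c with h | h <;> rw [h] <;> linarith [hw.one_lt]

theorem exists_baseCost_eq (i : Fin n) (c : Fin m) :
    ∃ j, baseCost w c = |w j c| ∧ ∀ i, |w j c| ≤ |w i c| := by
  have : Nonempty (Fin n) := ⟨i⟩
  obtain ⟨j, hj⟩ := exists_eq_ciSup_of_finite (f := fun i => w i c)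
  refine ⟨j, by rw [baseCost, ← hj], fun i => ?_⟩
  rw [hw.abs_eq_neg, hw.abs_eq_neg, neg_le_neg_iff, hj]
  exact le_ciSup (f := fun i => w i c) (Set.finite_range _).bddAbove i

theorem baseCost_le (i : Fin n) (c : Fin m) : baseCost w c ≤ |w i c| := by
  obtain ⟨j, hj, h⟩ := hw.exists_baseCost_eq i c
  rw [hj]; exact h i

theorem baseCost_eq (i : Fin n) (c : Fin m) : baseCost w c = 1 ∨ baseCost w c = p := by
  obtain ⟨j, hj, h⟩ := hw.exists_baseCost_eq i c
  rw [hj]; exact hw.cost_eq j c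

theorem one_le_baseCost (i : Fin n) (c : Fin m) : 1 ≤ baseCost w c := by
  rcases hw.baseCost_eq i c with h | h <;> rw [h]; exact hw.one_lt.le

theorem baseCost_eq_one {i : Fin n} {c : Fin m} (h : |w i c| = 1) : baseCost w c = 1 :=
  le_antisymm (h ▸ hw.baseCost_le i c) (hw.one_le_baseCost i c)

theorem cost_eq_of_baseCost {i : Fin n} {c : Fin m} (h : baseCost w c ≠ 1) : |w i c| = p :=
  (hw.cost_eq i c).resolve_left fun h' => h (hw.baseCost_eq_one h')

end IsScaled

namespace Config

variable {n m : ℕ}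

/-- Agents whose prices have been reduced. -/
def Reduced (s : Config n m) (i : Fin n) : Prop := ∃ t, i ∈ s.H t

/-- Chores that are entitled by some agent. -/
def IsEntitled (s : Config n m) (c : Fin m) : Prop := ∃ i, c ∈ s.entitled i

open Classical in
/-- The reciprocal of the minimum pain per buck ratio. -/
def invMPB (p : ℝ) (s : Config n m) (i : Fin n) : ℝ := if s.Reduced i then 1 else p

/-- The invariant that holds in all phases. -/
structure Core (p : ℝ) (w : Profile n m) (s : Config n m) : Prop where
  one_le_k : 1 ≤ s.k
  H_out : ∀ t, t = 0 ∨ s.k ≤ t → s.H t = ∅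
  H_nonempty : ∀ t, 1 ≤ t → t < s.k → (s.H t).Nonempty
  H_disj : ∀ t t' i, i ∈ s.H t → i ∈ s.H t' → t = t'
  ent : ∀ i c, c ∈ s.entitled i → s.Reduced i ∧ s.alloc c = i ∧ |w i c| = baseCost w c
  price_ent : ∀ c, s.IsEntitled c → s.price c = baseCost w c
  price_free : ∀ c, ¬ s.IsEntitled c → s.price c = p * baseCost w c
  own : ∀ c, ¬ s.Reduced (s.alloc c) → |w (s.alloc c) c| = baseCost w c
  small : 2 ≤ s.k → ∀ c, ¬ s.IsEntitled c → baseCost w c = 1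
  closed : ∀ t i c, i ∈ s.H t → |w i c| = 1 → ∃ t' ≤ t, ∃ i' ∈ s.H t', c ∈ s.entitled i'
  free_nonempty : 2 ≤ s.k → ∀ i, ¬ s.Reduced i → (bundle s.alloc i).Nonempty
  hist : ∀ t, 1 ≤ t → t < s.k → ∃ (e : ℝ) (y : Allocation n m),
    (∀ i ∈ s.H t, priceUpToOne s.price (s.entitled i) ≤ e) ∧
    (∀ a, (∀ t' ≤ t, a ∉ s.H t') → e < (bundle y a).card) ∧
    ∀ c, (∀ t' ≤ t, y c ∉ s.H t') →
      |w (y c) c| = 1 ∧ ∀ t' ≤ t, ∀ i ∈ s.H t', c ∉ s.entitled i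

namespace Core

variable {p : ℝ} {w : Profile n m} {s : Config n m}

theorem reduced_lt (h : Core p w s) {t : ℕ} {i : Fin n} (hi : i ∈ s.H t) : 1 ≤ t ∧ t < s.k := by
  by_contra hc
  have := h.H_out t (by omega)
  simp [this] at hi

theorem two_le_k (h : Core p w s) {i : Fin n} (hi : s.Reduced i) : 2 ≤ s.k := by
  obtain ⟨t, ht⟩ := hi
  have := h.reduced_lt ht
  omega

theorem entitled_owner (h : Core p w s) {c : Fin m} (hc : s.IsEntitled c) :
    c ∈ s.entitled (s.alloc c) ∧ s.Reduced (s.alloc c) := by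
  obtain ⟨i, hi⟩ := hc
  obtain ⟨h1, h2, -⟩ := h.ent i c hi
  rw [h2]; exact ⟨hi, h1⟩

variable (hw : IsScaled p w) (h : Core p w s)
include hw h

omit hw in
theorem price_free_eq {i : Fin n} {c : Fin m} (hi : s.Reduced i) (hc : ¬ s.IsEntitled c) :
    s.price c = p := by
  rw [h.price_free c hc, h.small (h.two_le_k hi) c hc, mul_one]

theorem price_pos (c : Fin m) : 0 < s.price c := by
  have hb := hw.one_le_baseCost (s.alloc c) c
  by_cases hc : s.IsEntitled c
  · rw [h.price_ent c hc]; linarith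
  · rw [h.price_free c hc]; exact mul_pos hw.pos (by linarith)

theorem one_le_price (c : Fin m) : 1 ≤ s.price c := by
  have hb := hw.one_le_baseCost (s.alloc c) c
  by_cases hc : s.IsEntitled c
  · rwa [h.price_ent c hc]
  · rw [h.price_free c hc]; nlinarith [hw.one_lt]

theorem price_le_of_two_le (hk : 2 ≤ s.k) (c : Fin m) : s.price c ≤ p := by
  by_cases hc : s.IsEntitled c
  · rw [h.price_ent c hc]
    rcases hw.baseCost_eq (s.alloc c) c with e | e <;> rw [e]; exact hw.one_lt.le
  · rw [h.price_free c hc, h.small hk c hc, mul_one]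

theorem cost_of_reduced_free {i : Fin n} {c : Fin m} (hi : s.Reduced i)
    (hc : ¬ s.IsEntitled c) : |w i c| = p := by
  refine (hw.cost_eq i c).resolve_left fun h1 => hc ?_
  obtain ⟨t, ht⟩ := hi
  obtain ⟨t', -, i', -, hi'⟩ := h.closed t i c ht h1
  exact ⟨i', hi'⟩

omit h in
theorem invMPB_pos (i : Fin n) : 0 < s.invMPB p i := by
  unfold invMPB; split_ifs; exacts [one_pos, hw.pos]

theorem price_le (i : Fin n) (c : Fin m) : s.price c ≤ s.invMPB p i * |w i c| := by
  have hb := hw.baseCost_le i c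
  have hb1 := hw.one_le_baseCost i c
  unfold invMPB
  split_ifs with hi
  · rw [one_mul]
    by_cases hc : s.IsEntitled c
    · rwa [h.price_ent c hc]
    · rw [h.price_free_eq hi hc, h.cost_of_reduced_free hw hi hc]
  · by_cases hc : s.IsEntitled c
    · rw [h.price_ent c hc]; nlinarith [hw.one_lt]
    · rw [h.price_free c hc]; exact mul_le_mul_of_nonneg_left hb hw.pos.le

theorem price_owner (c : Fin m) :
    s.price c = s.invMPB p (s.alloc c) * |w (s.alloc c) c| := by
  unfold invMPB
  split_ifs with hi
  · rw [one_mul]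
    by_cases hc : s.IsEntitled c
    · rw [h.price_ent c hc, (h.ent _ c (h.entitled_owner hc).1).2.2]
    · rw [h.price_free_eq hi hc, h.cost_of_reduced_free hw hi hc]
  · rw [h.price_free c fun hc => hi (h.entitled_owner hc).2, h.own c hi]

theorem exists_price_eq (hm : 0 < m) (i : Fin n) :
    ∃ c, s.price c = s.invMPB p i * |w i c| := by
  obtain ⟨c, hc⟩ := hw.easy i hm
  have hc : |w i c| = 1 := by simp [hc]
  unfold invMPB
  split_ifs with hi
  · obtain ⟨t, ht⟩ := hi
    obtain ⟨t', -, i', -, hi'⟩ := h.closed t i c ht hc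
    exact ⟨c, by rw [h.price_ent c ⟨i', hi'⟩, hc, hw.baseCost_eq_one hc, one_mul]⟩
  · by_cases hk : 2 ≤ s.k
    · obtain ⟨d, hd⟩ := h.free_nonempty hk i hi
      obtain rfl := mem_bundle.1 hd
      exact ⟨d, by rw [h.price_owner hw d, invMPB, if_neg hi]⟩
    · refine ⟨c, ?_⟩
      rw [h.price_free c, hc, hw.baseCost_eq_one hc]
      rintro hce
      exact hk (h.two_le_k (h.entitled_owner hce).2)

theorem painPerBuck_ge (i : Fin n) (c : Fin m) :
    1 / s.invMPB p i ≤ painPerBuck w s.price i c := by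
  rw [painPerBuck, div_le_div_iff₀ (invMPB_pos hw i) (h.price_pos hw c), one_mul]
  linarith [h.price_le hw i c]

theorem minPainPerBuck_eq (hm : 0 < m) (i : Fin n) :
    minPainPerBuck w s.price i = 1 / s.invMPB p i := by
  have : Nonempty (Fin m) := ⟨⟨0, hm⟩⟩
  have hpos := invMPB_pos (s := s) hw i
  apply le_antisymm
  · obtain ⟨c, hc⟩ := h.exists_price_eq hw hm i
    refine (ciInf_le (Set.finite_range _).bddBelow c).trans ?_
    rw [painPerBuck, div_le_div_iff₀ (h.price_pos hw c) hpos]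
    linarith
  · exact le_ciInf fun c => h.painPerBuck_ge hw i c

theorem isMPBChore_iff {i : Fin n} {c : Fin m} :
    IsMPBChore w s.price i c ↔ s.price c = s.invMPB p i * |w i c| := by
  have hpos := invMPB_pos (s := s) hw i
  have hpr := h.price_pos hw c
  rw [IsMPBChore, h.minPainPerBuck_eq hw (Fin.pos c), painPerBuck,
    div_eq_div_iff hpr.ne' hpos.ne']
  constructor <;> intro e <;> linarith

theorem mpb_of_reduced {i : Fin n} {c : Fin m} (hi : s.Reduced i) (hc : ¬ s.IsEntitled c) :
    IsMPBChore w s.price i c := by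
  rw [h.isMPBChore_iff hw, invMPB, if_pos hi, h.price_free_eq hi hc,
    h.cost_of_reduced_free hw hi hc, one_mul]

theorem free_of_mpb {i : Fin n} {c : Fin m} (hi : ¬ s.Reduced i)
    (hc : IsMPBChore w s.price i c) : ¬ s.IsEntitled c ∧ |w i c| = baseCost w c := by
  rw [h.isMPBChore_iff hw, invMPB, if_neg hi] at hc
  have hb := hw.baseCost_le i c
  have hb1 := hw.one_le_baseCost i c
  have hp := hw.one_lt
  by_cases he : s.IsEntitled c
  · rw [h.price_ent c he] at hc
    nlinarith
  · rw [h.price_free c he] at hc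
    exact ⟨he, (mul_left_cancel₀ hw.pos.ne' hc).symm⟩

theorem mpb_of_free {i : Fin n} {c : Fin m} (hi : ¬ s.Reduced i) (hc : ¬ s.IsEntitled c)
    (hcost : |w i c| = baseCost w c) : IsMPBChore w s.price i c := by
  rw [h.isMPBChore_iff hw, invMPB, if_neg hi, h.price_free c hc, hcost]

/-- The core invariant survives the transfer of a chore that is not entitled to an agent for
whom it is an MPB chore. -/
theorem transfer {c : Fin m} {j : Fin n} (hc : ¬ s.IsEntitled c)
    (hj : IsMPBChore w s.price j c)
    (hd : s.Reduced (s.alloc c) ∨ ((bundle s.alloc (s.alloc c)).erase c).Nonempty) :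
    Core p w { s with alloc := Function.update s.alloc c j } where
  one_le_k := h.one_le_k
  H_out := h.H_out
  H_nonempty := h.H_nonempty
  H_disj := h.H_disj
  ent i d hd := by
    obtain ⟨h1, h2, h3⟩ := h.ent i d hd
    have hdc : d ≠ c := fun e => hc ⟨i, e ▸ hd⟩
    exact ⟨h1, by simpa [hdc] using h2, h3⟩
  price_ent := h.price_ent
  price_free := h.price_free
  own d hd := by
    by_cases hdc : d = c
    · subst hdc
      simp only [Function.update_self] at hd ⊢
      exact (h.free_of_mpb hw hd hj).2
    · simp only [Function.update_of_ne hdc] at hd ⊢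
      exact h.own d hd
  small := h.small
  closed := h.closed
  free_nonempty hk i hi := by
    obtain ⟨d, hd'⟩ := h.free_nonempty hk i hi
    by_cases hij : i = j
    · exact ⟨c, by simp [hij]⟩
    by_cases hic : i = s.alloc c
    · rcases hd with hd | ⟨e, he⟩
      · exact absurd (hic ▸ hd) hi
      · refine ⟨e, ?_⟩
        simp only [Finset.mem_erase, mem_bundle] at he
        simp [he.1, he.2, hic]
    · refine ⟨d, ?_⟩
      rw [mem_bundle] at hd'
      have : d ≠ c := fun e => hic (by rw [← e, hd'])
      simp [this, hd']
  hist := h.hist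

end Core

end Config

end BivaluedChores

end
noncomputable section

namespace BivaluedChores

namespace Config

variable {n m : ℕ} {p : ℝ} {w : Profile n m} {s : Config n m}

/-! ### Transfers -/

/-- The configuration after the transfer of `c` to `j`. -/
def give (s : Config n m) (c : Fin m) (j : Fin n) : Config n m :=
  { s with alloc := Function.update s.alloc c j }

/-- The bundle of `i` up to one chore is at most as expensive as the bundle of `j`. -/
def Bal (s : Config n m) (i j : Fin n) : Prop := s.spendingUpToOne i ≤ s.spending j

section Give

variable {c : Fin m} {j : Fin n}

theorem spending_give_self (hj : s.alloc c ≠ j) :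
    (s.give c j).spending j = s.spending j + s.price c := by
  obtain ⟨h1, h2⟩ := bundle_update_self hj
  simp only [spending, give, h1, setPrice_insert h2]

theorem spendingUpToOne_give_self (hj : s.alloc c ≠ j) :
    (s.give c j).spendingUpToOne j ≤ s.spending j := by
  obtain ⟨h1, h2⟩ := bundle_update_self hj
  simp only [spendingUpToOne, spending, give, h1]
  exact priceUpToOne_insert_le h2

theorem spending_give_donor (hj : s.alloc c ≠ j) :
    s.spendingUpToOne (s.alloc c) ≤ (s.give c j).spending (s.alloc c) := by
  simp only [spendingUpToOne, spending, give, bundle_update_donor hj]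
  exact priceUpToOne_le_erase (by simp)

theorem spendingUpToOne_give_donor (hpos : ∀ c, 0 < s.price c) (hj : s.alloc c ≠ j) :
    (s.give c j).spendingUpToOne (s.alloc c) ≤ s.spendingUpToOne (s.alloc c) := by
  simp only [spendingUpToOne, give, bundle_update_donor hj]
  exact priceUpToOne_mono hpos (Finset.erase_subset _ _)

theorem spending_give_other {i : Fin n} (h₁ : i ≠ s.alloc c) (h₂ : i ≠ j) :
    (s.give c j).spending i = s.spending i := by
  simp only [spending, give, bundle_update_other h₁ h₂]

theorem spendingUpToOne_give_other {i : Fin n} (h₁ : i ≠ s.alloc c) (h₂ : i ≠ j) :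
    (s.give c j).spendingUpToOne i = s.spendingUpToOne i := by
  simp only [spendingUpToOne, give, bundle_update_other h₁ h₂]

theorem spending_le_give (hpos : ∀ c, 0 < s.price c) (hj : s.alloc c ≠ j) {i : Fin n}
    (hi : i ≠ s.alloc c) : s.spending i ≤ (s.give c j).spending i := by
  by_cases hij : i = j
  · subst hij; rw [spending_give_self hj]; linarith [hpos c]
  · rw [spending_give_other hi hij]

theorem spendingUpToOne_give_le (hpos : ∀ c, 0 < s.price c) (hj : s.alloc c ≠ j) {i : Fin n}
    (hi : i ≠ j) : (s.give c j).spendingUpToOne i ≤ s.spendingUpToOne i := by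
  by_cases hic : i = s.alloc c
  · subst hic; exact spendingUpToOne_give_donor hpos hj
  · rw [spendingUpToOne_give_other hic hi]

end Give

/-! ### Phase 2a -/

/-- The balance conditions of Phase 2a. -/
def Balanced (s : Config n m) : Prop :=
  ∀ a, ∀ i ∈ s.H a, (∀ b, ∀ j ∈ s.H b, b ≤ a ∨ s.l < a → s.Bal i j) ∧
    ∀ j, ¬ s.Reduced j → s.Bal i j

/-- No agent with reduced prices is a violator. -/
def Quiet (s : Config n m) : Prop := ∀ i, s.Reduced i → ∀ j, s.Bal i j

theorem Selects.mem_later {i j : Fin n} (h : s.Selects i j) :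
    ∃ b, s.l < b ∧ b < s.k ∧ j ∈ s.H b := by
  have := h.2.1
  simp only [Finset.mem_biUnion, Finset.mem_Ioo] at this
  obtain ⟨b, hb, hj⟩ := this
  exact ⟨b, hb.1, hb.2, hj⟩

theorem Selects.le {i j : Fin n} (h : s.Selects i j) {b : ℕ} {j' : Fin n} (hl : s.l < b)
    (hk : b < s.k) (hj' : j' ∈ s.H b) : s.spending j ≤ s.spending j' :=
  h.2.2 j' (Finset.mem_biUnion.2 ⟨b, Finset.mem_Ioo.2 ⟨hl, hk⟩, hj'⟩)

theorem Core.exists_selects (h : Core p w s) (hl : 1 ≤ s.l) (hlk : s.l + 2 ≤ s.k) :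
    ∃ i j, s.Selects i j := by
  obtain ⟨i, hi, hmax⟩ :=
    (s.H s.l).exists_max_image s.spendingUpToOne (h.H_nonempty _ hl (by omega))
  have hne : ((Finset.Ioo s.l s.k).biUnion s.H).Nonempty := by
    obtain ⟨j, hj⟩ := h.H_nonempty (s.k - 1) (by omega) (by omega)
    exact ⟨j, Finset.mem_biUnion.2 ⟨s.k - 1, Finset.mem_Ioo.2 ⟨by omega, by omega⟩, hj⟩⟩
  obtain ⟨j, hj, hmin⟩ := Finset.exists_min_image _ s.spending hne
  exact ⟨i, j, ⟨hi, hmax⟩, hj, hmin⟩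

theorem card_filter_mem_eq_sum (x : Allocation n m) (S : Finset (Fin n)) :
    (Finset.univ.filter fun c => x c ∈ S).card = ∑ a ∈ S, (bundle x a).card := by
  rw [Finset.card_eq_sum_card_fiberwise (f := x) (t := S) (by intro c hc; simpa using hc)]
  refine Finset.sum_congr rfl fun a ha => congrArg _ ?_
  ext c
  simp only [Finset.mem_filter, Finset.mem_univ, true_and, mem_bundle]
  exact ⟨fun h => h.2, fun h => ⟨h ▸ ha, h⟩⟩

/-- Phase 2a does not run out of chores that can be transferred. -/
theorem Core.exists_free (hw : IsScaled p w) (h : Core p w s) (hb : s.Balanced)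
    (hl : 1 ≤ s.l) (hlk : s.l + 2 ≤ s.k) {i j : Fin n} (hs : s.Selects i j)
    (hv : s.spendingUpToOne i > s.spending j) :
    (bundle s.alloc i \ s.entitled i).Nonempty := by
  by_contra hcon
  rw [Finset.not_nonempty_iff_eq_empty, Finset.sdiff_eq_empty_iff_subset] at hcon
  have hsub : s.entitled i ⊆ bundle s.alloc i := fun c hc => by simpa using (h.ent i c hc).2.1
  have hbi : bundle s.alloc i = s.entitled i := hcon.antisymm hsub
  obtain ⟨e, y, he, hy, hyc⟩ := h.hist s.l hl (by omega)
  have hie : s.spendingUpToOne i ≤ e := by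
    rw [spendingUpToOne, hbi]; exact he i hs.1.1
  set later := (Finset.Ioo s.l s.k).biUnion s.H with hlater
  have hmem : ∀ a, a ∈ later ↔ ∃ b, s.l < b ∧ b < s.k ∧ a ∈ s.H b := by
    intro a
    simp only [hlater, Finset.mem_biUnion, Finset.mem_Ioo, and_assoc]
  have hnot : ∀ a ∈ later, ∀ t' ≤ s.l, a ∉ s.H t' := by
    intro a ha t' ht' hat
    obtain ⟨b, hb1, -, hb2⟩ := (hmem a).1 ha
    have := h.H_disj _ _ a hat hb2
    omega
  have hcard : ∑ a ∈ later, (bundle y a).card ≤ ∑ a ∈ later, (bundle s.alloc a).card := by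
    rw [← card_filter_mem_eq_sum, ← card_filter_mem_eq_sum]
    refine Finset.card_le_card fun c hc => ?_
    simp only [Finset.mem_filter, Finset.mem_univ, true_and] at hc ⊢
    obtain ⟨hc1, hc2⟩ := hyc c (hnot _ hc)
    obtain ⟨b, hb1, hb2, hb3⟩ := (hmem _).1 hc
    obtain ⟨t', ht', i', hi', hci'⟩ := h.closed b _ c hb3 hc1
    rw [(h.ent i' c hci').2.1, hmem]
    refine ⟨t', ?_, by omega, hi'⟩
    by_contra hlt
    exact hc2 t' (by omega) i' hi' hci'
  have hj : j ∈ later := hs.2.1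
  have hjlt : (bundle s.alloc j).card < (bundle y j).card := by
    have h1 := card_le_setPrice (h.one_le_price hw) (bundle s.alloc j)
    have h2 := hy j (hnot j hj)
    have h3 : setPrice s.price (bundle s.alloc j) = s.spending j := rfl
    exact_mod_cast (by linarith : ((bundle s.alloc j).card : ℝ) < (bundle y j).card)
  obtain ⟨a, ha, hlt⟩ : ∃ a ∈ later, (bundle y a).card < (bundle s.alloc a).card := by
    by_contra! hall
    exact absurd hcard (not_le.2 (Finset.sum_lt_sum hall ⟨j, hj, hjlt⟩))
  have h1 := card_sub_one_le_priceUpToOne (h.one_le_price hw) (bundle s.alloc a)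
  have h2 := hy a (hnot a ha)
  obtain ⟨b, hb1, hb2, hb3⟩ := (hmem a).1 ha
  obtain ⟨b', hb1', hb2', hb3'⟩ := (hmem j).1 hj
  have h3 : s.spendingUpToOne a ≤ s.spending j := (hb b a hb3).1 b' j hb3' (Or.inr hb1)
  have h4 : ((bundle y a).card : ℝ) + 1 ≤ (bundle s.alloc a).card := by exact_mod_cast hlt
  have h5 : s.spendingUpToOne a = priceUpToOne s.price (bundle s.alloc a) := rfl
  linarith

theorem Core.balanced_give (hw : IsScaled p w) (h : Core p w s) (hb : s.Balanced)
    {c : Fin m} {j : Fin n} (hs : s.Selects (s.alloc c) j)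
    (hv : s.spendingUpToOne (s.alloc c) > s.spending j) : (s.give c j).Balanced := by
  have hpos := h.price_pos hw
  have hne : s.alloc c ≠ j := by
    rintro rfl
    exact absurd hv (not_lt.2 (priceUpToOne_le hpos _))
  obtain ⟨bj, hlj, hjk, hj⟩ := hs.mem_later
  have hi := hs.1.1
  have hred : ∀ j', ¬ s.Reduced j' → j' ≠ s.alloc c := by
    rintro _ hj' rfl; exact hj' ⟨_, hi⟩
  have hdon := spending_give_donor (s := s) hne
  intro a u hu
  change u ∈ s.H a at hu
  by_cases huj : u = j
  · subst huj
    obtain rfl := h.H_disj _ _ _ hu hj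
    have hself := spendingUpToOne_give_self (s := s) hne
    refine ⟨fun b v hv' hba => hself.trans ?_, fun r hr => hself.trans ?_⟩
    · change v ∈ s.H b at hv'
      by_cases hvi : v = s.alloc c
      · subst hvi; linarith
      refine le_trans ?_ (spending_le_give hpos hne hvi)
      by_cases hbl : s.l < b
      · exact hs.le hbl (h.reduced_lt hv').2 hv'
      · have : s.Bal (s.alloc c) v := (hb _ _ hi).1 b v hv' (by omega)
        exact hv.le.trans this
    · refine le_trans ?_ (spending_le_give hpos hne (hred r hr))
      exact hv.le.trans ((hb _ _ hi).2 r hr)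
  · refine ⟨fun b v hv' hba => (spendingUpToOne_give_le hpos hne huj).trans ?_,
      fun r hr => (spendingUpToOne_give_le hpos hne huj).trans ?_⟩
    · change v ∈ s.H b at hv'
      change b ≤ a ∨ s.l < a at hba
      by_cases hvi : v = s.alloc c
      · subst hvi
        obtain rfl := h.H_disj _ _ _ hv' hi
        refine le_trans ?_ hdon
        by_cases hla : s.l < a
        · have : s.Bal u j := (hb a u hu).1 bj j hj (Or.inr hla)
          exact this.trans hv.le
        · have : s.l = a := by omega
          exact hs.1.2 u (this ▸ hu)
      · exact ((hb a u hu).1 b v hv' hba).trans (spending_le_give hpos hne hvi)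
    · exact ((hb a u hu).2 r hr).trans (spending_le_give hpos hne (hred r hr))

theorem Core.balanced_next (h : Core p w s) (hb : s.Balanced) (hl : 1 ≤ s.l) {i j : Fin n}
    (hs : s.Selects i j) (hv : ¬ s.spendingUpToOne i > s.spending j) :
    Balanced { s with l := s.l - 1 } := by
  intro a u hu
  change u ∈ s.H a at hu
  refine ⟨fun b v hv' hba => ?_, (hb a u hu).2⟩
  change v ∈ s.H b at hv'
  change b ≤ a ∨ s.l - 1 < a at hba
  change s.Bal u v
  by_cases hba' : b ≤ a ∨ s.l < a
  · exact (hb a u hu).1 b v hv' hba'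
  · have hal : a = s.l := by omega
    subst hal
    have h1 := hs.1.2 u hu
    have h2 := hs.le (by omega) (h.reduced_lt hv').2 hv'
    exact (h1.trans (not_lt.1 hv)).trans h2

theorem Core.quiet_of_balanced (h : Core p w s) (hb : s.Balanced) (hl : s.l = 0) : s.Quiet := by
  rintro i ⟨a, hi⟩ j
  by_cases hj : s.Reduced j
  · obtain ⟨b, hj⟩ := hj
    exact (hb a i hi).1 b j hj (Or.inr (by have := h.reduced_lt hi; omega))
  · exact (hb a i hi).2 j hj

end Config

end BivaluedChores

end
noncomputable section

namespace BivaluedChores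

namespace Config

variable {n m : ℕ} {p : ℝ} {w : Profile n m} {s : Config n m}

/-! ### Phase 2b -/

theorem LeastSpender.eq {i j : Fin n} (hi : s.LeastSpender i) (hj : s.LeastSpender j) :
    s.spending i = s.spending j :=
  (hi j).antisymm (hj i)

theorem exists_leastSpender (hn : 0 < n) (s : Config n m) : ∃ i, s.LeastSpender i := by
  have : Nonempty (Fin n) := ⟨⟨0, hn⟩⟩
  obtain ⟨i, -, hi⟩ := Finset.exists_min_image Finset.univ s.spending Finset.univ_nonempty
  exact ⟨i, fun j => hi j (Finset.mem_univ j)⟩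

/-- The agent `i` with reduced prices has received a chore that it can pass on along a path of
length `t`; all other agents with reduced prices are no violators. -/
structure Pending (w : Profile n m) (s : Config n m) (i : Fin n) (t : ℕ) : Prop where
  others : ∀ u, s.Reduced u → u ≠ i → ∀ v, s.Bal u v
  erase : ∀ c, s.alloc c = i → ¬ s.IsEntitled c →
    ∀ v, priceUpToOne s.price ((bundle s.alloc i).erase c) ≤ s.spending v
  near : ∀ ls t' a, s.LeastSpender ls → t' < t → AltPath w s ls t' a → ¬ s.Reduced a
  path : ∃ ls, s.ViolatorPath w ls t i
  unique : ∀ ls t' a, t' ≤ t → s.ViolatorPath w ls t' a → a = i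

/-- The data of a transfer in Phase 2b. -/
structure Move (w : Profile n m) (s : Config n m) (ls j : Fin n) (c : Fin m) (d : ℕ) : Prop where
  path : AltPath w s ls d j
  mpb : IsMPBChore w s.price j c
  violator : s.ViolatorPath w ls (d + 1) (s.alloc c)
  min : ∀ ls' d' i', s.ViolatorPath w ls' d' i' → d + 1 ≤ d'

namespace Move

variable {ls j : Fin n} {c : Fin m} {d : ℕ} (hM : Move w s ls j c d)
include hM

theorem ne : s.alloc c ≠ j := by
  intro e
  have := hM.min ls d j ⟨hM.violator.1, hM.path, e ▸ hM.violator.2.2⟩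
  omega

theorem lt_donor : s.spending ls < (s.give c j).spending (s.alloc c) :=
  lt_of_lt_of_le hM.violator.2.2 (spending_give_donor hM.ne)

variable (hpos : ∀ c, 0 < s.price c)
include hpos

theorem le_spending (v : Fin n) : s.spending ls ≤ (s.give c j).spending v := by
  by_cases hv : v = s.alloc c
  · subst hv; exact hM.lt_donor.le
  · exact (hM.violator.1 v).trans (spending_le_give hpos hM.ne hv)

theorem ls_ne_donor : ls ≠ s.alloc c := by
  intro e
  have h1 := hM.violator.2.2
  have h2 := priceUpToOne_le hpos (bundle s.alloc (s.alloc c))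
  rw [← e] at h1 h2
  exact absurd h1 (not_lt.2 h2)

theorem leastSpender_of_give {v : Fin n} (hv : (s.give c j).spending v ≤ s.spending ls) :
    s.LeastSpender v := by
  have hne : v ≠ s.alloc c := by
    rintro rfl
    exact absurd hv (not_le.2 hM.lt_donor)
  intro u
  exact ((spending_le_give hpos hM.ne hne).trans hv).trans (hM.violator.1 u)

omit hpos in
/-- Distances from the least spenders do not decrease. -/
theorem altPath_of_give
    (hLS : ∀ v, (s.give c j).LeastSpender v → s.LeastSpender v) {v a : Fin n} {t : ℕ}
    (hv : (s.give c j).LeastSpender v) (hP : AltPath w (s.give c j) v t a) :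
    ∃ u t', t' ≤ t ∧ s.LeastSpender u ∧ AltPath w s u t' a := by
  induction hP with
  | refl => exact ⟨v, 0, le_rfl, hLS v hv, AltPath.refl⟩
  | @snoc t b a e _ hA ih =>
    obtain ⟨u, t', ht', hu, hP⟩ := ih
    obtain ⟨ha, hmpb⟩ := hA
    change Function.update s.alloc c j e = a at ha
    change IsMPBChore w s.price b e at hmpb
    by_cases hec : e = c
    · subst hec
      rw [Function.update_self] at ha
      subst ha
      have hv : s.ViolatorPath w u (t' + 1) (s.alloc e) :=
        ⟨hu, hP.snoc ⟨rfl, hmpb⟩, hu.eq hM.violator.1 ▸ hM.violator.2.2⟩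
      have := hM.min _ _ _ hv
      exact ⟨ls, d, by omega, hM.violator.1, hM.path⟩
    · rw [Function.update_of_ne hec] at ha
      exact ⟨u, t' + 1, by omega, hu, hP.snoc ⟨ha, hmpb⟩⟩

omit hpos in
theorem altPath_give {v a : Fin n} {t : ℕ} (hv : s.LeastSpender v) (hP : AltPath w s v t a)
    (ht : t ≤ d) : AltPath w (s.give c j) v t a := by
  induction hP with
  | refl => exact AltPath.refl
  | @snoc t b a e hP hA ih =>
    refine (ih (by omega)).snoc ⟨?_, hA.2⟩
    change Function.update s.alloc c j e = a
    have hec : e ≠ c := by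
      rintro rfl
      have hv : s.ViolatorPath w v (t + 1) (s.alloc e) :=
        ⟨hv, hP.snoc ⟨rfl, hA.2⟩, hv.eq hM.violator.1 ▸ hM.violator.2.2⟩
      have := hM.min _ _ _ hv
      omega
    rw [Function.update_of_ne hec, hA.1]

theorem donor_nonempty : ((bundle s.alloc (s.alloc c)).erase c).Nonempty := by
  have h1 := hM.violator.2.2
  have h2 : s.spendingUpToOne (s.alloc c) ≤ _ :=
    priceUpToOne_le_erase (price := s.price) (c := c) (S := bundle s.alloc (s.alloc c)) (by simp)
  have h3 : 0 ≤ s.spending ls := setPrice_nonneg hpos _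
  rw [Finset.nonempty_iff_ne_empty]
  intro he
  rw [he] at h2
  simp only [setPrice, Finset.sum_empty] at h2
  linarith

omit hpos in
theorem quiet_or_pending (hw : IsScaled p w) (h : Core p w s)
    (hq : s.Quiet ∨ ∃ i t, Pending w s i t) :
    ¬ s.IsEntitled c ∧ ((s.give c j).Quiet ∨ ∃ i t, Pending w (s.give c j) i t) := by
  have hpos := h.price_pos hw
  have hle := hM.le_spending hpos
  have hviol := hM.violator.2.2
  have hother : ∀ u, u ≠ j → (∀ v, s.Bal u v) → ∀ v, (s.give c j).Bal u v := fun u hu hb v =>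
    ((spendingUpToOne_give_le hpos hM.ne hu).trans (hb ls)).trans (hle v)
  rcases hq with hq | ⟨i, t, hp⟩
  · have hdon : ¬ s.Reduced (s.alloc c) := fun hr => absurd hviol (not_lt.2 (hq _ hr ls))
    have hfree : ¬ s.IsEntitled c := fun he => hdon (h.entitled_owner he).2
    refine ⟨hfree, ?_⟩
    by_cases hj : s.Reduced j
    swap
    · left
      intro u hu
      exact hother u (fun e => hj (e ▸ hu)) (hq u hu)
    by_cases hjl : s.LeastSpender j
    · left
      intro u hu
      by_cases huj : u = j
      · subst huj
        intro v
        refine ((spendingUpToOne_give_self hM.ne).trans ?_).trans (hle v)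
        exact hjl ls
      · exact hother u huj (hq u hu)
    · right
      have hlsj : ls ≠ j := fun e => hjl (e ▸ hM.violator.1)
      have hls : (s.give c j).spending ls = s.spending ls :=
        spending_give_other (hM.ls_ne_donor hpos) hlsj
      have hLS : ∀ v, (s.give c j).LeastSpender v → s.LeastSpender v := fun v hv =>
        hM.leastSpender_of_give hpos (hls ▸ hv ls)
      have hprice : ∀ e, ¬ s.IsEntitled e → s.price e = p := fun e he =>
        h.price_free_eq hj he
      obtain ⟨hins, hcj⟩ := bundle_update_self hM.ne
      refine ⟨j, d, fun u hu huj => hother u huj (hq u hu), ?_, ?_, ?_, ?_⟩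
      · intro e he hef v
        change priceUpToOne s.price ((bundle (Function.update s.alloc c j) j).erase e) ≤ _
        have hmem : e ∈ bundle (Function.update s.alloc c j) j := by rw [mem_bundle]; exact he
        rw [hins] at hmem ⊢
        refine (priceUpToOne_exchange hcj hmem ?_).trans ((hq j hj ls).trans (hle v))
        rw [hprice c hfree, hprice e hef]
      · intro v t' a hv ht' hP ha
        obtain ⟨u, t'', ht'', hu, hP'⟩ := hM.altPath_of_give hLS hv hP
        have := hM.min u (t'' + 1) (s.alloc c)
          ⟨hu, hP'.snoc ⟨rfl, h.mpb_of_reduced hw ha hfree⟩, hu.eq hM.violator.1 ▸ hviol⟩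
        omega
      · refine ⟨ls, fun v => hls ▸ hle v, hM.altPath_give hM.violator.1 hM.path le_rfl, ?_⟩
        have hUp : (s.give c j).spendingUpToOne j = s.spending j := by
          change priceUpToOne s.price (bundle (Function.update s.alloc c j) j) = _
          rw [hins]
          refine priceUpToOne_insert_of_max hcj fun e _ => ?_
          rw [hprice c hfree]
          exact h.price_le_of_two_le hw (h.two_le_k hj) e
        rw [hls, hUp]
        refine lt_of_le_of_ne (hM.violator.1 j) fun e => hjl fun v => ?_
        rw [← e]; exact hM.violator.1 v
      · intro v t' a ht' hP
        by_contra haj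
        obtain ⟨u, t'', ht'', hu, hP'⟩ := hM.altPath_of_give hLS hP.1 hP.2.1
        have h1 := hP.2.2
        have h2 := hle v
        have h3 := spendingUpToOne_give_le hpos hM.ne haj
        have h4 := hu.eq hM.violator.1
        have := hM.min u t'' a ⟨hu, hP', by linarith⟩
        omega
  · obtain ⟨ls0, h0⟩ := hp.path
    have hdt := hM.min _ _ _ h0
    have hci : s.alloc c = i := hp.unique _ _ _ hdt hM.violator
    have hj : ¬ s.Reduced j := hp.near ls d j hM.violator.1 (by omega) hM.path
    have hfree := (h.free_of_mpb hw hj hM.mpb).1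
    refine ⟨hfree, Or.inl fun u hu => ?_⟩
    have huj : u ≠ j := fun e => hj (e ▸ hu)
    by_cases hui : u = i
    · subst hui
      intro v
      refine le_trans ?_ (hle v)
      change priceUpToOne s.price (bundle (Function.update s.alloc c j) u) ≤ _
      rw [← hci, bundle_update_donor hM.ne, hci]
      exact hp.erase c hci hfree ls
    · exact hother u huj (hp.others u hu hui)

end Move

/-- Without violators on alternating paths there is no pending agent. -/
theorem quiet_of_no_violatorPath (hq : s.Quiet ∨ ∃ i t, Pending w s i t)
    (hv : ¬ ∃ ls d i, s.ViolatorPath w ls d i) : s.Quiet := by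
  rcases hq with hq | ⟨i, t, hp⟩
  · exact hq
  · obtain ⟨ls, h⟩ := hp.path
    exact absurd ⟨ls, t, i, h⟩ hv

/-- A violator path has positive length, so that the last chore on a shortest one can be moved. -/
theorem Core.exists_move (hw : IsScaled p w) (h : Core p w s)
    (hv : ∃ ls d i, s.ViolatorPath w ls d i) : ∃ ls j c d, Move w s ls j c d := by
  classical
  have hex : ∃ d, ∃ ls i, s.ViolatorPath w ls d i := by
    obtain ⟨ls, d, i, h⟩ := hv; exact ⟨d, ls, i, h⟩
  obtain ⟨ls, i, hP⟩ := Nat.find_spec hex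
  have hmin : ∀ ls' d' i', s.ViolatorPath w ls' d' i' → Nat.find hex ≤ d' :=
    fun ls' d' i' h' => Nat.find_min' hex ⟨ls', i', h'⟩
  obtain ⟨h1, h2, h3⟩ := hP
  generalize Nat.find hex = d at *
  cases h2 with
  | refl => exact absurd h3 (not_lt.2 (priceUpToOne_le (h.price_pos hw) _))
  | @snoc d j _ c hj ha =>
    obtain ⟨rfl, hm⟩ := ha
    exact ⟨ls, j, c, d, hj, hm, ⟨h1, hj.snoc ⟨rfl, hm⟩, h3⟩, hmin⟩

/-! ### Lengths of shortest paths -/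

theorem AltPath.exists_seq {ls i : Fin n} {d : ℕ} (hP : AltPath w s ls d i) :
    ∃ f : ℕ → Fin n, f 0 = ls ∧ f d = i ∧ ∀ t < d, ∃ c, Arrow w s (f t) c (f (t + 1)) := by
  induction hP with
  | refl => exact ⟨fun _ => ls, rfl, rfl, by simp⟩
  | @snoc d j i c _ hA ih =>
    obtain ⟨f, h0, hd, hf⟩ := ih
    refine ⟨Function.update f (d + 1) i, by simp [h0], by simp, fun t ht => ?_⟩
    rcases Nat.lt_succ_iff_lt_or_eq.1 ht with htd | rfl
    · rw [Function.update_of_ne (by omega), Function.update_of_ne (by omega)]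
      exact hf t htd
    · rw [Function.update_of_ne (by omega), Function.update_self, hd]
      exact ⟨c, hA⟩

theorem AltPath.extend {ls : Fin n} {d : ℕ} {f : ℕ → Fin n} {a : ℕ}
    (hP : AltPath w s ls d (f a)) (r : ℕ)
    (hf : ∀ t, a ≤ t → t < a + r → ∃ c, Arrow w s (f t) c (f (t + 1))) :
    AltPath w s ls (d + r) (f (a + r)) := by
  induction r with
  | zero => exact hP
  | succ r ih =>
    obtain ⟨c, hc⟩ := hf (a + r) (by omega) (by omega)
    exact (ih fun t h1 h2 => hf t h1 (by omega)).snoc hc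

/-- Shortest paths visit every agent at most once. -/
theorem AltPath.lt_of_shortest {ls i : Fin n} {d : ℕ} (hP : AltPath w s ls d i)
    (hmin : ∀ d', AltPath w s ls d' i → d ≤ d') : d < n := by
  obtain ⟨f, h0, hd, hf⟩ := hP.exists_seq
  have hinit : ∀ t ≤ d, AltPath w s ls t (f t) := fun t ht => by
    have := (AltPath.refl (w := w) (s := s) (i₀ := f 0)).extend (f := f) (a := 0) t
      fun t' _ h2 => hf t' (by omega)
    simpa [h0] using this
  have hne : ∀ a b, a < b → b ≤ d → f a ≠ f b := fun a b hab hbd e => by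
    have h1 := hinit a (by omega)
    rw [e] at h1
    have h2 := h1.extend (d - b) fun t _ h2 => hf t (by omega)
    rw [show b + (d - b) = d by omega, hd] at h2
    have := hmin _ h2
    omega
  have hinj : Set.InjOn f (Finset.range (d + 1) : Finset ℕ) := by
    intro a ha b hb hab
    simp only [Finset.coe_range, Set.mem_Iio] at ha hb
    rcases lt_trichotomy a b with h | h | h
    · exact absurd hab (hne a b h (by omega))
    · exact h
    · exact absurd hab.symm (hne b a h (by omega))
  have := Finset.card_le_card_of_injOn (t := Finset.univ) f (by simp) hinj
  simpa using this

theorem Move.lt {ls j : Fin n} {c : Fin m} {d : ℕ} (hM : Move w s ls j c d) : d + 1 < n :=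
  hM.violator.2.1.lt_of_shortest fun d' hd' =>
    hM.min ls d' _ ⟨hM.violator.1, hd', hM.violator.2.2⟩

end Config

end BivaluedChores

end
noncomputable section

namespace BivaluedChores

namespace Config

variable {n m : ℕ} {p : ℝ} {w : Profile n m} {s : Config n m}

/-! ### Termination of Phase 2b -/

/-- The distance from the least spenders, at most `n`. -/
def dist (w : Profile n m) (s : Config n m) (a : Fin n) : ℕ :=
  sInf {t | t = n ∨ ∃ ls, s.LeastSpender ls ∧ AltPath w s ls t a}

theorem dist_mem (w : Profile n m) (s : Config n m) (a : Fin n) :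
    dist w s a = n ∨ ∃ ls, s.LeastSpender ls ∧ AltPath w s ls (dist w s a) a :=
  Nat.sInf_mem (s := {t | t = n ∨ ∃ ls, s.LeastSpender ls ∧ AltPath w s ls t a}) ⟨n, Or.inl rfl⟩

theorem dist_le (a : Fin n) : dist w s a ≤ n := Nat.sInf_le (Or.inl rfl)

theorem dist_le_of_altPath {ls a : Fin n} {t : ℕ} (h : s.LeastSpender ls)
    (hP : AltPath w s ls t a) : dist w s a ≤ t :=
  Nat.sInf_le (Or.inr ⟨ls, h, hP⟩)

/-- The potential that decreases while the minimum spending is unchanged. -/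
def potential (w : Profile n m) (s : Config n m) : ℕ :=
  (∑ a, (n - dist w s a)) * (n * m + 1) + ∑ c, dist w s (s.alloc c)

theorem potential_le : potential w s ≤ n * n * (n * m + 1) + n * m := by
  refine Nat.add_le_add (Nat.mul_le_mul_right _ ?_) ?_
  · simpa using Finset.sum_le_sum (s := Finset.univ) fun a _ => Nat.sub_le n (dist w s a)
  · simpa [mul_comm] using
      Finset.sum_le_sum (s := Finset.univ) fun c _ => dist_le (w := w) (s := s) (s.alloc c)

/-- The smallest possible price. -/
def unit (p : ℝ) (s : Config n m) : ℝ := if 2 ≤ s.k then 1 else p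

theorem Core.price_eq_unit (hw : IsScaled p w) (h : Core p w s) (c : Fin m) :
    s.price c = s.unit p ∨ s.price c = s.unit p * p := by
  have hb := hw.baseCost_eq (s.alloc c) c
  unfold unit
  split_ifs with hk
  · by_cases hc : s.IsEntitled c
    · simpa [h.price_ent c hc] using hb
    · right; rw [h.price_free c hc, h.small hk c hc]; ring
  · have hc : ¬ s.IsEntitled c := fun hc => hk (h.two_le_k (h.entitled_owner hc).2)
    rw [h.price_free c hc]
    rcases hb with e | e <;> simp [e]

theorem Core.spending_eq_unit (hw : IsScaled p w) (h : Core p w s) (i : Fin n) :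
    ∃ a b : ℕ, a ≤ m ∧ b ≤ m ∧ s.spending i = s.unit p * (a + b * p) := by
  classical
  set S := bundle s.alloc i
  refine ⟨(S.filter fun c => s.price c = s.unit p).card,
    (S.filter fun c => ¬ s.price c = s.unit p).card,
    (Finset.card_le_univ _).trans (by simp), (Finset.card_le_univ _).trans (by simp), ?_⟩
  rw [spending, setPrice, ← Finset.sum_filter_add_sum_filter_not S fun c => s.price c = s.unit p]
  rw [Finset.sum_congr rfl (g := fun _ => s.unit p) fun c hc => (Finset.mem_filter.1 hc).2,
    Finset.sum_congr rfl (s₁ := S.filter fun c => ¬ s.price c = s.unit p)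
      (g := fun _ => s.unit p * p) fun c hc =>
        (h.price_eq_unit hw c).resolve_left (Finset.mem_filter.1 hc).2]
  simp only [Finset.sum_const, nsmul_eq_mul]
  ring

open Classical in
/-- The possible spending levels above the current minimum spending. -/
def levels (p : ℝ) (s : Config n m) : Finset (ℕ × ℕ) :=
  (Finset.range (m + 1) ×ˢ Finset.range (m + 1)).filter fun ab =>
    ∃ i, s.spending i < s.unit p * (ab.1 + ab.2 * p)

theorem card_levels_le : (levels p s).card ≤ (m + 1) * (m + 1) := by
  refine (Finset.card_filter_le _ _).trans ?_
  simp

/-- The measure for Phase 2b. -/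
def measure2b (p : ℝ) (w : Profile n m) (s : Config n m) : ℕ :=
  (levels p s).card * (n * n * (n * m + 1) + n * m + 1) + potential w s

theorem measure2b_le : measure2b p w s ≤
    (m + 1) * (m + 1) * (n * n * (n * m + 1) + n * m + 1) + (n * n * (n * m + 1) + n * m) :=
  Nat.add_le_add (Nat.mul_le_mul_right _ card_levels_le) potential_le

namespace Move

variable {ls j : Fin n} {c : Fin m} {d : ℕ} (hM : Move w s ls j c d)
include hM

theorem potential_lt (hLS : ∀ v, (s.give c j).LeastSpender v → s.LeastSpender v) :
    potential w (s.give c j) < potential w s := by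
  have hmono : ∀ a, dist w s a ≤ dist w (s.give c j) a := fun a => by
    rcases dist_mem w (s.give c j) a with h | ⟨v, hv, hP⟩
    · rw [h]; exact dist_le a
    · obtain ⟨u, t', ht', hu, hP'⟩ := hM.altPath_of_give hLS hv hP
      exact (dist_le_of_altPath hu hP').trans ht'
  have hsub : ∀ a, n - dist w (s.give c j) a ≤ n - dist w s a := fun a =>
    Nat.sub_le_sub_left (hmono a) n
  unfold potential
  by_cases hall : ∀ a, dist w (s.give c j) a = dist w s a
  · simp only [hall]
    refine Nat.add_lt_add_left (Finset.sum_lt_sum (fun e _ => ?_) ⟨c, Finset.mem_univ _, ?_⟩) _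
    all_goals
      have h1 : dist w s j ≤ d := dist_le_of_altPath hM.violator.1 hM.path
      have h2 : d + 1 ≤ dist w s (s.alloc c) := by
        rcases dist_mem w s (s.alloc c) with h | ⟨u, hu, hP⟩
        · rw [h]; exact hM.lt.le
        · exact hM.min _ _ _ ⟨hu, hP, hu.eq hM.violator.1 ▸ hM.violator.2.2⟩
    · change dist w s (Function.update s.alloc c j e) ≤ _
      by_cases hec : e = c
      · subst hec; rw [Function.update_self]; omega
      · rw [Function.update_of_ne hec]
    · change dist w s (Function.update s.alloc c j c) < _
      rw [Function.update_self]; omega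
  · push Not at hall
    obtain ⟨a, ha⟩ := hall
    have h1 : ∑ a, (n - dist w (s.give c j) a) < ∑ a, (n - dist w s a) := by
      refine Finset.sum_lt_sum (fun a _ => hsub a) ⟨a, Finset.mem_univ _, ?_⟩
      have := hmono a
      have := dist_le (w := w) (s := s.give c j) a
      omega
    have h2 : ∑ e, dist w (s.give c j) ((s.give c j).alloc e) ≤ n * m := by
      simpa [mul_comm] using
        Finset.sum_le_sum (s := Finset.univ) fun e _ =>
          dist_le (w := w) (s := s.give c j) ((s.give c j).alloc e)
    have h3 := Nat.mul_le_mul_right (n * m + 1) (Nat.succ_le_of_lt h1)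
    rw [Nat.succ_mul] at h3
    omega

theorem measure2b_lt (hw : IsScaled p w) (h : Core p w s)
    (h' : Core p w (s.give c j)) : measure2b p w (s.give c j) < measure2b p w s := by
  have hpos := h.price_pos hw
  have hle := hM.le_spending hpos
  have hsub : levels p (s.give c j) ⊆ levels p s := by
    intro ab hab
    simp only [levels, Finset.mem_filter] at hab ⊢
    obtain ⟨h1, i, hi⟩ := hab
    exact ⟨h1, ls, (hle i).trans_lt hi⟩
  unfold measure2b
  by_cases hex : ∃ v, (s.give c j).spending v ≤ s.spending ls
  · obtain ⟨v, hv⟩ := hex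
    refine Nat.add_lt_add_of_le_of_lt (Nat.mul_le_mul_right _ (Finset.card_le_card hsub))
      (hM.potential_lt fun u hu => hM.leastSpender_of_give hpos ((hu v).trans hv))
  · push Not at hex
    obtain ⟨v, hv⟩ := exists_leastSpender (Fin.pos ls) (s.give c j)
    obtain ⟨a, b, ha, hb, hab⟩ := h'.spending_eq_unit hw v
    have hlt : (levels p (s.give c j)).card < (levels p s).card := by
      refine Finset.card_lt_card ⟨hsub, fun hsup => ?_⟩
      have hmem : (a, b) ∈ levels p s := by
        simp only [levels, Finset.mem_filter, Finset.mem_product, Finset.mem_range]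
        refine ⟨⟨by omega, by omega⟩, ls, ?_⟩
        have : (s.give c j).unit p = s.unit p := rfl
        rw [← this, ← hab]
        exact hex v
      have := hsup hmem
      simp only [levels, Finset.mem_filter] at this
      obtain ⟨-, i, hi⟩ := this
      rw [← hab] at hi
      exact absurd (hv i) (not_le.2 hi)
    have := potential_le (w := w) (s := s.give c j)
    nlinarith [Nat.mul_le_mul_right (n * n * (n * m + 1) + n * m + 1) hlt]

end Move

/-! ### Phase 3 -/

/-- The configuration after Phase 3. -/
def reduceBy (s : Config n m) (Hk : Finset (Fin n)) (α : ℝ) : Config n m where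
  phase := Phase.phase2a
  alloc := s.alloc
  price := fun c => if s.alloc c ∈ Hk then 1 / α * s.price c else s.price c
  k := s.k + 1
  l := s.k + 1 - 2
  H := Function.update s.H s.k Hk
  entitled := fun i => if i ∈ Hk then bundle s.alloc i else s.entitled i

/-- The situation at the beginning of Phase 3, where `r` is a violator. -/
structure Break (p : ℝ) (w : Profile n m) (s : Config n m) (Hk : Finset (Fin n)) (ls r : Fin n) :
    Prop where
  scaled : IsScaled p w
  core : Core p w s
  quiet : s.Quiet
  no_path : ¬ ∃ ls d i, s.ViolatorPath w ls d i
  mem_iff : ∀ i, i ∈ Hk ↔ ∃ ls d, s.LeastSpender ls ∧ AltPath w s ls d i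
  least : s.LeastSpender ls
  violator : s.spending ls < s.spendingUpToOne r

namespace Break

variable {Hk : Finset (Fin n)} {ls r : Fin n} (hB : Break p w s Hk ls r)
include hB

theorem ls_mem : ls ∈ Hk := (hB.mem_iff ls).2 ⟨ls, 0, hB.least, AltPath.refl⟩

theorem le_least {i : Fin n} (hi : i ∈ Hk) : s.spendingUpToOne i ≤ s.spending ls := by
  obtain ⟨u, d, hu, hP⟩ := (hB.mem_iff i).1 hi
  by_contra hlt
  exact hB.no_path ⟨u, d, i, hu, hP, hu.eq hB.least ▸ not_le.1 hlt⟩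

theorem least_lt {i : Fin n} (hi : i ∉ Hk) : s.spending ls < s.spending i := by
  refine lt_of_le_of_ne (hB.least i) fun e => hi ((hB.mem_iff i).2 ⟨i, 0, fun v => ?_, .refl⟩)
  rw [← e]; exact hB.least v

theorem mem_of_mpb {i : Fin n} {c : Fin m} (hi : i ∈ Hk) (hc : IsMPBChore w s.price i c) :
    s.alloc c ∈ Hk := by
  obtain ⟨u, d, hu, hP⟩ := (hB.mem_iff i).1 hi
  exact (hB.mem_iff _).2 ⟨u, d + 1, hu, hP.snoc ⟨rfl, hc⟩⟩

theorem violator_not_mem : r ∉ Hk := fun h => absurd hB.violator (not_lt.2 (hB.le_least h))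

theorem violator_not_reduced : ¬ s.Reduced r := fun h =>
  absurd hB.violator (not_lt.2 (hB.quiet r h ls))

theorem nonempty_of_not_mem {i : Fin n} (hi : i ∉ Hk) : (bundle s.alloc i).Nonempty := by
  have h1 := hB.least_lt hi
  have h2 : 0 ≤ s.spending ls := setPrice_nonneg (hB.core.price_pos hB.scaled) _
  rw [Finset.nonempty_iff_ne_empty]
  intro he
  rw [spending, spending, he] at h1
  simp only [setPrice, Finset.sum_empty] at h1
  exact absurd h1 (not_lt.2 h2)

theorem not_reduced {i : Fin n} (hi : i ∈ Hk) : ¬ s.Reduced i := by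
  intro hr
  obtain ⟨c, hc⟩ := hB.nonempty_of_not_mem hB.violator_not_mem
  obtain rfl := mem_bundle.1 hc
  have hfree : ¬ s.IsEntitled c := fun he =>
    hB.violator_not_reduced (hB.core.entitled_owner he).2
  exact hB.violator_not_mem (hB.mem_of_mpb hi (hB.core.mpb_of_reduced hB.scaled hr hfree))

theorem baseCost_eq_one {c : Fin m} (hc : ¬ s.IsEntitled c) (ha : s.alloc c ∉ Hk) :
    baseCost w c = 1 := by
  by_contra hb
  have h1 := hB.scaled.cost_eq_of_baseCost (i := ls) hb
  have h2 := (hB.scaled.baseCost_eq ls c).resolve_left hb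
  exact ha (hB.mem_of_mpb hB.ls_mem (hB.core.mpb_of_free hB.scaled (hB.not_reduced hB.ls_mem) hc
    (h1.trans h2.symm)))

theorem cost_eq {i : Fin n} {c : Fin m} (hi : i ∈ Hk) (hc : ¬ s.IsEntitled c)
    (ha : s.alloc c ∉ Hk) : |w i c| = p := by
  refine (hB.scaled.cost_eq i c).resolve_left fun h1 => ha (hB.mem_of_mpb hi ?_)
  refine hB.core.mpb_of_free hB.scaled (hB.not_reduced hi) hc ?_
  rw [h1, hB.baseCost_eq_one hc ha]

/-- The prices are always reduced by the factor `p`. -/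
theorem isLeast : IsLeast {a : ℝ | ∃ i ∈ Hk, ∃ c, s.alloc c ∉ Hk ∧
    a = painPerBuck w s.price i c / minPainPerBuck w s.price i} p := by
  have hval : ∀ i ∈ Hk, ∀ c, painPerBuck w s.price i c / minPainPerBuck w s.price i =
      |w i c| / s.price c * p := by
    intro i hi c
    rw [hB.core.minPainPerBuck_eq hB.scaled (Fin.pos c), invMPB, if_neg (hB.not_reduced hi),
      painPerBuck]
    field_simp
  have hp := hB.scaled.pos
  constructor
  · obtain ⟨c, hc⟩ := hB.nonempty_of_not_mem hB.violator_not_mem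
    have hc := mem_bundle.1 hc
    have hfree : ¬ s.IsEntitled c := fun he =>
      hB.violator_not_reduced (hc ▸ (hB.core.entitled_owner he).2)
    have ha : s.alloc c ∉ Hk := hc ▸ hB.violator_not_mem
    refine ⟨ls, hB.ls_mem, c, ha, ?_⟩
    rw [hval ls hB.ls_mem, hB.cost_eq hB.ls_mem hfree ha, hB.core.price_free c hfree,
      hB.baseCost_eq_one hfree ha]
    field_simp
  · rintro a ⟨i, hi, c, ha, rfl⟩
    rw [hval i hi]
    have hpr := hB.core.price_pos hB.scaled c
    have : s.price c ≤ |w i c| := by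
      by_cases hc : s.IsEntitled c
      · rw [hB.core.price_ent c hc]; exact hB.scaled.baseCost_le i c
      · rw [hB.cost_eq hi hc ha, hB.core.price_free c hc, hB.baseCost_eq_one hc ha, mul_one]
    have h1 : 1 ≤ |w i c| / s.price c := (one_le_div hpr).2 this
    nlinarith

theorem reduced_iff (i : Fin n) : (s.reduceBy Hk p).Reduced i ↔ s.Reduced i ∨ i ∈ Hk := by
  have hk := hB.core.H_out s.k (Or.inr le_rfl)
  constructor
  · rintro ⟨t, ht⟩
    change i ∈ Function.update s.H s.k Hk t at ht
    by_cases htk : t = s.k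
    · subst htk; right; simpa using ht
    · rw [Function.update_of_ne htk] at ht; exact Or.inl ⟨t, ht⟩
  · rintro (⟨t, ht⟩ | hi)
    · have htk : t ≠ s.k := by rintro rfl; simp [hk] at ht
      exact ⟨t, by change i ∈ Function.update s.H s.k Hk t; rwa [Function.update_of_ne htk]⟩
    · exact ⟨s.k, by change i ∈ Function.update s.H s.k Hk s.k; rwa [Function.update_self]⟩

omit hB in
theorem H_of_lt {t : ℕ} (ht : t < s.k) : (s.reduceBy Hk p).H t = s.H t :=
  Function.update_of_ne ht.ne _ _

omit hB in
theorem H_self : (s.reduceBy Hk p).H s.k = Hk := Function.update_self _ _ _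

theorem entitled_of_reduced {i : Fin n} (hi : s.Reduced i) :
    (s.reduceBy Hk p).entitled i = s.entitled i :=
  if_neg fun h => hB.not_reduced h hi

omit hB in
theorem entitled_of_mem {i : Fin n} (hi : i ∈ Hk) :
    (s.reduceBy Hk p).entitled i = bundle s.alloc i :=
  if_pos hi

theorem owner_of_entitled {i : Fin n} {c : Fin m} (h : c ∈ (s.reduceBy Hk p).entitled i) :
    s.alloc c = i := by
  by_cases hi : i ∈ Hk
  · rw [entitled_of_mem hi] at h; exact mem_bundle.1 h
  · exact (hB.core.ent i c (by simpa [reduceBy, hi] using h)).2.1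

theorem isEntitled_iff (c : Fin m) :
    (s.reduceBy Hk p).IsEntitled c ↔ s.IsEntitled c ∨ s.alloc c ∈ Hk := by
  constructor
  · rintro ⟨i, hi⟩
    have ho := hB.owner_of_entitled hi
    by_cases hH : i ∈ Hk
    · right; rwa [ho]
    · left; exact ⟨i, by simpa [reduceBy, hH] using hi⟩
  · rintro (h | h)
    · obtain ⟨h1, h2⟩ := hB.core.entitled_owner h
      exact ⟨_, by rwa [hB.entitled_of_reduced h2]⟩
    · exact ⟨_, by rw [entitled_of_mem h]; simp⟩

theorem not_isEntitled {c : Fin m} (hc : s.alloc c ∈ Hk) : ¬ s.IsEntitled c := fun h =>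
  hB.not_reduced hc (hB.core.entitled_owner h).2

omit hB in
theorem price_of_mem {c : Fin m} (hc : s.alloc c ∈ Hk) :
    (s.reduceBy Hk p).price c = 1 / p * s.price c := if_pos hc

omit hB in
theorem price_of_not_mem {c : Fin m} (hc : s.alloc c ∉ Hk) :
    (s.reduceBy Hk p).price c = s.price c := if_neg hc

theorem spendingUpToOne_of_mem {i : Fin n} (hi : i ∈ Hk) :
    (s.reduceBy Hk p).spendingUpToOne i = 1 / p * s.spendingUpToOne i :=
  priceUpToOne_const_mul (one_div_pos.2 hB.scaled.pos) fun c hc =>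
    price_of_mem ((mem_bundle.1 hc : s.alloc c = i) ▸ hi)

omit hB in
theorem spendingUpToOne_of_not_mem {i : Fin n} (hi : i ∉ Hk) :
    (s.reduceBy Hk p).spendingUpToOne i = s.spendingUpToOne i :=
  priceUpToOne_congr fun c hc => price_of_not_mem ((mem_bundle.1 hc : s.alloc c = i) ▸ hi)

omit hB in
theorem spending_of_not_mem {i : Fin n} (hi : i ∉ Hk) :
    (s.reduceBy Hk p).spending i = s.spending i :=
  setPrice_congr fun c hc => price_of_not_mem ((mem_bundle.1 hc : s.alloc c = i) ▸ hi)

theorem le_spending (i : Fin n) : 1 / p * s.spending i ≤ (s.reduceBy Hk p).spending i := by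
  have h1 : 1 / p ≤ 1 := (div_le_one hB.scaled.pos).2 hB.scaled.one_lt.le
  change _ ≤ ∑ c ∈ bundle s.alloc i, _
  rw [spending, setPrice, Finset.mul_sum]
  refine Finset.sum_le_sum fun c _ => ?_
  have hpos := hB.core.price_pos hB.scaled c
  by_cases hc : s.alloc c ∈ Hk
  · rw [price_of_mem hc]
  · rw [price_of_not_mem hc]; nlinarith

theorem core_reduceBy : Core p w (s.reduceBy Hk p) where
  one_le_k := Nat.le_add_left _ _
  H_out t ht := by
    have hk := hB.core.one_le_k
    change t = 0 ∨ s.k + 1 ≤ t at ht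
    change Function.update s.H s.k Hk t = ∅
    rw [Function.update_of_ne (by omega)]
    exact hB.core.H_out t (by omega)
  H_nonempty t h1 h2 := by
    change t < s.k + 1 at h2
    rcases Nat.lt_succ_iff_lt_or_eq.1 h2 with h | rfl
    · rw [H_of_lt h]; exact hB.core.H_nonempty t h1 h
    · rw [H_self]; exact ⟨ls, hB.ls_mem⟩
  H_disj t t' i ht ht' := by
    change i ∈ Function.update s.H s.k Hk t at ht
    change i ∈ Function.update s.H s.k Hk t' at ht'
    by_cases e : t = s.k <;> by_cases e' : t' = s.k
    · rw [e, e']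
    · subst e
      rw [Function.update_self] at ht
      rw [Function.update_of_ne e'] at ht'
      exact absurd ⟨t', ht'⟩ (hB.not_reduced ht)
    · subst e'
      rw [Function.update_self] at ht'
      rw [Function.update_of_ne e] at ht
      exact absurd ⟨t, ht⟩ (hB.not_reduced ht')
    · rw [Function.update_of_ne e] at ht
      rw [Function.update_of_ne e'] at ht'
      exact hB.core.H_disj t t' i ht ht'
  ent i c hc := by
    have ho := hB.owner_of_entitled hc
    refine ⟨(hB.reduced_iff i).2 ?_, ho, ?_⟩
    · by_cases hi : i ∈ Hk
      · exact Or.inr hi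
      · exact Or.inl (hB.core.ent i c (by simpa [reduceBy, hi] using hc)).1
    · by_cases hi : i ∈ Hk
      · rw [← ho] at hi ⊢
        exact hB.core.own c (hB.not_reduced hi)
      · exact (hB.core.ent i c (by simpa [reduceBy, hi] using hc)).2.2
  price_ent c hc := by
    by_cases ha : s.alloc c ∈ Hk
    · rw [price_of_mem ha, hB.core.price_free c (hB.not_isEntitled ha)]
      have := hB.scaled.pos
      field_simp
    · rw [price_of_not_mem ha]
      exact hB.core.price_ent c (((hB.isEntitled_iff c).1 hc).resolve_right ha)
  price_free c hc := by
    rw [hB.isEntitled_iff, not_or] at hc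
    rw [price_of_not_mem hc.2, hB.core.price_free c hc.1]
  own c hc := hB.core.own c fun h => hc ((hB.reduced_iff _).2 (Or.inl h))
  small _ c hc := by
    rw [hB.isEntitled_iff, not_or] at hc
    exact hB.baseCost_eq_one hc.1 hc.2
  closed t i c hi hc := by
    change i ∈ Function.update s.H s.k Hk t at hi
    by_cases e : t = s.k
    · subst e
      rw [Function.update_self] at hi
      by_cases he : s.IsEntitled c
      · obtain ⟨h1, h2⟩ := hB.core.entitled_owner he
        obtain ⟨t', ht'⟩ := h2
        have hlt := (hB.core.reduced_lt ht').2
        exact ⟨t', hlt.le, _, by rwa [H_of_lt hlt], by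
          rwa [hB.entitled_of_reduced ⟨t', ht'⟩]⟩
      · have hm := hB.mem_of_mpb hi (hB.core.mpb_of_free hB.scaled (hB.not_reduced hi) he
          (by rw [hc, hB.scaled.baseCost_eq_one hc]))
        exact ⟨s.k, le_rfl, _, by rwa [H_self], by rw [entitled_of_mem hm]; simp⟩
    · rw [Function.update_of_ne e] at hi
      have hlt := (hB.core.reduced_lt hi).2
      obtain ⟨t', ht', i', hi', hc'⟩ := hB.core.closed t i c hi hc
      exact ⟨t', ht', i', by rwa [H_of_lt (by omega)], by
        rwa [hB.entitled_of_reduced ⟨t', hi'⟩]⟩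
  free_nonempty _ i hi := by
    rw [hB.reduced_iff, not_or] at hi
    exact hB.nonempty_of_not_mem hi.2
  hist t h1 h2 := by
    change t < s.k + 1 at h2
    rcases Nat.lt_succ_iff_lt_or_eq.1 h2 with h | rfl
    · obtain ⟨e, y, he, hy, hyc⟩ := hB.core.hist t h1 h
      have hH : ∀ t' ≤ t, (s.reduceBy Hk p).H t' = s.H t' := fun t' ht' => H_of_lt (by omega)
      refine ⟨e, y, fun i hi => ?_, fun a ha => hy a fun t' ht' => hH t' ht' ▸ ha t' ht',
        fun c hc => ?_⟩
      · rw [hH t le_rfl] at hi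
        rw [hB.entitled_of_reduced ⟨t, hi⟩, priceUpToOne_congr (price := s.price)]
        · exact he i hi
        · intro c hc
          have := (hB.core.ent i c hc).2.1
          exact price_of_not_mem fun hm => hB.not_reduced hm (this ▸ ⟨t, hi⟩)
      · obtain ⟨h3, h4⟩ := hyc c fun t' ht' => hH t' ht' ▸ hc t' ht'
        refine ⟨h3, fun t' ht' i hi => ?_⟩
        rw [hH t' ht'] at hi
        rw [hB.entitled_of_reduced ⟨t', hi⟩]
        exact h4 t' ht' i hi
    · have hp := hB.scaled.pos
      have hnot : ∀ a, (∀ t' ≤ s.k, a ∉ (s.reduceBy Hk p).H t') → a ∉ Hk ∧ ¬ s.Reduced a := by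
        refine fun a ha => ⟨by simpa [H_self] using ha s.k le_rfl, ?_⟩
        rintro ⟨t', ht'⟩
        have hlt := (hB.core.reduced_lt ht').2
        exact ha t' hlt.le (by rwa [H_of_lt hlt])
      refine ⟨1 / p * s.spending ls, s.alloc, fun i hi => ?_, fun a ha => ?_, fun c hc => ?_⟩
      · rw [H_self] at hi
        rw [entitled_of_mem hi]
        exact (hB.spendingUpToOne_of_mem hi).trans_le
          (mul_le_mul_of_nonneg_left (hB.le_least hi) (by positivity))
      · obtain ⟨ha1, ha2⟩ := hnot a ha
        have hsp : s.spending a = (bundle s.alloc a).card * p := by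
          rw [spending, setPrice, ← nsmul_eq_mul, ← Finset.sum_const]
          refine Finset.sum_congr rfl fun c hc => ?_
          have hc := mem_bundle.1 hc
          have hfree : ¬ s.IsEntitled c := fun he =>
            ha2 (hc ▸ (hB.core.entitled_owner he).2)
          rw [hB.core.price_free c hfree, hB.baseCost_eq_one hfree (hc ▸ ha1), mul_one]
        have := hB.least_lt ha1
        rw [hsp] at this
        rw [one_div_mul_eq_div, div_lt_iff₀ hp]
        exact this
      · obtain ⟨ha1, ha2⟩ := hnot _ hc
        have hfree : ¬ s.IsEntitled c := fun he => ha2 (hB.core.entitled_owner he).2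
        refine ⟨(hB.core.own c ha2).trans (hB.baseCost_eq_one hfree ha1), ?_⟩
        intro t' ht' i hi hci
        rw [← hB.owner_of_entitled hci] at hi
        exact hc t' ht' hi

theorem balanced_reduceBy : (s.reduceBy Hk p).Balanced := by
  have hp := hB.scaled.pos
  intro a i hi
  change i ∈ Function.update s.H s.k Hk a at hi
  by_cases e : a = s.k
  · subst e
    rw [Function.update_self] at hi
    have hall : ∀ v, (s.reduceBy Hk p).Bal i v := fun v => by
      refine (hB.spendingUpToOne_of_mem hi).trans_le (le_trans ?_ (hB.le_spending v))
      exact mul_le_mul_of_nonneg_left ((hB.le_least hi).trans (hB.least v)) (by positivity)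
    exact ⟨fun _ v _ _ => hall v, fun v _ => hall v⟩
  · rw [Function.update_of_ne e] at hi
    have hlt := (hB.core.reduced_lt hi).2
    have hiH : i ∉ Hk := fun h => hB.not_reduced h ⟨a, hi⟩
    have hall : ∀ v, v ∉ Hk → (s.reduceBy Hk p).Bal i v := fun v hv => by
      rw [Bal, spendingUpToOne_of_not_mem hiH, spending_of_not_mem hv]
      exact hB.quiet i ⟨a, hi⟩ v
    refine ⟨fun b v hv hba => hall v fun hvH => ?_, fun v hv => hall v fun hvH => ?_⟩
    · change b ≤ a ∨ s.k + 1 - 2 < a at hba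
      rw [H_of_lt (by omega)] at hv
      exact hB.not_reduced hvH ⟨b, hv⟩
    · exact hv ((hB.reduced_iff v).2 (Or.inr hvH))

end Break

/-- The number of iterations is bounded by the number of agents. -/
theorem Core.k_le (h : Core p w s) : s.k ≤ n + 1 := by
  have h1 : ((Finset.Ico 1 s.k).biUnion s.H).card = ∑ t ∈ Finset.Ico 1 s.k, (s.H t).card :=
    Finset.card_biUnion fun a _ b _ hab => Finset.disjoint_left.2 fun i ha hb =>
      hab (h.H_disj a b i ha hb)
  have h2 : (Finset.Ico 1 s.k).card • 1 ≤ ∑ t ∈ Finset.Ico 1 s.k, (s.H t).card := by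
    refine Finset.card_nsmul_le_sum _ _ _ fun t ht => ?_
    rw [Finset.mem_Ico] at ht
    exact (h.H_nonempty t ht.1 ht.2).card_pos
  have h3 := Finset.card_le_univ ((Finset.Ico 1 s.k).biUnion s.H)
  simp only [Nat.card_Ico, smul_eq_mul, mul_one, Fintype.card_fin] at h2 h3
  omega

end Config

end BivaluedChores

end
noncomputable section

namespace BivaluedChores

namespace Config

variable {n m : ℕ} {p : ℝ} {w : Profile n m} {s s' : Config n m}

/-! ### The invariant of the algorithm -/

theorem Core.congr (h : Core p w s) (hk : s'.k = s.k) (ha : s'.alloc = s.alloc)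
    (hp : s'.price = s.price) (hH : s'.H = s.H) (he : s'.entitled = s.entitled) :
    Core p w s' := by
  obtain ⟨ph, a, pr, k, l, H, e⟩ := s
  obtain ⟨ph', a', pr', k', l', H', e'⟩ := s'
  dsimp only at hk ha hp hH he
  subst hk ha hp hH he
  exact ⟨h.1, h.2, h.3, h.4, h.5, h.6, h.7, h.8, h.9, h.10, h.11, h.12⟩

theorem AltPath.congr (ha : s'.alloc = s.alloc) (hp : s'.price = s.price) {ls i : Fin n} {d : ℕ}
    (h : AltPath w s ls d i) : AltPath w s' ls d i := by
  induction h with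
  | refl => exact .refl
  | snoc _ hA ih => exact ih.snoc ⟨by rw [ha]; exact hA.1, by rw [hp]; exact hA.2⟩

/-- The part of the invariant that depends on the phase. -/
def PhaseInv (w : Profile n m) (s : Config n m) : Prop :=
  match s.phase with
  | Phase.phase2a => (s.l + 2 ≤ s.k ∨ s.l = 0) ∧ s.Balanced
  | Phase.phase2b => s.Quiet ∨ ∃ i t, Pending w s i t
  | Phase.phase3 => s.Quiet ∧ (¬ ∃ ls d i, s.ViolatorPath w ls d i) ∧ ¬ PriceEF1 s.alloc s.price
  | Phase.done => PriceEF1 s.alloc s.price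

/-- The invariant of the algorithm. -/
def Inv (p : ℝ) (w : Profile n m) (s : Config n m) : Prop := Core p w s ∧ PhaseInv w s

theorem exists_break (hw : IsScaled p w) (h : Inv p w s) (hph : s.phase = Phase.phase3)
    {Hk : Finset (Fin n)}
    (hHk : ∀ i, i ∈ Hk ↔ ∃ ls d, s.LeastSpender ls ∧ AltPath w s ls d i) :
    ∃ ls r, Break p w s Hk ls r := by
  obtain ⟨hc, hq⟩ := h
  rw [PhaseInv, hph] at hq
  obtain ⟨hq, hv, hef⟩ := hq
  rw [priceEF1_iff (hc.price_pos hw)] at hef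
  push Not at hef
  obtain ⟨i, j, hij⟩ := hef
  obtain ⟨ls, hls⟩ := exists_leastSpender (Fin.pos i) s
  exact ⟨ls, i, hw, hc, hq, hv, hHk, hls, (hls j).trans_lt hij⟩

/-- The measure for Phase 2a. -/
def measure2a (s : Config n m) : ℕ :=
  s.l * (m + 1) + (Finset.univ.filter fun c => s.alloc c ∈ s.H s.l).card

/-- A bound for the measure of Phase 2b. -/
def bound2b (n m : ℕ) : ℕ :=
  (m + 1) * (m + 1) * (n * n * (n * m + 1) + n * m + 1) + (n * n * (n * m + 1) + n * m)

/-- A bound for the length of an iteration. -/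
def iterBound (n m : ℕ) : ℕ := (n + 1) * (m + 1) + bound2b n m + 3

/-- The number of steps left is at most this. -/
def measure (p : ℝ) (w : Profile n m) (s : Config n m) : ℕ :=
  (n + 1 - s.k) * iterBound n m +
    match s.phase with
    | Phase.phase2a => bound2b n m + 3 + measure2a s
    | Phase.phase2b => 2 + measure2b p w s
    | Phase.phase3 => 1
    | Phase.done => 0

theorem measure2a_lt (h : Core p w s) (hl : s.l + 2 ≤ s.k ∨ s.l = 0) :
    measure2a s < (n + 1) * (m + 1) := by
  have h1 := h.k_le
  have h2 : (Finset.univ.filter fun c => s.alloc c ∈ s.H s.l).card ≤ m := by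
    simpa using Finset.card_filter_le Finset.univ fun c => s.alloc c ∈ s.H s.l
  have h3 : s.l * (m + 1) ≤ n * (m + 1) := Nat.mul_le_mul_right _ (by omega)
  rw [measure2a, Nat.succ_mul]
  omega

theorem Inv.measure_le (h : Inv p w s) : measure p w s ≤ (n + 1) * iterBound n m := by
  have h1 := h.1.one_le_k
  have h2 : (n + 1 - s.k) * iterBound n m ≤ n * iterBound n m := Nat.mul_le_mul_right _ (by omega)
  have h3 : measure2b p w s ≤ bound2b n m := measure2b_le
  have hi := h.2
  unfold measure
  unfold PhaseInv at hi
  rw [Nat.succ_mul]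
  have h4 : iterBound n m = (n + 1) * (m + 1) + bound2b n m + 3 := rfl
  split
  · rename_i hph
    rw [hph] at hi
    have := measure2a_lt h.1 hi.1
    omega
  all_goals omega

/-- Every step preserves the invariant and decreases the measure. -/
theorem Inv.step (hw : IsScaled p w) (h : Inv p w s) (hs : Step w s s') :
    Inv p w s' ∧ measure p w s' < measure p w s := by
  have hc := h.1
  have hq := h.2
  cases hs with
  | transfer2a i j c hph hl hsel hv hc' =>
    rw [PhaseInv, hph] at hq
    obtain ⟨hlk, hbal⟩ := hq
    have hlk : s.l + 2 ≤ s.k := hlk.resolve_right (by omega)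
    simp only [Finset.mem_sdiff, mem_bundle] at hc'
    obtain ⟨rfl, hce⟩ := hc'
    have hfree : ¬ s.IsEntitled c := fun he => hce (hc.entitled_owner he).1
    obtain ⟨b, hlb, hbk, hj⟩ := hsel.mem_later
    have hcore := hc.transfer hw hfree (hc.mpb_of_reduced hw ⟨b, hj⟩ hfree)
      (Or.inl ⟨_, hsel.1.1⟩)
    have hjl : j ∉ s.H s.l := fun hj' => by have := hc.H_disj _ _ j hj hj'; omega
    refine ⟨⟨hcore, ?_⟩, ?_⟩
    · simp only [PhaseInv, hph]
      exact ⟨Or.inl hlk, hc.balanced_give hw hbal hsel hv⟩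
    · simp only [measure, hph, measure2a]
      refine Nat.add_lt_add_left (Nat.add_lt_add_left (Nat.add_lt_add_left ?_ _) _) _
      refine Finset.card_lt_card ⟨fun e he => ?_, fun hsub => ?_⟩
      · simp only [Finset.mem_filter, Finset.mem_univ, true_and] at he ⊢
        by_cases hec : e = c
        · subst hec; exact hsel.1.1
        · rwa [Function.update_of_ne hec] at he
      · have := @hsub c (by simpa using hsel.1.1)
        simp [hjl] at this
  | next2a i j hph hl hsel hv =>
    rw [PhaseInv, hph] at hq
    obtain ⟨hlk, hbal⟩ := hq
    refine ⟨⟨hc.congr rfl rfl rfl rfl rfl, ?_⟩, ?_⟩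
    · simp only [PhaseInv, hph]
      exact ⟨by omega, hc.balanced_next hbal hl hsel hv⟩
    · simp only [measure, hph, measure2a]
      have h2 : (Finset.univ.filter fun c => s.alloc c ∈ s.H (s.l - 1)).card ≤ m := by
        simpa using Finset.card_filter_le Finset.univ fun c => s.alloc c ∈ s.H (s.l - 1)
      obtain ⟨l, hl'⟩ : ∃ l, s.l = l + 1 := ⟨s.l - 1, by omega⟩
      rw [hl'] at h2 ⊢
      rw [Nat.add_sub_cancel] at h2 ⊢
      rw [Nat.succ_mul]
      omega
  | end2a hph hl =>
    rw [PhaseInv, hph] at hq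
    refine ⟨⟨hc.congr rfl rfl rfl rfl rfl, Or.inl (hc.quiet_of_balanced hq.2 hl)⟩, ?_⟩
    simp only [measure, hph]
    have : measure2b p w { s with phase := Phase.phase2b } ≤ bound2b n m := measure2b_le
    omega
  | transfer2b ls j i c d hph hP hA hv hmin =>
    rw [PhaseInv, hph] at hq
    obtain ⟨rfl, hmpb⟩ := hA
    have hM : Move w s ls j c d := ⟨hP, hmpb, hv, hmin⟩
    obtain ⟨hfree, hq'⟩ := hM.quiet_or_pending hw hc hq
    have hcore : Core p w (s.give c j) :=
      hc.transfer hw hfree hmpb (Or.inr (hM.donor_nonempty (hc.price_pos hw)))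
    refine ⟨⟨hcore, ?_⟩, ?_⟩
    · change PhaseInv w (s.give c j)
      rw [PhaseInv, show (s.give c j).phase = _ from hph]
      exact hq'
    · change measure p w (s.give c j) < _
      rw [measure, measure, show (s.give c j).phase = _ from hph, hph]
      exact Nat.add_lt_add_left (Nat.add_lt_add_left (hM.measure2b_lt hw hc hcore) _) _
  | return2b hph hv hef =>
    refine ⟨⟨hc.congr rfl rfl rfl rfl rfl, hef⟩, ?_⟩
    simp only [measure, hph]
    omega
  | break2b hph hv hef =>
    rw [PhaseInv, hph] at hq
    refine ⟨⟨hc.congr rfl rfl rfl rfl rfl, quiet_of_no_violatorPath (s := s) hq hv, ?_, hef⟩, ?_⟩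
    · rintro ⟨ls, d, i, h1, h2, h3⟩
      exact hv ⟨ls, d, i, h1, AltPath.congr (s' := s) (s := { s with phase := .phase3 }) rfl rfl h2, h3⟩
    · simp only [measure, hph]
      omega
  | reduce Hk α hph hHk hα =>
    obtain ⟨ls, r, hB⟩ := exists_break hw h hph hHk
    obtain rfl := hα.unique hB.isLeast
    have hk := hc.one_le_k
    have hl : (s.reduceBy Hk α).l + 2 ≤ (s.reduceBy Hk α).k :=
      show s.k + 1 - 2 + 2 ≤ s.k + 1 by omega
    have hcore := hB.core_reduceBy
    refine ⟨⟨hcore, Or.inl hl, hB.balanced_reduceBy⟩, ?_⟩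
    have h1 := measure2a_lt hcore (Or.inl hl)
    have h2 : s.k + 1 ≤ n + 1 := hcore.k_le
    have h3 : measure α w (s.reduceBy Hk α) =
        (n + 1 - (s.k + 1)) * iterBound n m + (bound2b n m + 3 + measure2a (s.reduceBy Hk α)) := rfl
    change measure α w (s.reduceBy Hk α) < _
    obtain ⟨a, ha⟩ : ∃ a, n + 1 - s.k = a + 1 := ⟨n - s.k, by omega⟩
    rw [h3, measure, hph, ha, show n + 1 - (s.k + 1) = a by omega, Nat.succ_mul]
    have h4 : iterBound n m = (n + 1) * (m + 1) + bound2b n m + 3 := rfl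
    dsimp only
    omega

/-- The algorithm never gets stuck. -/
theorem Inv.exists_step (hw : IsScaled p w) (h : Inv p w s) :
    s.phase = Phase.done ∨ ∃ s', Step w s s' := by
  classical
  have hc := h.1
  have hq := h.2
  rw [PhaseInv] at hq
  cases hph : s.phase with
  | phase2a =>
    right
    rw [hph] at hq
    obtain ⟨hlk, hbal⟩ := hq
    by_cases hl : s.l = 0
    · exact ⟨_, Step.end2a s hph hl⟩
    have hlk : s.l + 2 ≤ s.k := hlk.resolve_right hl
    obtain ⟨i, j, hsel⟩ := hc.exists_selects (by omega) hlk
    by_cases hv : s.spendingUpToOne i > s.spending j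
    · obtain ⟨c, hc'⟩ := hc.exists_free hw hbal (by omega) hlk hsel hv
      exact ⟨_, Step.transfer2a s i j c hph (by omega) hsel hv hc'⟩
    · exact ⟨_, Step.next2a s i j hph (by omega) hsel hv⟩
  | phase2b =>
    right
    by_cases hv : ∃ ls d i, s.ViolatorPath w ls d i
    · obtain ⟨ls, j, c, d, hM⟩ := hc.exists_move hw hv
      exact ⟨_, Step.transfer2b s ls j _ c d hph hM.path ⟨rfl, hM.mpb⟩ hM.violator hM.min⟩
    · by_cases hef : PriceEF1 s.alloc s.price
      · exact ⟨_, Step.return2b s hph hv hef⟩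
      · exact ⟨_, Step.break2b s hph hv hef⟩
  | phase3 =>
    right
    have hHk : ∀ i, i ∈ Finset.univ.filter
        (fun i => ∃ ls d, s.LeastSpender ls ∧ AltPath w s ls d i) ↔
        ∃ ls d, s.LeastSpender ls ∧ AltPath w s ls d i := by simp
    obtain ⟨ls, r, hB⟩ := exists_break hw h hph hHk
    exact ⟨_, Step.reduce s _ p hph hHk hB.isLeast⟩
  | done => left; rfl

/-! ### Correctness -/

theorem sum_utility_bundle (f : Fin n → Fin m → ℝ) (y : Allocation n m) :
    ∑ i, ∑ c ∈ bundle y i, f i c = ∑ c, f (y c) c := by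
  rw [← Finset.sum_fiberwise (s := Finset.univ) (g := y)]
  refine Finset.sum_congr rfl fun i _ => Finset.sum_congr rfl fun c hc => ?_
  rw [mem_bundle.1 hc]

/-- MPB allocations are Pareto optimal. -/
theorem Core.paretoOptimal (hw : IsScaled p w) (h : Core p w s) : ParetoOptimal w s.alloc := by
  rintro ⟨y, hy, i, hi⟩
  have h1 : ∑ i, s.invMPB p i * utility w i (bundle s.alloc i) <
      ∑ i, s.invMPB p i * utility w i (bundle y i) :=
    Finset.sum_lt_sum (fun i _ => mul_le_mul_of_nonneg_left (hy i) (invMPB_pos hw i).le)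
      ⟨i, Finset.mem_univ i, mul_lt_mul_of_pos_left hi (invMPB_pos hw i)⟩
  simp only [utility, Finset.mul_sum] at h1
  rw [sum_utility_bundle fun i c => s.invMPB p i * w i c,
    sum_utility_bundle fun i c => s.invMPB p i * w i c] at h1
  refine absurd h1 (not_lt.2 (Finset.sum_le_sum fun c _ => ?_))
  have h2 := h.price_le hw (y c) c
  have h3 := h.price_owner hw c
  rw [hw.abs_eq_neg] at h2 h3
  linarith

theorem Core.ef1 (hw : IsScaled p w) (h : Core p w s) (hef : PriceEF1 s.alloc s.price) :
    EF1 w s.alloc := by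
  intro i j hij
  have hnonpos : ∀ S : Finset (Fin m), utility w i S ≤ 0 := fun S =>
    Finset.sum_nonpos fun c _ => by
      have := hw.abs_eq_neg i c
      have := abs_nonneg (w i c)
      linarith
  rcases (bundle s.alloc i).eq_empty_or_nonempty with he | hne
  · obtain ⟨r, hr⟩ := hij
    refine ⟨r, hr, ?_⟩
    rw [he, Finset.empty_sdiff]
    simpa [utility] using hnonpos _
  obtain ⟨c, hc, hle⟩ := hef i j hne
  refine ⟨c, Finset.mem_union_left _ hc, ?_⟩
  have hlam := invMPB_pos (s := s) hw i
  have h1 : setPrice s.price (bundle s.alloc i \ {c}) =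
      -(s.invMPB p i * utility w i (bundle s.alloc i \ {c})) := by
    rw [setPrice, utility, Finset.mul_sum, ← Finset.sum_neg_distrib]
    refine Finset.sum_congr rfl fun d hd => ?_
    have hd := mem_bundle.1 (Finset.mem_sdiff.1 hd).1
    have := h.price_owner hw d
    rw [hd, hw.abs_eq_neg] at this
    linarith
  have h2 : setPrice s.price (bundle s.alloc j \ {c}) ≤
      -(s.invMPB p i * utility w i (bundle s.alloc j \ {c})) := by
    rw [setPrice, utility, Finset.mul_sum, ← Finset.sum_neg_distrib]
    refine Finset.sum_le_sum fun d _ => ?_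
    have := h.price_le hw i d
    rw [hw.abs_eq_neg] at this
    linarith
  by_cases hij' : i = j
  · subst hij'; exact le_rfl
  have h3 : bundle s.alloc j \ {c} = bundle s.alloc j := by
    rw [Finset.sdiff_singleton_eq_erase, Finset.erase_eq_of_notMem]
    rw [mem_bundle] at hc ⊢
    rwa [hc]
  rw [h3] at h2 ⊢
  by_contra hlt
  have := mul_lt_mul_of_pos_left (not_le.1 hlt) hlam
  linarith

end Config

section Scaling

variable {n m : ℕ} {v w : Profile n m} {p : ℝ} (h : IsScaling v p w)
include h

theorem IsScaling.utility_eq (i : Fin n) :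
    ∃ t : ℝ, 0 < t ∧ ∀ S, utility w i S = t * utility v i S := by
  obtain ⟨t, ht, hv⟩ := h.2.1 i
  refine ⟨t, ht, fun S => ?_⟩
  rw [utility, utility, Finset.mul_sum]
  exact Finset.sum_congr rfl fun c _ => hv c

theorem IsScaling.ef1 {x : Allocation n m} (hx : EF1 w x) : EF1 v x := by
  intro i j hij
  obtain ⟨r, hr, hle⟩ := hx i j hij
  obtain ⟨t, ht, hv⟩ := h.utility_eq i
  rw [hv, hv] at hle
  exact ⟨r, hr, le_of_mul_le_mul_left hle ht⟩

theorem IsScaling.paretoOptimal {x : Allocation n m} (hx : ParetoOptimal w x) :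
    ParetoOptimal v x := by
  rintro ⟨y, hy, i, hi⟩
  refine hx ⟨y, fun i => ?_, i, ?_⟩
  all_goals
    obtain ⟨t, ht, hv⟩ := h.utility_eq i
    rw [hv, hv]
  · exact mul_le_mul_of_nonneg_left (hy i) ht.le
  · exact mul_lt_mul_of_pos_left hi ht

end Scaling

/-! ### Phase 1 and the length of runs -/

theorem exists_isInitial {n m : ℕ} (hn : 0 < n) (p : ℝ) (w : Profile n m) :
    ∃ s : Config n m, IsInitial p w s := by
  have : Nonempty (Fin n) := ⟨⟨0, hn⟩⟩
  obtain ⟨x, hx⟩ := Finite.exists_max fun y : Allocation n m => ∑ i, utility w i (bundle y i)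
  exact ⟨⟨Phase.phase2a, x, fun c => p * |⨆ i, w i c|, 1, 0, fun _ => ∅, fun _ => ∅⟩,
    rfl, rfl, rfl, fun _ => rfl, fun _ => rfl, fun _ => rfl, hx⟩

theorem IsInitial.inv {n m : ℕ} {p : ℝ} {w : Profile n m} {s : Config n m} (hw : IsScaled p w)
    (h : IsInitial p w s) : Config.Inv p w s := by
  obtain ⟨hph, hk, hl, hH, hE, hp, hmax⟩ := h
  have hent : ∀ c, ¬ s.IsEntitled c := by rintro c ⟨i, hi⟩; simp [hE] at hi
  refine ⟨⟨hk.ge, fun t _ => hH t, fun t _ _ => by omega, fun t t' i hi => by simp [hH] at hi,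
    fun i c hc => by simp [hE] at hc, fun c hc => absurd hc (hent c), fun c _ => hp c,
    fun c _ => ?_, fun _ => by omega, fun t i c hi => by simp [hH] at hi, fun _ => by omega,
    fun t _ _ => by omega⟩, ?_⟩
  · obtain ⟨j, hj, hle⟩ := hw.exists_baseCost_eq (s.alloc c) c
    refine le_antisymm ?_ (hw.baseCost_le _ c)
    rw [hj]
    by_contra hlt
    rw [hw.abs_eq_neg, hw.abs_eq_neg, not_le, neg_lt_neg_iff] at hlt
    refine absurd (hmax (Function.update s.alloc c j)) (not_le.2 ?_)
    simp only [utility]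
    rw [Config.sum_utility_bundle, Config.sum_utility_bundle]
    refine Finset.sum_lt_sum (fun d _ => ?_) ⟨c, Finset.mem_univ c, by simpa using hlt⟩
    by_cases hd : d = c
    · subst hd; simpa using hlt.le
    · rw [Function.update_of_ne hd]
  · simp only [Config.PhaseInv, hph]
    exact ⟨Or.inr hl, fun a i hi => by simp [hH] at hi⟩

/-- The invariant along a run, and the bound for its length. -/
theorem IsRun.inv {n m : ℕ} {p : ℝ} {w : Profile n m} {L : ℕ} {σ : ℕ → Config n m}
    (hw : IsScaled p w) (h : IsRun p w L σ) :
    ∀ t ≤ L, Config.Inv p w (σ t) ∧ t + Config.measure p w (σ t) ≤ Config.measure p w (σ 0) := by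
  intro t ht
  induction t with
  | zero => exact ⟨h.1.inv hw, by omega⟩
  | succ t ih =>
    obtain ⟨h1, h2⟩ := ih (by omega)
    obtain ⟨h3, h4⟩ := h1.step hw (h.2 t (by omega))
    exact ⟨h3, by omega⟩

theorem Config.Inv.correct {n m : ℕ} {p : ℝ} {v w : Profile n m} {s : Config n m}
    (hv : IsScaling v p w) (h : s.Inv p w) (hd : s.phase = Phase.done) :
    EF1 v s.alloc ∧ ParetoOptimal v s.alloc := by
  have hw := hv.isScaled
  have hef := h.2
  rw [Config.PhaseInv, hd] at hef
  exact ⟨hv.ef1 (h.1.ef1 hw hef), hv.paretoOptimal (h.1.paretoOptimal hw)⟩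

/-- A polynomial that bounds the length of all runs. -/
def runPoly : Polynomial ℕ :=
  let X := (Polynomial.X : Polynomial ℕ)
  (X + 1) * ((X + 1) * (X + 1) + ((X + 1) * (X + 1) * (X * X * (X * X + 1) + X * X + 1) +
    (X * X * (X * X + 1) + X * X)) + 3)

theorem iterBound_le_runPoly (n m : ℕ) :
    (n + 1) * Config.iterBound n m ≤ runPoly.eval (n + m) := by
  have h3 : (3 : Polynomial ℕ) = Polynomial.C 3 := rfl
  simp only [runPoly, h3, Config.iterBound, Config.bound2b, Polynomial.eval_mul,
    Polynomial.eval_add, Polynomial.eval_X, Polynomial.eval_one, Polynomial.eval_C]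
  have hn : n ≤ n + m := by omega
  have hm : m ≤ n + m := by omega
  gcongr

theorem IsRun.length_le {n m : ℕ} {p : ℝ} {w : Profile n m} {L : ℕ} {σ : ℕ → Config n m}
    (hw : IsScaled p w) (h : IsRun p w L σ) : L ≤ runPoly.eval (n + m) := by
  have h1 := (h.inv hw L le_rfl).2
  have h2 := (h.1.inv hw).measure_le
  have h3 := iterBound_le_runPoly n m
  omega

end BivaluedChores

end
noncomputable section

namespace BivaluedChores

/-! ### Total correctness of programs -/

/-- `Run P ν C Q`: started in `ν`, the program `P` halts after at most `C` operations in a memory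
that satisfies `Q`. -/
def Run (P : Prog) (ν : Mem) (C : ℕ) (Q : Mem → Prop) : Prop :=
  ∃ ν' t, Exec P ν ν' t ∧ t ≤ C ∧ Q ν'

namespace Run

variable {P P' : Prog} {ν : Mem} {C C' : ℕ} {Q Q' : Mem → Prop}

theorem mono (h : Run P ν C Q) (hC : C ≤ C') (hQ : ∀ ν', Q ν' → Q' ν') : Run P ν C' Q' := by
  obtain ⟨ν', t, h1, h2, h3⟩ := h
  exact ⟨ν', t, h1, h2.trans hC, hQ ν' h3⟩

theorem seq (h : Run P ν C Q) (h' : ∀ ν', Q ν' → Run P' ν' C' Q') :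
    Run (P.seq P') ν (C + C') Q' := by
  obtain ⟨ν', t, h1, h2, h3⟩ := h
  obtain ⟨ν'', t', h4, h5, h6⟩ := h' ν' h3
  exact ⟨ν'', t + t', h1.seq h4, by omega, h6⟩

theorem setNat {a : ℕ} {r c e : NExp}
    (h : Q { ν with nat := setCell ν.nat a (r.eval ν) (c.eval ν) (e.eval ν) }) :
    Run (Prog.setNat a r c e) ν (r.cost + c.cost + e.cost + 1) Q :=
  ⟨_, _, Exec.setNat ν a r c e, le_rfl, h⟩

theorem setReal {a : ℕ} {r c : NExp} {e : RExp}
    (h : Q { ν with real := setCell ν.real a (r.eval ν) (c.eval ν) (e.eval ν) }) :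
    Run (Prog.setReal a r c e) ν (r.cost + c.cost + e.cost + 1) Q :=
  ⟨_, _, Exec.setReal ν a r c e, le_rfl, h⟩

theorem cond {b : BExp} (h : b.holds ν → Run P ν C Q) (h' : ¬ b.holds ν → Run P' ν C Q) :
    Run (Prog.cond b P P') ν (b.cost + C) Q := by
  by_cases hb : b.holds ν
  · obtain ⟨ν', t, h1, h2, h3⟩ := h hb
    exact ⟨ν', _, Exec.condTrue hb h1, by omega, h3⟩
  · obtain ⟨ν', t, h1, h2, h3⟩ := h' hb
    exact ⟨ν', _, Exec.condFalse hb h1, by omega, h3⟩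

/-- A loop with a counter. -/
theorem loop {b : BExp} {I : ℕ → Mem → Prop} {N : ℕ}
    (hstep : ∀ i < N, ∀ ν, I i ν → b.holds ν ∧ Run P ν C (I (i + 1)))
    (hend : ∀ ν, I N ν → ¬ b.holds ν) (h0 : I 0 ν) :
    Run (Prog.loop b P) ν (N * (C + b.cost) + b.cost) (I N) := by
  suffices H : ∀ d i ν, i + d = N → I i ν →
      Run (Prog.loop b P) ν (d * (C + b.cost) + b.cost) (I N) from H N 0 ν (by omega) h0
  intro d
  induction d with
  | zero =>
    intro i ν hi hI
    obtain rfl : i = N := by omega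
    exact ⟨ν, _, Exec.loopDone (hend ν hI), by omega, hI⟩
  | succ d ih =>
    intro i ν hi hI
    obtain ⟨hb, ν', t, h1, h2, h3⟩ := hstep i (by omega) ν hI
    obtain ⟨ν'', t', h4, h5, h6⟩ := ih (i + 1) ν' (by omega) h3
    refine ⟨ν'', _, Exec.loopStep hb h1 h4, ?_, h6⟩
    rw [Nat.succ_mul]
    omega

end Run

/-! ### Expressions with bounded sums

Arrays below `100` hold data. Integer array `100` holds the values of index variables, and the
integer array `101` and the real array `100` hold intermediate results. -/

/-- Bounds for sums and loops. -/
inductive Bound where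
  | one
  | agents
  | items
  | agentsSucc

/-- The bound as an expression. -/
def Bound.toNExp : Bound → NExp
  | one => .const 1
  | agents => .read 0 (.const 0) (.const 0)
  | items => .read 1 (.const 0) (.const 0)
  | agentsSucc => .plus (.read 0 (.const 0) (.const 0)) (.const 1)

/-- The value of the bound. -/
def Bound.val (ν : Mem) : Bound → ℕ
  | one => 1
  | agents => ν.nat 0 0 0
  | items => ν.nat 1 0 0
  | agentsSucc => ν.nat 0 0 0 + 1

theorem Bound.eval_toNExp (N : Bound) (ν : Mem) : N.toNExp.eval ν = N.val ν := by
  cases N <;> rfl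

theorem Bound.cost_le (N : Bound) : N.toNExp.cost ≤ 5 := by
  cases N <;> simp [Bound.toNExp, NExp.cost]

/-- The size of the input in memory. -/
def Mem.size (ν : Mem) : ℕ := ν.nat 0 0 0 + ν.nat 1 0 0 + 1

theorem Bound.val_le (N : Bound) (ν : Mem) : N.val ν ≤ ν.size := by
  cases N <;> simp only [Bound.val, Mem.size] <;> omega

mutual

/-- Integer expressions with index variables and bounded sums. -/
inductive NX where
  | const (z : ℕ)
  | var (k : ℕ)
  | read (a : ℕ) (r c : NX)
  | add (e f : NX)
  | sub (e f : NX)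
  | lt (e f : NX)
  | rlt (e f : RX)
  | ite (b e f : NX)
  | sum (k : ℕ) (N : Bound) (e : NX)

/-- Real expressions with bounded sums. -/
inductive RX where
  | const (z : ℤ)
  | read (a : ℕ) (r c : NX)
  | sub (e f : RX)
  | mul (e f : RX)
  | div (e f : RX)
  | ite (b : NX) (e f : RX)
  | sum (k : ℕ) (N : Bound) (e : RX)

end

mutual

/-- The value of an integer expression, where `ρ` gives the values of the index variables. -/
def NX.eval (μ : Mem) (ρ : ℕ → ℕ) : NX → ℕ
  | .const z => z
  | .var k => ρ k
  | .read a r c => μ.nat (a % 100) (r.eval μ ρ) (c.eval μ ρ)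
  | .add e f => e.eval μ ρ + f.eval μ ρ
  | .sub e f => e.eval μ ρ - f.eval μ ρ
  | .lt e f => if e.eval μ ρ < f.eval μ ρ then 1 else 0
  | .rlt e f => open Classical in if e.eval μ ρ < f.eval μ ρ then 1 else 0
  | .ite b e f => if 0 < b.eval μ ρ then e.eval μ ρ else f.eval μ ρ
  | .sum k N e => ∑ i ∈ Finset.range (N.val μ), e.eval μ (Function.update ρ k i)

/-- The value of a real expression. -/
def RX.eval (μ : Mem) (ρ : ℕ → ℕ) : RX → ℝ
  | .const z => z
  | .read a r c => μ.real (a % 100) (r.eval μ ρ) (c.eval μ ρ)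
  | .sub e f => e.eval μ ρ - f.eval μ ρ
  | .mul e f => e.eval μ ρ * f.eval μ ρ
  | .div e f => e.eval μ ρ / f.eval μ ρ
  | .ite b e f => if 0 < b.eval μ ρ then e.eval μ ρ else f.eval μ ρ
  | .sum k N e => ∑ i ∈ Finset.range (N.val μ), e.eval μ (Function.update ρ k i)

end

/-- The memories agree on data. -/
def Agree (μ ν : Mem) : Prop :=
  (∀ a < 100, ∀ r c, ν.nat a r c = μ.nat a r c) ∧ ∀ a < 100, ∀ r c, ν.real a r c = μ.real a r c

theorem Agree.val {μ ν : Mem} (h : Agree μ ν) (N : Bound) : N.val ν = N.val μ := by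
  cases N <;> simp [Bound.val, h.1]

theorem Agree.symm {μ ν : Mem} (h : Agree μ ν) : Agree ν μ :=
  ⟨fun a ha r c => (h.1 a ha r c).symm, fun a ha r c => (h.2 a ha r c).symm⟩

theorem Agree.trans {μ ν κ : Mem} (h : Agree μ ν) (h' : Agree ν κ) : Agree μ κ :=
  ⟨fun a ha r c => (h'.1 a ha r c).trans (h.1 a ha r c),
    fun a ha r c => (h'.2 a ha r c).trans (h.2 a ha r c)⟩

theorem Agree.size {μ ν : Mem} (h : Agree μ ν) : ν.size = μ.size := by
  simp [Mem.size, h.1]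

mutual

theorem NX.eval_congr {μ ν : Mem} (h : Agree μ ν) (ρ : ℕ → ℕ) : ∀ e : NX,
    e.eval ν ρ = e.eval μ ρ
  | .const z => rfl
  | .var k => rfl
  | .read a r c => by
    rw [NX.eval, NX.eval, h.1 _ (Nat.mod_lt _ (by norm_num)), r.eval_congr h, c.eval_congr h]
  | .add e f => by rw [NX.eval, NX.eval, e.eval_congr h, f.eval_congr h]
  | .sub e f => by rw [NX.eval, NX.eval, e.eval_congr h, f.eval_congr h]
  | .lt e f => by rw [NX.eval, NX.eval, e.eval_congr h, f.eval_congr h]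
  | .rlt e f => by rw [NX.eval, NX.eval, e.eval_congr h, f.eval_congr h]
  | .ite b e f => by rw [NX.eval, NX.eval, b.eval_congr h, e.eval_congr h, f.eval_congr h]
  | .sum k N e => by
    rw [NX.eval, NX.eval, h.val]
    exact Finset.sum_congr rfl fun i _ => e.eval_congr h _

theorem RX.eval_congr {μ ν : Mem} (h : Agree μ ν) (ρ : ℕ → ℕ) : ∀ e : RX,
    e.eval ν ρ = e.eval μ ρ
  | .const z => rfl
  | .read a r c => by
    rw [RX.eval, RX.eval, h.2 _ (Nat.mod_lt _ (by norm_num)), r.eval_congr h, c.eval_congr h]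
  | .sub e f => by rw [RX.eval, RX.eval, e.eval_congr h, f.eval_congr h]
  | .mul e f => by rw [RX.eval, RX.eval, e.eval_congr h, f.eval_congr h]
  | .div e f => by rw [RX.eval, RX.eval, e.eval_congr h, f.eval_congr h]
  | .ite b e f => by rw [RX.eval, RX.eval, b.eval_congr h, e.eval_congr h, f.eval_congr h]
  | .sum k N e => by
    rw [RX.eval, RX.eval, h.val]
    exact Finset.sum_congr rfl fun i _ => e.eval_congr h _

end

/-- The cell in row `r` and column `0`. -/
def ncell (a r : ℕ) : NExp := .read a (.const r) (.const 0)

/-- Write an integer cell in column `0`. -/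
def putNat (a r : ℕ) (e : NExp) : Prog := .setNat a (.const r) (.const 0) e

/-- The cell in row `r` and column `0`. -/
def rcell (a r : ℕ) : RExp := .read a (.const r) (.const 0)

/-- Write a real cell in column `0`. -/
def putReal (a r : ℕ) (e : RExp) : Prog := .setReal a (.const r) (.const 0) e

/-- Let the index variable `k` run from `0` to `N - 1`. -/
def forLoop (k : ℕ) (N : Bound) (P : Prog) : Prog :=
  (putNat 100 k (.const 0)).seq (.loop (.natLt (ncell 100 k) N.toNExp)
    (P.seq (putNat 100 k (.plus (ncell 100 k) (.const 1)))))

mutual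

/-- A program that computes the value of `e` in cell `d` for intermediate results, and does not
use the preceding cells. -/
def NX.compile (d : ℕ) : NX → Prog
  | .const z => putNat 101 d (.const z)
  | .var k => putNat 101 d (ncell 100 k)
  | .read a r c => (r.compile d).seq ((c.compile (d + 1)).seq
      (putNat 101 d (.read (a % 100) (ncell 101 d) (ncell 101 (d + 1)))))
  | .add e f => (e.compile d).seq ((f.compile (d + 1)).seq
      (putNat 101 d (.plus (ncell 101 d) (ncell 101 (d + 1)))))
  | .sub e f => (e.compile d).seq ((f.compile (d + 1)).seq
      (putNat 101 d (.minus (ncell 101 d) (ncell 101 (d + 1)))))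
  | .lt e f => (e.compile d).seq ((f.compile (d + 1)).seq
      (.cond (.natLt (ncell 101 d) (ncell 101 (d + 1)))
        (putNat 101 d (.const 1)) (putNat 101 d (.const 0))))
  | .rlt e f => (e.compile d).seq ((f.compile (d + 1)).seq
      (.cond (.realLt (rcell 100 d) (rcell 100 (d + 1)))
        (putNat 101 d (.const 1)) (putNat 101 d (.const 0))))
  | .ite b e f => (b.compile d).seq
      (.cond (.natLt (.const 0) (ncell 101 d)) (e.compile d) (f.compile d))
  | .sum k N e => (putNat 101 d (ncell 100 k)).seq ((putNat 101 (d + 1) (.const 0)).seq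
      ((forLoop k N ((e.compile (d + 2)).seq
        (putNat 101 (d + 1) (.plus (ncell 101 (d + 1)) (ncell 101 (d + 2)))))).seq
      ((putNat 100 k (ncell 101 d)).seq (putNat 101 d (ncell 101 (d + 1))))))

/-- A program that computes the value of `e` in cell `d` for intermediate results. -/
def RX.compile (d : ℕ) : RX → Prog
  | .const z => putReal 100 d (.const z)
  | .read a r c => (r.compile d).seq ((c.compile (d + 1)).seq
      (putReal 100 d (.read (a % 100) (ncell 101 d) (ncell 101 (d + 1)))))
  | .sub e f => (e.compile d).seq ((f.compile (d + 1)).seq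
      (putReal 100 d (.minus (rcell 100 d) (rcell 100 (d + 1)))))
  | .mul e f => (e.compile d).seq ((f.compile (d + 1)).seq
      (putReal 100 d (.times (rcell 100 d) (rcell 100 (d + 1)))))
  | .div e f => (e.compile d).seq ((f.compile (d + 1)).seq
      (putReal 100 d (.divide (rcell 100 d) (rcell 100 (d + 1)))))
  | .ite b e f => (b.compile d).seq
      (.cond (.natLt (.const 0) (ncell 101 d)) (e.compile d) (f.compile d))
  | .sum k N e => (putNat 101 d (ncell 100 k)).seq ((putReal 100 (d + 1) (.const 0)).seq
      ((forLoop k N ((e.compile (d + 2)).seq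
        (putReal 100 (d + 1) (.plus (rcell 100 (d + 1)) (rcell 100 (d + 2)))))).seq
      ((putNat 100 k (ncell 101 d)).seq (putReal 100 d (rcell 100 (d + 1))))))

end

open Polynomial in
mutual

/-- A bound for the running time, in terms of the size of the input. -/
def NX.time : NX → ℕ[X]
  | .const _ => C 4
  | .var _ => C 6
  | .read _ r c => r.time + (c.time + C 10)
  | .add e f => e.time + (f.time + C 10)
  | .sub e f => e.time + (f.time + C 10)
  | .lt e f => e.time + (f.time + C 11)
  | .rlt e f => e.time + (f.time + C 11)
  | .ite b e f => b.time + (C 5 + (e.time + f.time))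
  | .sum _ _ e => C 6 + (C 4 + ((C 4 + (X * ((e.time + C 10 + C 8) + C 9) + C 9)) + (C 6 + C 6)))

/-- A bound for the running time, in terms of the size of the input. -/
def RX.time : RX → ℕ[X]
  | .const _ => C 4
  | .read _ r c => r.time + (c.time + C 10)
  | .sub e f => e.time + (f.time + C 10)
  | .mul e f => e.time + (f.time + C 10)
  | .div e f => e.time + (f.time + C 10)
  | .ite b e f => b.time + (C 5 + (e.time + f.time))
  | .sum _ _ e => C 6 + (C 4 + ((C 4 + (X * ((e.time + C 10 + C 8) + C 9) + C 9)) + (C 6 + C 6)))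

end

/-- Only intermediate results from `d` on are changed. -/
def Frame (d : ℕ) (ν ν' : Mem) : Prop :=
  (∀ a r c, a ≠ 101 ∨ r < d → ν'.nat a r c = ν.nat a r c) ∧
    ∀ a r c, a ≠ 100 ∨ r < d → ν'.real a r c = ν.real a r c

/-- The values of the index variables. -/
def Mem.vars (ν : Mem) : ℕ → ℕ := fun k => ν.nat 100 k 0

namespace Frame

variable {d d' : ℕ} {ν ν' ν'' : Mem}

theorem refl (d : ℕ) (ν : Mem) : Frame d ν ν := ⟨fun _ _ _ _ => rfl, fun _ _ _ _ => rfl⟩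

theorem trans (h : Frame d ν ν') (h' : Frame d ν' ν'') : Frame d ν ν'' :=
  ⟨fun a r c hr => (h'.1 a r c hr).trans (h.1 a r c hr),
    fun a r c hr => (h'.2 a r c hr).trans (h.2 a r c hr)⟩

theorem mono (h : Frame d' ν ν') (hd : d ≤ d') : Frame d ν ν' :=
  ⟨fun a r c hr => h.1 a r c (by omega), fun a r c hr => h.2 a r c (by omega)⟩

theorem agree (h : Frame d ν ν') : Agree ν ν' :=
  ⟨fun a ha r c => h.1 a r c (Or.inl (by omega)), fun a ha r c => h.2 a r c (Or.inl (by omega))⟩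

theorem vars (h : Frame d ν ν') : ν'.vars = ν.vars :=
  funext fun k => h.1 100 k 0 (Or.inl (by norm_num))

theorem setNat (h : Frame d ν ν') {r : ℕ} (hr : d ≤ r) (c z : ℕ) :
    Frame d ν { ν' with nat := setCell ν'.nat 101 r c z } := by
  refine ⟨fun a r' c' hr' => ?_, h.2⟩
  have : ¬ (a = 101 ∧ r' = r ∧ c' = c) := by omega
  simp only [setCell, this, if_false]
  exact h.1 a r' c' hr'

theorem setReal (h : Frame d ν ν') {r : ℕ} (hr : d ≤ r) (c : ℕ) (z : ℝ) :
    Frame d ν { ν' with real := setCell ν'.real 100 r c z } := by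
  refine ⟨h.1, fun a r' c' hr' => ?_⟩
  have : ¬ (a = 100 ∧ r' = r ∧ c' = c) := by omega
  simp only [setCell, this, if_false]
  exact h.2 a r' c' hr'

end Frame

@[simp] theorem ncell_eval (a r : ℕ) (ν : Mem) : (ncell a r).eval ν = ν.nat a r 0 := rfl
@[simp] theorem rcell_eval (a r : ℕ) (ν : Mem) : (rcell a r).eval ν = ν.real a r 0 := rfl
@[simp] theorem ncell_cost (a r : ℕ) : (ncell a r).cost = 3 := rfl
@[simp] theorem rcell_cost (a r : ℕ) : (rcell a r).cost = 3 := rfl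

@[simp] theorem setCell_self {α : Type} (A : ℕ → ℕ → ℕ → α) (a r c : ℕ) (z : α) :
    setCell A a r c z a r c = z := by simp [setCell]

theorem setCell_of_ne {α : Type} (A : ℕ → ℕ → ℕ → α) {a r c a' r' c' : ℕ} (z : α)
    (h : ¬ (a' = a ∧ r' = r ∧ c' = c)) : setCell A a r c z a' r' c' = A a' r' c' := by
  simp only [setCell, h, if_false]

theorem Run.putNat {ν : Mem} {Q : Mem → Prop} {a r C : ℕ} {e : NExp}
    (h : Q { ν with nat := setCell ν.nat a r 0 (e.eval ν) }) (hC : e.cost + 3 ≤ C) :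
    Run (putNat a r e) ν C Q :=
  (Run.setNat h).mono (by simp only [NExp.cost]; omega) fun _ => id

theorem Run.putReal {ν : Mem} {Q : Mem → Prop} {a r C : ℕ} {e : RExp}
    (h : Q { ν with real := setCell ν.real a r 0 (e.eval ν) }) (hC : e.cost + 3 ≤ C) :
    Run (putReal a r e) ν C Q :=
  (Run.setReal h).mono (by simp only [NExp.cost]; omega) fun _ => id

/-- The rule for loops with an index variable. -/
theorem Run.forLoop {ν : Mem} {k C S : ℕ} {N : Bound} {P : Prog} {I : ℕ → Mem → Prop}
    (hS : ν.size ≤ S)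
    (hvar : ∀ i ν', I i ν' → ν'.nat 100 k 0 = i ∧ N.val ν' = N.val ν)
    (h0 : I 0 { ν with nat := setCell ν.nat 100 k 0 0 })
    (hstep : ∀ i < N.val ν, ∀ ν', I i ν' → Run P ν' C fun ν'' => ν''.nat 100 k 0 = i ∧
      I (i + 1) { ν'' with nat := setCell ν''.nat 100 k 0 (i + 1) }) :
    Run (forLoop k N P) ν (4 + (S * (C + 8 + 9) + 9)) (I (N.val ν)) := by
  refine Run.seq (C := 4) (Q := I 0) (Run.putNat h0 (by simp [NExp.cost])) fun ν₁ h₁ => ?_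
  have hb : (BExp.natLt (ncell 100 k) N.toNExp).cost ≤ 9 := by
    have := N.cost_le
    simp only [BExp.cost, ncell_cost]; omega
  refine (Run.loop (I := I) (N := N.val ν) (C := C + 8) (fun i hi ν' hI => ⟨?_, ?_⟩)
    (fun ν' hI => ?_) h₁).mono ?_ fun _ => id
  · simp only [BExp.holds, ncell_eval, N.eval_toNExp, (hvar i ν' hI).1, (hvar i ν' hI).2]
    exact hi
  · refine (hstep i hi ν' hI).seq fun ν'' h'' => Run.putNat ?_ (by simp [NExp.cost])
    simp only [NExp.eval, ncell_eval, h''.1]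
    exact h''.2
  · simp only [BExp.holds, ncell_eval, N.eval_toNExp, (hvar _ ν' hI).1, (hvar _ ν' hI).2]
    exact lt_irrefl _
  · have := (N.val_le ν).trans hS
    gcongr

/-- Two expressions are evaluated one after the other. -/
theorem Run.pair {ν : Mem} {P P' P'' : Prog} {C C' C'' : ℕ} {R Q : Mem → Prop}
    {R' : Mem → Mem → Prop} {d : ℕ} (h : Run P ν C fun ν' => Frame d ν ν' ∧ R ν')
    (h' : ∀ ν', Frame d ν ν' → R ν' →
      Run P' ν' C' fun ν'' => Frame (d + 1) ν' ν'' ∧ R' ν' ν'')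
    (h'' : ∀ ν' ν'', Frame d ν ν' → R ν' → Frame (d + 1) ν' ν'' → R' ν' ν'' → Run P'' ν'' C'' Q) :
    Run (P.seq (P'.seq P'')) ν (C + (C' + C'')) Q :=
  h.seq fun ν' hν' => (h' ν' hν'.1 hν'.2).seq fun ν'' hν'' =>
    h'' ν' ν'' hν'.1 hν'.2 hν''.1 hν''.2

mutual

theorem NX.run (e : NX) (d : ℕ) (ν : Mem) (S : ℕ) (hS : ν.size ≤ S) :
    Run (e.compile d) ν (e.time.eval S)
      fun ν' => Frame d ν ν' ∧ ν'.nat 101 d 0 = e.eval ν ν.vars := by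
  match e with
  | .const z =>
    simp only [NX.compile, NX.time, Polynomial.eval_C, NX.eval]
    exact Run.putNat ⟨(Frame.refl d ν).setNat le_rfl _ _, by simp [NExp.eval]⟩ (by simp [NExp.cost])
  | .var k =>
    simp only [NX.compile, NX.time, Polynomial.eval_C, NX.eval]
    exact Run.putNat ⟨(Frame.refl d ν).setNat le_rfl _ _, by simp [Mem.vars]⟩ (by simp)
  | .read a r c =>
    simp only [NX.compile, NX.time, Polynomial.eval_C, Polynomial.eval_add, NX.eval]
    refine Run.pair (NX.run r d ν S hS)
      (fun ν' h _ => NX.run c (d + 1) ν' S (h.agree.size ▸ hS)) ?_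
    intro ν' ν'' h h1 h' h2
    refine Run.putNat ⟨(h.trans (h'.mono (by omega))).setNat le_rfl _ _, ?_⟩ (by simp [NExp.cost])
    rw [h.vars, NX.eval_congr h.agree] at h2
    simp only [NExp.eval, ncell_eval, setCell_self]
    rw [h2, h'.1 101 d 0 (by omega), h1]
    exact (h.agree.trans h'.agree).1 _ (Nat.mod_lt _ (by norm_num)) _ _
  | .add e f =>
    simp only [NX.compile, NX.time, Polynomial.eval_C, Polynomial.eval_add, NX.eval]
    refine Run.pair (NX.run e d ν S hS)
      (fun ν' h _ => NX.run f (d + 1) ν' S (h.agree.size ▸ hS)) ?_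
    intro ν' ν'' h h1 h' h2
    refine Run.putNat ⟨(h.trans (h'.mono (by omega))).setNat le_rfl _ _, ?_⟩ (by simp [NExp.cost])
    rw [h.vars, NX.eval_congr h.agree] at h2
    simp only [NExp.eval, ncell_eval, setCell_self]
    rw [h2, h'.1 101 d 0 (by omega), h1]
  | .sub e f =>
    simp only [NX.compile, NX.time, Polynomial.eval_C, Polynomial.eval_add, NX.eval]
    refine Run.pair (NX.run e d ν S hS)
      (fun ν' h _ => NX.run f (d + 1) ν' S (h.agree.size ▸ hS)) ?_
    intro ν' ν'' h h1 h' h2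
    refine Run.putNat ⟨(h.trans (h'.mono (by omega))).setNat le_rfl _ _, ?_⟩ (by simp [NExp.cost])
    rw [h.vars, NX.eval_congr h.agree] at h2
    simp only [NExp.eval, ncell_eval, setCell_self]
    rw [h2, h'.1 101 d 0 (by omega), h1]
  | .lt e f =>
    simp only [NX.compile, NX.time, Polynomial.eval_C, Polynomial.eval_add, NX.eval]
    refine Run.pair (NX.run e d ν S hS)
      (fun ν' h _ => NX.run f (d + 1) ν' S (h.agree.size ▸ hS)) ?_
    intro ν' ν'' h h1 h' h2
    refine Run.cond (C := 4)
          (fun hb => Run.putNat ⟨(h.trans (h'.mono (by omega))).setNat le_rfl _ _, ?_⟩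
            (by simp [NExp.cost]))
          (fun hb => Run.putNat ⟨(h.trans (h'.mono (by omega))).setNat le_rfl _ _, ?_⟩
            (by simp [NExp.cost]))
    all_goals
      rw [h.vars, NX.eval_congr h.agree] at h2
      simp only [BExp.holds, ncell_eval] at hb
      rw [h2, h'.1 101 d 0 (by omega), h1] at hb
      simp [NExp.eval, hb]
  | .rlt e f =>
    simp only [NX.compile, NX.time, Polynomial.eval_C, Polynomial.eval_add, NX.eval]
    refine Run.pair (RX.run e d ν S hS)
      (fun ν' h _ => RX.run f (d + 1) ν' S (h.agree.size ▸ hS)) ?_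
    intro ν' ν'' h h1 h' h2
    refine Run.cond (C := 4)
          (fun hb => Run.putNat ⟨(h.trans (h'.mono (by omega))).setNat le_rfl _ _, ?_⟩
            (by simp [NExp.cost]))
          (fun hb => Run.putNat ⟨(h.trans (h'.mono (by omega))).setNat le_rfl _ _, ?_⟩
            (by simp [NExp.cost]))
    all_goals
      rw [h.vars, RX.eval_congr h.agree] at h2
      simp only [BExp.holds, rcell_eval] at hb
      rw [h2, h'.2 100 d 0 (by omega), h1] at hb
      simp [NExp.eval, hb]
  | .ite b e f =>
    simp only [NX.compile, NX.time, Polynomial.eval_C, Polynomial.eval_add, NX.eval]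
    refine (NX.run b d ν S hS).seq fun ν' ⟨h, h1⟩ => Run.cond (fun hb => ?_) (fun hb => ?_)
    all_goals
      simp only [BExp.holds, NExp.eval, ncell_eval, h1] at hb
      simp only [hb, if_true, if_false]
    · refine (NX.run e d ν' S (h.agree.size ▸ hS)).mono (by omega) fun ν'' ⟨h', h2⟩ => ?_
      rw [h.vars, NX.eval_congr h.agree] at h2
      exact ⟨h.trans h', h2⟩
    · refine (NX.run f d ν' S (h.agree.size ▸ hS)).mono (by omega) fun ν'' ⟨h', h2⟩ => ?_
      rw [h.vars, NX.eval_congr h.agree] at h2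
      exact ⟨h.trans h', h2⟩
  | .sum k N e =>
    simp only [NX.compile, NX.time, Polynomial.eval_C, Polynomial.eval_add, Polynomial.eval_mul,
      Polynomial.eval_X, NX.eval]
    let I : ℕ → Mem → Prop := fun i ν' =>
      (∀ a r c, a ≠ 101 ∨ r < d → ¬ (a = 100 ∧ r = k ∧ c = 0) → ν'.nat a r c = ν.nat a r c) ∧
      (∀ a r c, a ≠ 100 ∨ r < d → ν'.real a r c = ν.real a r c) ∧
      ν'.nat 100 k 0 = i ∧ ν'.nat 101 d 0 = ν.nat 100 k 0 ∧
      ν'.nat 101 (d + 1) 0 = ∑ j ∈ Finset.range i, e.eval ν (Function.update ν.vars k j)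
    have hI : ∀ i ν', I i ν' → Agree ν ν' ∧ ν'.vars = Function.update ν.vars k i := by
      intro i ν' hI
      refine ⟨⟨fun a ha r c => hI.1 a r c (by omega) (by omega),
        fun a ha r c => hI.2.1 a r c (by omega)⟩, funext fun k' => ?_⟩
      by_cases hk : k' = k
      · subst hk; rw [Function.update_self]; exact hI.2.2.1
      · rw [Function.update_of_ne hk]; exact hI.1 100 k' 0 (by omega) (by omega)
    refine Run.seq (Q := fun ν' => Frame d ν ν' ∧ ν'.nat 101 d 0 = ν.nat 100 k 0)
      (Run.putNat ⟨(Frame.refl d ν).setNat le_rfl _ _, by simp⟩ (by simp)) fun ν₁ ⟨h1, h1'⟩ => ?_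
    refine Run.seq (Q := fun ν' => Frame d ν ν' ∧ ν'.nat 101 d 0 = ν.nat 100 k 0 ∧
      ν'.nat 101 (d + 1) 0 = 0) (Run.putNat ⟨h1.setNat (by omega) _ _, ?_, by simp [NExp.eval]⟩
        (by simp [NExp.cost])) fun ν₂ ⟨h2, h2', h2''⟩ => ?_
    · simp only []
      rw [setCell_of_ne _ _ (by omega)]; exact h1'
    have hS2 : ν₂.size ≤ S := h2.agree.size ▸ hS
    have hval : N.val ν₂ = N.val ν := h2.agree.val N
    refine Run.seq (Q := I (N.val ν)) ?_ fun ν₃ h3 => ?_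
    · rw [← hval]
      refine Run.forLoop hS2 (fun i ν' h => ⟨h.2.2.1, ((hI i ν' h).1.val N).trans hval.symm⟩) ?_ ?_
      · refine ⟨fun a r c h h' => ?_, h2.2, by simp, ?_, ?_⟩
        · simp only []
          rw [setCell_of_ne _ _ h']; exact h2.1 a r c h
        · simp only []
          rw [setCell_of_ne _ _ (by omega)]; exact h2'
        · simp only []
          rw [setCell_of_ne _ _ (by omega)]; simpa using h2''
      · intro i hi ν' h
        obtain ⟨hA, hV⟩ := hI i ν' h
        refine (NX.run e (d + 2) ν' S (hA.size ▸ hS)).seq fun ν'' ⟨hF, hr⟩ => ?_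
        rw [NX.eval_congr hA, hV] at hr
        refine Run.putNat ⟨?_, ?_, ?_, ?_, ?_, ?_⟩ (by simp [NExp.cost])
        · simp only []
          rw [setCell_of_ne _ _ (by omega), hF.1 _ _ _ (by omega)]; exact h.2.2.1
        · intro a r c hd hk
          simp only []
          rw [setCell_of_ne _ _ hk, setCell_of_ne _ _ (by omega), hF.1 _ _ _ (by omega)]
          exact h.1 a r c hd hk
        · intro a r c hd
          simp only []
          rw [hF.2 _ _ _ (by omega)]
          exact h.2.1 a r c hd
        · simp
        · simp only []
          rw [setCell_of_ne _ _ (by omega), setCell_of_ne _ _ (by omega), hF.1 _ _ _ (by omega)]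
          exact h.2.2.2.1
        · simp only []
          rw [setCell_of_ne _ _ (by omega), setCell_self, Finset.sum_range_succ]
          simp only [NExp.eval, ncell_eval]
          rw [hr, hF.1 _ _ _ (by omega), h.2.2.2.2]
    · refine Run.seq (Q := fun ν' => Frame d ν ν' ∧ ν'.nat 101 (d + 1) 0 =
        ∑ j ∈ Finset.range (N.val ν), e.eval ν (Function.update ν.vars k j))
        (Run.putNat ⟨⟨fun a r c h => ?_, h3.2.1⟩, ?_⟩ (by simp)) fun ν₄ ⟨h4, h4'⟩ =>
          Run.putNat ⟨h4.setNat le_rfl _ _, by simpa using h4'⟩ (by simp)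
      · by_cases hk : a = 100 ∧ r = k ∧ c = 0
        · obtain ⟨rfl, rfl, rfl⟩ := hk
          simpa using h3.2.2.2.1
        · simp only []
          rw [setCell_of_ne _ _ hk]; exact h3.1 a r c h hk
      · simp only []
        rw [setCell_of_ne _ _ (by omega)]; exact h3.2.2.2.2

theorem RX.run (e : RX) (d : ℕ) (ν : Mem) (S : ℕ) (hS : ν.size ≤ S) :
    Run (e.compile d) ν (e.time.eval S)
      fun ν' => Frame d ν ν' ∧ ν'.real 100 d 0 = e.eval ν ν.vars := by
  match e with
  | .const z =>
    simp only [RX.compile, RX.time, Polynomial.eval_C, RX.eval]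
    exact Run.putReal ⟨(Frame.refl d ν).setReal le_rfl _ _, by simp [RExp.eval]⟩
      (by simp [RExp.cost])
  | .read a r c =>
    simp only [RX.compile, RX.time, Polynomial.eval_C, Polynomial.eval_add, RX.eval]
    refine Run.pair (NX.run r d ν S hS)
      (fun ν' h _ => NX.run c (d + 1) ν' S (h.agree.size ▸ hS)) ?_
    intro ν' ν'' h h1 h' h2
    refine Run.putReal ⟨(h.trans (h'.mono (by omega))).setReal le_rfl _ _, ?_⟩ (by simp [RExp.cost])
    rw [h.vars, NX.eval_congr h.agree] at h2
    simp only [RExp.eval, ncell_eval, setCell_self]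
    rw [h2, h'.1 101 d 0 (by omega), h1]
    exact (h.agree.trans h'.agree).2 _ (Nat.mod_lt _ (by norm_num)) _ _
  | .sub e f =>
    simp only [RX.compile, RX.time, Polynomial.eval_C, Polynomial.eval_add, RX.eval]
    refine Run.pair (RX.run e d ν S hS)
      (fun ν' h _ => RX.run f (d + 1) ν' S (h.agree.size ▸ hS)) ?_
    intro ν' ν'' h h1 h' h2
    refine Run.putReal ⟨(h.trans (h'.mono (by omega))).setReal le_rfl _ _, ?_⟩ (by simp [RExp.cost])
    rw [h.vars, RX.eval_congr h.agree] at h2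
    simp only [RExp.eval, rcell_eval, setCell_self]
    rw [h2, h'.2 100 d 0 (by omega), h1]
  | .mul e f =>
    simp only [RX.compile, RX.time, Polynomial.eval_C, Polynomial.eval_add, RX.eval]
    refine Run.pair (RX.run e d ν S hS)
      (fun ν' h _ => RX.run f (d + 1) ν' S (h.agree.size ▸ hS)) ?_
    intro ν' ν'' h h1 h' h2
    refine Run.putReal ⟨(h.trans (h'.mono (by omega))).setReal le_rfl _ _, ?_⟩ (by simp [RExp.cost])
    rw [h.vars, RX.eval_congr h.agree] at h2
    simp only [RExp.eval, rcell_eval, setCell_self]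
    rw [h2, h'.2 100 d 0 (by omega), h1]
  | .div e f =>
    simp only [RX.compile, RX.time, Polynomial.eval_C, Polynomial.eval_add, RX.eval]
    refine Run.pair (RX.run e d ν S hS)
      (fun ν' h _ => RX.run f (d + 1) ν' S (h.agree.size ▸ hS)) ?_
    intro ν' ν'' h h1 h' h2
    refine Run.putReal ⟨(h.trans (h'.mono (by omega))).setReal le_rfl _ _, ?_⟩ (by simp [RExp.cost])
    rw [h.vars, RX.eval_congr h.agree] at h2
    simp only [RExp.eval, rcell_eval, setCell_self]
    rw [h2, h'.2 100 d 0 (by omega), h1]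
  | .ite b e f =>
    simp only [RX.compile, RX.time, Polynomial.eval_C, Polynomial.eval_add, RX.eval]
    refine (NX.run b d ν S hS).seq fun ν' ⟨h, h1⟩ => Run.cond (fun hb => ?_) (fun hb => ?_)
    all_goals
      simp only [BExp.holds, NExp.eval, ncell_eval, h1] at hb
      simp only [hb, if_true, if_false]
    · refine (RX.run e d ν' S (h.agree.size ▸ hS)).mono (by omega) fun ν'' ⟨h', h2⟩ => ?_
      rw [h.vars, RX.eval_congr h.agree] at h2
      exact ⟨h.trans h', h2⟩
    · refine (RX.run f d ν' S (h.agree.size ▸ hS)).mono (by omega) fun ν'' ⟨h', h2⟩ => ?_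
      rw [h.vars, RX.eval_congr h.agree] at h2
      exact ⟨h.trans h', h2⟩
  | .sum k N e =>
    simp only [RX.compile, RX.time, Polynomial.eval_C, Polynomial.eval_add, Polynomial.eval_mul,
      Polynomial.eval_X, RX.eval]
    let I : ℕ → Mem → Prop := fun i ν' =>
      (∀ a r c, a ≠ 101 ∨ r < d → ¬ (a = 100 ∧ r = k ∧ c = 0) → ν'.nat a r c = ν.nat a r c) ∧
      (∀ a r c, a ≠ 100 ∨ r < d → ν'.real a r c = ν.real a r c) ∧
      ν'.nat 100 k 0 = i ∧ ν'.nat 101 d 0 = ν.nat 100 k 0 ∧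
      ν'.real 100 (d + 1) 0 = ∑ j ∈ Finset.range i, e.eval ν (Function.update ν.vars k j)
    have hI : ∀ i ν', I i ν' → Agree ν ν' ∧ ν'.vars = Function.update ν.vars k i := by
      intro i ν' hI
      refine ⟨⟨fun a ha r c => hI.1 a r c (by omega) (by omega),
        fun a ha r c => hI.2.1 a r c (by omega)⟩, funext fun k' => ?_⟩
      by_cases hk : k' = k
      · subst hk; rw [Function.update_self]; exact hI.2.2.1
      · rw [Function.update_of_ne hk]; exact hI.1 100 k' 0 (by omega) (by omega)
    refine Run.seq (Q := fun ν' => Frame d ν ν' ∧ ν'.nat 101 d 0 = ν.nat 100 k 0)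
      (Run.putNat ⟨(Frame.refl d ν).setNat le_rfl _ _, by simp⟩ (by simp)) fun ν₁ ⟨h1, h1'⟩ => ?_
    refine Run.seq (Q := fun ν' => Frame d ν ν' ∧ ν'.nat 101 d 0 = ν.nat 100 k 0 ∧
      ν'.real 100 (d + 1) 0 = 0) (Run.putReal ⟨h1.setReal (by omega) _ _, h1',
        by simp [RExp.eval]⟩ (by simp [RExp.cost])) fun ν₂ ⟨h2, h2', h2''⟩ => ?_
    have hS2 : ν₂.size ≤ S := h2.agree.size ▸ hS
    have hval : N.val ν₂ = N.val ν := h2.agree.val N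
    refine Run.seq (Q := I (N.val ν)) ?_ fun ν₃ h3 => ?_
    · rw [← hval]
      refine Run.forLoop hS2 (fun i ν' h => ⟨h.2.2.1, ((hI i ν' h).1.val N).trans hval.symm⟩) ?_ ?_
      · refine ⟨fun a r c h h' => ?_, h2.2, by simp, ?_, ?_⟩
        · simp only []
          rw [setCell_of_ne _ _ h']; exact h2.1 a r c h
        · simp only []
          rw [setCell_of_ne _ _ (by omega)]; exact h2'
        · simpa using h2''
      · intro i hi ν' h
        obtain ⟨hA, hV⟩ := hI i ν' h
        refine (RX.run e (d + 2) ν' S (hA.size ▸ hS)).seq fun ν'' ⟨hF, hr⟩ => ?_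
        rw [RX.eval_congr hA, hV] at hr
        refine Run.putReal ⟨?_, ?_, ?_, ?_, ?_, ?_⟩ (by simp [RExp.cost])
        · simp only []
          rw [hF.1 _ _ _ (by omega)]; exact h.2.2.1
        · intro a r c hd hk
          simp only []
          rw [setCell_of_ne _ _ hk, hF.1 _ _ _ (by omega)]
          exact h.1 a r c hd hk
        · intro a r c hd
          simp only []
          rw [setCell_of_ne _ _ (by omega), hF.2 _ _ _ (by omega)]
          exact h.2.1 a r c hd
        · simp
        · simp only []
          rw [setCell_of_ne _ _ (by omega), hF.1 _ _ _ (by omega)]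
          exact h.2.2.2.1
        · simp only []
          rw [setCell_self, Finset.sum_range_succ]
          simp only [RExp.eval, rcell_eval]
          rw [hr, hF.2 _ _ _ (by omega), h.2.2.2.2]
    · refine Run.seq (Q := fun ν' => Frame d ν ν' ∧ ν'.real 100 (d + 1) 0 =
        ∑ j ∈ Finset.range (N.val ν), e.eval ν (Function.update ν.vars k j))
        (Run.putNat ⟨⟨fun a r c h => ?_, h3.2.1⟩, h3.2.2.2.2⟩ (by simp)) fun ν₄ ⟨h4, h4'⟩ =>
          Run.putReal ⟨h4.setReal le_rfl _ _, by simpa using h4'⟩ (by simp)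
      by_cases hk : a = 100 ∧ r = k ∧ c = 0
      · obtain ⟨rfl, rfl, rfl⟩ := hk
        simpa using h3.2.2.2.1
      · simp only []
        rw [setCell_of_ne _ _ hk]; exact h3.1 a r c h hk

end

end BivaluedChores

end
noncomputable section

namespace BivaluedChores

/-! ### Statements that fill arrays -/

/-- Statements. A `fill` computes all cells of a block of an array simultaneously; the index
variables `0` and `1` hold the row and the column. -/
inductive St where
  | fillNat (a : ℕ) (N M : Bound) (e : NX)
  | fillReal (a : ℕ) (N M : Bound) (e : RX)
  | seq (P Q : St)
  | ite (b : NX) (P Q : St)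
  | iter (N : Bound) (P : St)

/-- The index variables for a cell. -/
def cellVars (r c : ℕ) : ℕ → ℕ := Function.update (Function.update (fun _ => 0) 0 r) 1 c

namespace St

/-- The meaning of a statement. -/
def sem : St → Mem → Mem
  | fillNat a N M e, μ =>
    { μ with nat := fun a' r c => if a' = a % 100 ∧ r < N.val μ ∧ c < M.val μ
      then e.eval μ (cellVars r c) else μ.nat a' r c }
  | fillReal a N M e, μ =>
    { μ with real := fun a' r c => if a' = a % 100 ∧ r < N.val μ ∧ c < M.val μ
      then e.eval μ (cellVars r c) else μ.real a' r c }
  | seq P Q, μ => Q.sem (P.sem μ)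
  | ite b P Q, μ => if 0 < b.eval μ (fun _ => 0) then P.sem μ else Q.sem μ
  | iter N P, μ => P.sem^[N.val μ] μ

/-- The statement does not write to the integer array `a`. -/
def keepsNat (a : ℕ) : St → Bool
  | fillNat b _ _ _ => decide (b % 100 ≠ a)
  | fillReal _ _ _ _ => true
  | seq P Q => P.keepsNat a && Q.keepsNat a
  | ite _ P Q => P.keepsNat a && Q.keepsNat a
  | iter _ P => P.keepsNat a

/-- The statement does not write to the real array `a`. -/
def keepsReal (a : ℕ) : St → Bool
  | fillNat _ _ _ _ => true
  | fillReal b _ _ _ => decide (b % 100 ≠ a)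
  | seq P Q => P.keepsReal a && Q.keepsReal a
  | ite _ P Q => P.keepsReal a && Q.keepsReal a
  | iter _ P => P.keepsReal a

/-- The index variable `k`. -/
def idx (k : ℕ) : NExp := ncell 100 k

/-- A loop over the cells of a block. -/
def forCells (N M : Bound) (P : Prog) : Prog := forLoop 0 N (forLoop 1 M P)

/-- Reset the index variables. -/
def resetVars : Prog := (putNat 100 0 (.const 0)).seq (putNat 100 1 (.const 0))

/-- The program for a statement; loop counters are in integer array `103`. -/
def compile (d : ℕ) : St → Prog
  | fillNat a N M e =>
    (forCells N M ((e.compile 0).seq (.setNat 102 (idx 0) (idx 1) (ncell 101 0)))).seq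
      ((forCells N M (.setNat (a % 100) (idx 0) (idx 1) (.read 102 (idx 0) (idx 1)))).seq
        resetVars)
  | fillReal a N M e =>
    (forCells N M ((e.compile 0).seq (.setReal 101 (idx 0) (idx 1) (rcell 100 0)))).seq
      ((forCells N M (.setReal (a % 100) (idx 0) (idx 1) (.read 101 (idx 0) (idx 1)))).seq
        resetVars)
  | seq P Q => (P.compile d).seq (Q.compile d)
  | ite b P Q => (b.compile 0).seq
      (.cond (.natLt (.const 0) (ncell 101 0)) (P.compile d) (Q.compile d))
  | iter N P => (putNat 103 d (.const 0)).seq (.loop (.natLt (ncell 103 d) N.toNExp)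
      ((P.compile (d + 1)).seq (putNat 103 d (.plus (ncell 103 d) (.const 1)))))

open Polynomial in
/-- The time for a loop over the cells of a block. -/
def cellsTime (q : ℕ[X]) : ℕ[X] :=
  C 4 + (X * ((C 4 + (X * (q + C 8 + C 9) + C 9)) + C 8 + C 9) + C 9)

open Polynomial in
/-- A bound for the running time. -/
def time : St → ℕ[X]
  | fillNat _ _ _ e => cellsTime (e.time + C 10) + (cellsTime (C 14) + (C 4 + C 4))
  | fillReal _ _ _ e => cellsTime (e.time + C 10) + (cellsTime (C 14) + (C 4 + C 4))
  | seq P Q => P.time + Q.time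
  | ite b P Q => b.time + (C 5 + (P.time + Q.time))
  | iter _ P => C 4 + (X * ((P.time + C 8) + C 9) + C 9)

theorem sem_nat {a : ℕ} : ∀ (P : St) (_ : P.keepsNat a = true) (μ : Mem),
    (P.sem μ).nat a = μ.nat a
  | fillNat b N M e, h, μ => by
    simp only [keepsNat, decide_eq_true_eq] at h
    funext r c
    simp only [sem]
    rw [if_neg (by omega)]
  | fillReal b N M e, h, μ => rfl
  | seq P Q, h, μ => by
    simp only [keepsNat, Bool.and_eq_true] at h
    rw [sem, sem_nat Q h.2, sem_nat P h.1]
  | ite b P Q, h, μ => by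
    simp only [keepsNat, Bool.and_eq_true] at h
    rw [sem]
    split_ifs
    · exact sem_nat P h.1 _
    · exact sem_nat Q h.2 _
  | iter N P, h, μ => by
    simp only [keepsNat] at h
    rw [sem]
    generalize N.val μ = k
    induction k with
    | zero => rfl
    | succ k ih => rw [Function.iterate_succ_apply', sem_nat P h, ih]

theorem sem_real {a : ℕ} : ∀ (P : St) (_ : P.keepsReal a = true) (μ : Mem),
    (P.sem μ).real a = μ.real a
  | fillNat b N M e, h, μ => rfl
  | fillReal b N M e, h, μ => by
    simp only [keepsReal, decide_eq_true_eq] at h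
    funext r c
    simp only [sem]
    rw [if_neg (by omega)]
  | seq P Q, h, μ => by
    simp only [keepsReal, Bool.and_eq_true] at h
    rw [sem, sem_real Q h.2, sem_real P h.1]
  | ite b P Q, h, μ => by
    simp only [keepsReal, Bool.and_eq_true] at h
    rw [sem]
    split_ifs
    · exact sem_real P h.1 _
    · exact sem_real Q h.2 _
  | iter N P, h, μ => by
    simp only [keepsReal] at h
    rw [sem]
    generalize N.val μ = k
    induction k with
    | zero => rfl
    | succ k ih => rw [Function.iterate_succ_apply', sem_real P h, ih]

/-- The statement does not write to the arrays that hold the size of the input. -/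
def Ok (P : St) : Prop := P.keepsNat 0 = true ∧ P.keepsNat 1 = true

theorem sem_size {P : St} (h : P.Ok) (μ : Mem) : (P.sem μ).size = μ.size := by
  simp [Mem.size, sem_nat P h.1, sem_nat P h.2]

/-- The memory `ν` holds the data of `μ`, and the index variables are zero. -/
def Sim (μ ν : Mem) : Prop := Agree μ ν ∧ ∀ k, ν.nat 100 k 0 = 0

/-- The rule for loops over the cells of a block, where `K D` holds when the cells in `D` have
been treated. -/
theorem run_forCells {N M : Bound} {P : Prog} {ν : Mem} {S : ℕ} {q : Polynomial ℕ}
    {K : (ℕ → ℕ → Prop) → Mem → Prop} (hS : ν.size ≤ S)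
    (hvar : ∀ D ν' k z, k < 2 → K D ν' → K D { ν' with nat := setCell ν'.nat 100 k 0 z })
    (hagree : ∀ D ν', K D ν' → ν'.nat 0 0 0 = ν.nat 0 0 0 ∧ ν'.nat 1 0 0 = ν.nat 1 0 0)
    (hstep : ∀ i < N.val ν, ∀ j < M.val ν, ∀ D ν', K D ν' → ν'.nat 100 0 0 = i →
      ν'.nat 100 1 0 = j → Run P ν' (q.eval S) fun ν'' => ν''.nat 100 0 0 = i ∧
        ν''.nat 100 1 0 = j ∧ K (fun r c => D r c ∨ r = i ∧ c = j) ν'')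
    (h0 : K (fun _ _ => False) ν) :
    Run (forCells N M P) ν ((cellsTime q).eval S)
      (K fun r c => r < N.val ν ∧ c < M.val ν) := by
  have hK : ∀ {D D' : ℕ → ℕ → Prop} {ν'}, K D ν' → (∀ r c, D r c ↔ D' r c) → K D' ν' := by
    intro D D' ν' h hD
    rwa [← funext fun r => funext fun c => propext (hD r c)]
  have hval : ∀ D ν', K D ν' → ∀ B : Bound, B.val ν' = B.val ν := by
    intro D ν' h B
    obtain ⟨h1, h2⟩ := hagree D ν' h
    cases B <;> simp [Bound.val, h1, h2]
  have hsize : ∀ D ν', K D ν' → ν'.size ≤ S := by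
    intro D ν' h
    obtain ⟨h1, h2⟩ := hagree D ν' h
    rw [Mem.size, h1, h2]; exact hS
  simp only [cellsTime, Polynomial.eval_add, Polynomial.eval_mul, Polynomial.eval_X,
    Polynomial.eval_C, forCells]
  refine (Run.forLoop (I := fun i ν' => ν'.nat 100 0 0 = i ∧
      K (fun r c => r < i ∧ c < M.val ν) ν') hS (fun i ν' h => ⟨h.1, hval _ _ h.2 _⟩)
    ⟨by simp, hvar _ _ _ _ (by norm_num) ?_⟩ ?_).mono le_rfl fun _ h => h.2
  · exact hK h0 fun r c => by simp
  · rintro i hi ν₁ ⟨h1, h2⟩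
    refine (Run.forLoop (I := fun j ν' => ν'.nat 100 1 0 = j ∧ ν'.nat 100 0 0 = i ∧
      K (fun r c => r < i ∧ c < M.val ν ∨ r = i ∧ c < j) ν') (hsize _ _ h2)
      (fun j ν' h => ⟨h.1, (hval _ _ h.2.2 _).trans (hval _ _ h2 _).symm⟩)
      ⟨by simp, ?_, hvar _ _ _ _ (by norm_num) ?_⟩ ?_).mono le_rfl ?_
    · simp only []
      rw [setCell_of_ne _ _ (by omega)]; exact h1
    · exact hK h2 fun r c => by omega
    · rintro j hj ν₂ ⟨h3, h4, h5⟩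
      rw [hval _ _ h2] at hj
      refine (hstep i hi j hj _ ν₂ h5 h4 h3).mono le_rfl fun ν₃ ⟨h6, h7, h8⟩ => ?_
      refine ⟨h7, by simp, ?_, hvar _ _ _ _ (by norm_num) ?_⟩
      · simp only []
        rw [setCell_of_ne _ _ (by omega)]; exact h6
      · exact hK h8 fun r c => by omega
    · rintro ν₂ ⟨h3, h4, h5⟩
      rw [hval _ _ h2] at h5
      refine ⟨h4, by simp, hvar _ _ _ _ (by norm_num) ?_⟩
      exact hK h5 fun r c => by omega

theorem run_resetVars {μ ν : Mem} {d : ℕ} {κ : Mem} (h : Agree μ ν)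
    (hv : ∀ k, 2 ≤ k → ν.nat 100 k 0 = 0) (hc : ∀ r < d, ν.nat 103 r 0 = κ.nat 103 r 0) :
    Run resetVars ν (4 + 4) fun ν' => Sim μ ν' ∧ ∀ r < d, ν'.nat 103 r 0 = κ.nat 103 r 0 := by
  refine Run.seq (Q := fun ν' => Agree μ ν' ∧ (∀ k, 2 ≤ k ∨ k = 0 → ν'.nat 100 k 0 = 0) ∧
    ∀ r < d, ν'.nat 103 r 0 = κ.nat 103 r 0) (Run.putNat ?_ (by simp [NExp.cost]))
    fun ν' h' => Run.putNat ?_ (by simp [NExp.cost])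
  · refine ⟨⟨fun a ha r c => ?_, h.2⟩, fun k hk => ?_, fun r hr => ?_⟩
    · simp only []
      rw [setCell_of_ne _ _ (by omega)]; exact h.1 a ha r c
    · by_cases hk0 : k = 0
      · subst hk0; simp [NExp.eval]
      · simp only []
        rw [setCell_of_ne _ _ (by omega)]; exact hv k (by omega)
    · simp only []
      rw [setCell_of_ne _ _ (by omega)]; exact hc r hr
  · refine ⟨⟨⟨fun a ha r c => ?_, h'.1.2⟩, fun k => ?_⟩, fun r hr => ?_⟩
    · simp only []
      rw [setCell_of_ne _ _ (by omega)]; exact h'.1.1 a ha r c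
    · by_cases hk0 : k = 1
      · subst hk0; simp [NExp.eval]
      · simp only []
        rw [setCell_of_ne _ _ (by omega)]; exact h'.2.1 k (by omega)
    · simp only []
      rw [setCell_of_ne _ _ (by omega)]; exact h'.2.2 r hr

theorem vars_eq {ν : Mem} {i j : ℕ} (hv : ∀ k, 2 ≤ k → ν.nat 100 k 0 = 0)
    (hi : ν.nat 100 0 0 = i) (hj : ν.nat 100 1 0 = j) : ν.vars = cellVars i j := by
  funext k
  rcases k with _ | _ | k
  · simpa [Mem.vars, cellVars] using hi
  · simpa [Mem.vars, cellVars] using hj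
  · simpa [Mem.vars, cellVars] using hv (k + 2) (by omega)

theorem run_fillNat (a : ℕ) (N M : Bound) (e : NX) (hok : 2 ≤ a % 100) (d : ℕ) {μ ν : Mem}
    (h : Sim μ ν) {S : ℕ} (hS : μ.size ≤ S) :
    Run ((fillNat a N M e).compile d) ν ((fillNat a N M e).time.eval S) fun ν' =>
      Sim ((fillNat a N M e).sem μ) ν' ∧ ∀ r < d, ν'.nat 103 r 0 = ν.nat 103 r 0 := by
  have ha : a % 100 < 100 := Nat.mod_lt _ (by norm_num)
  generalize hb : a % 100 = b at ha hok
  simp only [compile, time, Polynomial.eval_add, Polynomial.eval_C, hb]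
  obtain ⟨hA, hV⟩ := h
  have hN : N.val ν = N.val μ := hA.val N
  have hM : M.val ν = M.val μ := hA.val M
  let val : ℕ → ℕ → ℕ := fun r c => e.eval μ (cellVars r c)
  refine Run.seq (Q := fun ν' => Agree μ ν' ∧ (∀ k, 2 ≤ k → ν'.nat 100 k 0 = 0) ∧
      (∀ r < d, ν'.nat 103 r 0 = ν.nat 103 r 0) ∧
      ∀ r c, r < N.val μ ∧ c < M.val μ → ν'.nat 102 r c = val r c) ?_ ?_
  · rw [← hN, ← hM]
    refine run_forCells (K := fun D ν' => Agree μ ν' ∧ (∀ k, 2 ≤ k → ν'.nat 100 k 0 = 0) ∧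
      (∀ r < d, ν'.nat 103 r 0 = ν.nat 103 r 0) ∧
      ∀ r c, D r c → ν'.nat 102 r c = val r c) (hA.size ▸ hS) ?_ ?_ ?_ ?_
    · rintro D ν' k z hk ⟨h1, h2, h3, h4⟩
      refine ⟨⟨fun a ha r c => ?_, h1.2⟩, fun k' hk' => ?_, fun r hr => ?_, fun r c hD => ?_⟩
      all_goals
        simp only []
        rw [setCell_of_ne _ _ (by omega)]
      exacts [h1.1 a ha r c, h2 k' hk', h3 r hr, h4 r c hD]
    · rintro D ν' ⟨h1, -⟩
      have := hA.symm.trans h1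
      exact ⟨this.1 0 (by norm_num) 0 0, this.1 1 (by norm_num) 0 0⟩
    · rintro i hi j hj D ν' ⟨h1, h2, h3, h4⟩ h0 h0'
      simp only [Polynomial.eval_add, Polynomial.eval_C]
      refine (NX.run e 0 ν' S (h1.size ▸ hS)).seq fun ν'' ⟨hF, hr⟩ =>
        (Run.setNat ?_).mono (by simp [idx]) fun _ => id
      rw [vars_eq h2 h0 h0', NX.eval_congr h1] at hr
      have hi' : (idx 0).eval ν'' = i := (hF.1 _ _ _ (by omega)).trans h0
      have hj' : (idx 1).eval ν'' = j := (hF.1 _ _ _ (by omega)).trans h0'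
      rw [hi', hj', ncell_eval, hr]
      refine ⟨?_, ?_, ⟨fun a ha r c => ?_, fun a ha r c => ?_⟩, fun k hk => ?_, fun r hr => ?_,
        fun r c hD => ?_⟩
      · simp only []
        rw [setCell_of_ne _ _ (by omega)]; exact hi'
      · simp only []
        rw [setCell_of_ne _ _ (by omega)]; exact hj'
      · simp only []
        rw [setCell_of_ne _ _ (by omega), hF.1 _ _ _ (by omega)]; exact h1.1 a ha r c
      · simp only []
        rw [hF.2 _ _ _ (by omega)]; exact h1.2 a ha r c
      · simp only []
        rw [setCell_of_ne _ _ (by omega), hF.1 _ _ _ (by omega)]; exact h2 k hk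
      · simp only []
        rw [setCell_of_ne _ _ (by omega), hF.1 _ _ _ (by omega)]; exact h3 r hr
      · by_cases hrc : r = i ∧ c = j
        · obtain ⟨rfl, rfl⟩ := hrc
          simp [val]
        · simp only []
          rw [setCell_of_ne _ _ (by omega), hF.1 _ _ _ (by omega)]
          exact h4 r c (hD.resolve_right hrc)
    · exact ⟨hA, fun k _ => hV k, fun _ _ => rfl, fun _ _ h => h.elim⟩
  rintro ν₁ ⟨hA1, hV1, hc1, hb1⟩
  have hN1 : N.val ν₁ = N.val μ := hA1.val N
  have hM1 : M.val ν₁ = M.val μ := hA1.val M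
  refine Run.seq (Q := fun ν' => Agree ((fillNat a N M e).sem μ) ν' ∧
      (∀ k, 2 ≤ k → ν'.nat 100 k 0 = 0) ∧ ∀ r < d, ν'.nat 103 r 0 = ν.nat 103 r 0) ?_
    fun ν' h' => run_resetVars h'.1 h'.2.1 h'.2.2
  refine (run_forCells (N := N) (M := M) (q := Polynomial.C 14)
    (K := fun D ν' => (∀ a' < 100, ∀ r c, ¬ (a' = b ∧ D r c) →
      ν'.nat a' r c = μ.nat a' r c) ∧ (∀ a' < 100, ∀ r c, ν'.real a' r c = μ.real a' r c) ∧
      (∀ r c, D r c → ν'.nat b r c = val r c) ∧ (∀ k, 2 ≤ k → ν'.nat 100 k 0 = 0) ∧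
      (∀ r < d, ν'.nat 103 r 0 = ν.nat 103 r 0) ∧
      ∀ r c, r < N.val μ ∧ c < M.val μ → ν'.nat 102 r c = val r c)
    (hA1.size ▸ hS) ?_ ?_ ?_ ?_).mono le_rfl ?_
  · rintro D ν' k z hk ⟨h1, h2, h3, h4, h5, h6⟩
    refine ⟨fun a ha r c hD => ?_, h2, fun r c hD => ?_, fun k' hk' => ?_, fun r hr => ?_,
      fun r c hD => ?_⟩
    all_goals
      simp only []
      rw [setCell_of_ne _ _ (by omega)]
    exacts [h1 a ha r c hD, h3 r c hD, h4 k' hk', h5 r hr, h6 r c hD]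
  · rintro D ν' ⟨h1, -⟩
    rw [h1 0 (by omega) _ _ (by omega), h1 1 (by omega) _ _ (by omega)]
    exact ⟨(hA1.1 0 (by omega) _ _).symm, (hA1.1 1 (by omega) _ _).symm⟩
  · rintro i hi j hj D ν' ⟨h1, h2, h3, h4, h5, h6⟩ h0 h0'
    refine (Run.setNat ?_).mono (by simp [idx, NExp.cost]) fun _ => id
    have hi' : (idx 0).eval ν' = i := h0
    have hj' : (idx 1).eval ν' = j := h0'
    rw [hi', hj', NExp.eval, hi', hj', h6 i j ⟨hN1 ▸ hi, hM1 ▸ hj⟩]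
    refine ⟨?_, ?_, fun a' ha' r c hD => ?_, h2, fun r c hD => ?_, fun k hk => ?_, fun r hr => ?_,
      fun r c hrc => ?_⟩
    · simp only []
      rw [setCell_of_ne _ _ (by omega)]; exact hi'
    · simp only []
      rw [setCell_of_ne _ _ (by omega)]; exact hj'
    · simp only []
      rw [setCell_of_ne _ _ (by tauto)]; exact h1 a' ha' r c (by tauto)
    · by_cases hrc : r = i ∧ c = j
      · obtain ⟨rfl, rfl⟩ := hrc
        simp
      · simp only []
        rw [setCell_of_ne _ _ (by omega)]; exact h3 r c (hD.resolve_right hrc)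
    · simp only []
      rw [setCell_of_ne _ _ (by omega)]; exact h4 k hk
    · simp only []
      rw [setCell_of_ne _ _ (by omega)]; exact h5 r hr
    · simp only []
      rw [setCell_of_ne _ _ (by omega)]; exact h6 r c hrc
  · exact ⟨fun a ha r c _ => hA1.1 a ha r c, fun a ha r c => hA1.2 a ha r c,
      fun _ _ h => h.elim, hV1, hc1, hb1⟩
  · rintro ν' ⟨h1, h2, h3, h4, h5, h6⟩
    refine ⟨⟨fun a' ha' r c => ?_, h2⟩, h4, h5⟩
    simp only [sem, hb]
    rw [hN1, hM1] at h1 h3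
    split_ifs with hc
    · obtain ⟨rfl, hc⟩ := hc
      exact h3 r c hc
    · exact h1 a' ha' r c hc

theorem run_fillReal (a : ℕ) (N M : Bound) (e : RX) (d : ℕ) {μ ν : Mem}
    (h : Sim μ ν) {S : ℕ} (hS : μ.size ≤ S) :
    Run ((fillReal a N M e).compile d) ν ((fillReal a N M e).time.eval S) fun ν' =>
      Sim ((fillReal a N M e).sem μ) ν' ∧ ∀ r < d, ν'.nat 103 r 0 = ν.nat 103 r 0 := by
  have ha : a % 100 < 100 := Nat.mod_lt _ (by norm_num)
  generalize hb : a % 100 = b at ha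
  simp only [compile, time, Polynomial.eval_add, Polynomial.eval_C, hb]
  obtain ⟨hA, hV⟩ := h
  have hN : N.val ν = N.val μ := hA.val N
  have hM : M.val ν = M.val μ := hA.val M
  let val : ℕ → ℕ → ℝ := fun r c => e.eval μ (cellVars r c)
  refine Run.seq (Q := fun ν' => Agree μ ν' ∧ (∀ k, 2 ≤ k → ν'.nat 100 k 0 = 0) ∧
      (∀ r < d, ν'.nat 103 r 0 = ν.nat 103 r 0) ∧
      ∀ r c, r < N.val μ ∧ c < M.val μ → ν'.real 101 r c = val r c) ?_ ?_
  · rw [← hN, ← hM]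
    refine run_forCells (K := fun D ν' => Agree μ ν' ∧ (∀ k, 2 ≤ k → ν'.nat 100 k 0 = 0) ∧
      (∀ r < d, ν'.nat 103 r 0 = ν.nat 103 r 0) ∧
      ∀ r c, D r c → ν'.real 101 r c = val r c) (hA.size ▸ hS) ?_ ?_ ?_ ?_
    · rintro D ν' k z hk ⟨h1, h2, h3, h4⟩
      refine ⟨⟨fun a ha r c => ?_, h1.2⟩, fun k' hk' => ?_, fun r hr => ?_, h4⟩
      all_goals
        simp only []
        rw [setCell_of_ne _ _ (by omega)]
      exacts [h1.1 a ha r c, h2 k' hk', h3 r hr]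
    · rintro D ν' ⟨h1, -⟩
      have := hA.symm.trans h1
      exact ⟨this.1 0 (by norm_num) 0 0, this.1 1 (by norm_num) 0 0⟩
    · rintro i hi j hj D ν' ⟨h1, h2, h3, h4⟩ h0 h0'
      simp only [Polynomial.eval_add, Polynomial.eval_C]
      refine (RX.run e 0 ν' S (h1.size ▸ hS)).seq fun ν'' ⟨hF, hr⟩ =>
        (Run.setReal ?_).mono (by simp [idx]) fun _ => id
      rw [vars_eq h2 h0 h0', RX.eval_congr h1] at hr
      have hi' : (idx 0).eval ν'' = i := (hF.1 _ _ _ (by omega)).trans h0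
      have hj' : (idx 1).eval ν'' = j := (hF.1 _ _ _ (by omega)).trans h0'
      rw [hi', hj', rcell_eval, hr]
      refine ⟨hi', hj', ⟨fun a ha r c => ?_, fun a ha r c => ?_⟩, fun k hk => ?_, fun r hr => ?_,
        fun r c hD => ?_⟩
      · exact (hF.1 _ _ _ (by omega)).trans (h1.1 a ha r c)
      · simp only []
        rw [setCell_of_ne _ _ (by omega), hF.2 _ _ _ (by omega)]; exact h1.2 a ha r c
      · exact (hF.1 _ _ _ (by omega)).trans (h2 k hk)
      · exact (hF.1 _ _ _ (by omega)).trans (h3 r hr)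
      · by_cases hrc : r = i ∧ c = j
        · obtain ⟨rfl, rfl⟩ := hrc
          simp [val]
        · simp only []
          rw [setCell_of_ne _ _ (by omega), hF.2 _ _ _ (by omega)]
          exact h4 r c (hD.resolve_right hrc)
    · exact ⟨hA, fun k _ => hV k, fun _ _ => rfl, fun _ _ h => h.elim⟩
  rintro ν₁ ⟨hA1, hV1, hc1, hb1⟩
  have hN1 : N.val ν₁ = N.val μ := hA1.val N
  have hM1 : M.val ν₁ = M.val μ := hA1.val M
  refine Run.seq (Q := fun ν' => Agree ((fillReal a N M e).sem μ) ν' ∧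
      (∀ k, 2 ≤ k → ν'.nat 100 k 0 = 0) ∧ ∀ r < d, ν'.nat 103 r 0 = ν.nat 103 r 0) ?_
    fun ν' h' => run_resetVars h'.1 h'.2.1 h'.2.2
  refine (run_forCells (N := N) (M := M) (q := Polynomial.C 14)
    (K := fun D ν' => (∀ a' < 100, ∀ r c, ¬ (a' = b ∧ D r c) →
      ν'.real a' r c = μ.real a' r c) ∧ (∀ a' < 100, ∀ r c, ν'.nat a' r c = μ.nat a' r c) ∧
      (∀ r c, D r c → ν'.real b r c = val r c) ∧ (∀ k, 2 ≤ k → ν'.nat 100 k 0 = 0) ∧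
      (∀ r < d, ν'.nat 103 r 0 = ν.nat 103 r 0) ∧
      ∀ r c, r < N.val μ ∧ c < M.val μ → ν'.real 101 r c = val r c)
    (hA1.size ▸ hS) ?_ ?_ ?_ ?_).mono le_rfl ?_
  · rintro D ν' k z hk ⟨h1, h2, h3, h4, h5, h6⟩
    refine ⟨h1, fun a ha r c => ?_, h3, fun k' hk' => ?_, fun r hr => ?_, h6⟩
    all_goals
      simp only []
      rw [setCell_of_ne _ _ (by omega)]
    exacts [h2 a ha r c, h4 k' hk', h5 r hr]
  · rintro D ν' ⟨-, h2, -⟩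
    rw [h2 0 (by omega), h2 1 (by omega)]
    exact ⟨(hA1.1 0 (by omega) _ _).symm, (hA1.1 1 (by omega) _ _).symm⟩
  · rintro i hi j hj D ν' ⟨h1, h2, h3, h4, h5, h6⟩ h0 h0'
    refine (Run.setReal ?_).mono (by simp [idx, RExp.cost]) fun _ => id
    have hi' : (idx 0).eval ν' = i := h0
    have hj' : (idx 1).eval ν' = j := h0'
    rw [hi', hj', RExp.eval, hi', hj', h6 i j ⟨hN1 ▸ hi, hM1 ▸ hj⟩]
    refine ⟨hi', hj', fun a' ha' r c hD => ?_, h2, fun r c hD => ?_, h4, h5, fun r c hrc => ?_⟩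
    · simp only []
      rw [setCell_of_ne _ _ (by tauto)]; exact h1 a' ha' r c (by tauto)
    · by_cases hrc : r = i ∧ c = j
      · obtain ⟨rfl, rfl⟩ := hrc
        simp
      · simp only []
        rw [setCell_of_ne _ _ (by omega)]; exact h3 r c (hD.resolve_right hrc)
    · simp only []
      rw [setCell_of_ne _ _ (by omega)]; exact h6 r c hrc
  · exact ⟨fun a ha r c _ => hA1.2 a ha r c, fun a ha r c => hA1.1 a ha r c,
      fun _ _ h => h.elim, hV1, hc1, hb1⟩
  · rintro ν' ⟨h1, h2, h3, h4, h5, h6⟩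
    refine ⟨⟨h2, fun a' ha' r c => ?_⟩, h4, h5⟩
    simp only [sem, hb]
    rw [hN1, hM1] at h1 h3
    split_ifs with hc
    · obtain ⟨rfl, hc⟩ := hc
      exact h3 r c hc
    · exact h1 a' ha' r c hc

/-- Programs for statements are correct. -/
theorem run : ∀ (P : St) (_ : P.Ok) (d : ℕ) (μ ν : Mem) (_ : Sim μ ν) (S : ℕ)
    (_ : μ.size ≤ S), Run (P.compile d) ν (P.time.eval S) fun ν' =>
      Sim (P.sem μ) ν' ∧ ∀ r < d, ν'.nat 103 r 0 = ν.nat 103 r 0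
  | fillNat a N M e, hok, d, μ, ν, h, S, hS =>
    run_fillNat a N M e (by simp [Ok, keepsNat] at hok; omega) d h hS
  | fillReal a N M e, _, d, μ, ν, h, S, hS => run_fillReal a N M e d h hS
  | seq P Q, hok, d, μ, ν, h, S, hS => by
    simp only [Ok, keepsNat, Bool.and_eq_true] at hok
    have hP : P.Ok := ⟨hok.1.1, hok.2.1⟩
    have hQ : Q.Ok := ⟨hok.1.2, hok.2.2⟩
    simp only [compile, time, Polynomial.eval_add, sem]
    refine (run P hP d μ ν h S hS).seq fun ν' h' =>
      (run Q hQ d _ ν' h'.1 S (sem_size hP μ ▸ hS)).mono le_rfl fun ν'' h'' =>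
        ⟨h''.1, fun r hr => (h''.2 r hr).trans (h'.2 r hr)⟩
  | ite b P Q, hok, d, μ, ν, h, S, hS => by
    simp only [Ok, keepsNat, Bool.and_eq_true] at hok
    have hP : P.Ok := ⟨hok.1.1, hok.2.1⟩
    have hQ : Q.Ok := ⟨hok.1.2, hok.2.2⟩
    simp only [compile, time, Polynomial.eval_add, Polynomial.eval_C, sem]
    refine (NX.run b 0 ν S (h.1.size ▸ hS)).seq fun ν' ⟨hF, hb⟩ => ?_
    have hvars : ν.vars = fun _ => 0 := funext h.2
    rw [hvars, NX.eval_congr h.1] at hb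
    have hSim : Sim μ ν' :=
      ⟨h.1.trans hF.agree, fun k => (hF.1 _ _ _ (by omega)).trans (h.2 k)⟩
    have hcell : ∀ r, ν'.nat 103 r 0 = ν.nat 103 r 0 := fun r => hF.1 _ _ _ (by omega)
    refine Run.cond (fun hb' => ?_) (fun hb' => ?_)
    all_goals
      simp only [BExp.holds, NExp.eval, ncell_eval, hb] at hb'
      simp only [hb', if_true, if_false]
    · exact (run P hP d μ ν' hSim S hS).mono (by omega) fun ν'' h'' =>
        ⟨h''.1, fun r hr => (h''.2 r hr).trans (hcell r)⟩
    · exact (run Q hQ d μ ν' hSim S hS).mono (by omega) fun ν'' h'' =>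
        ⟨h''.1, fun r hr => (h''.2 r hr).trans (hcell r)⟩
  | iter N P, hok, d, μ, ν, h, S, hS => by
    have hok : P.Ok := hok
    simp only [compile, time, Polynomial.eval_add, Polynomial.eval_mul, Polynomial.eval_X,
      Polynomial.eval_C, sem]
    have hsz : ∀ k, (P.sem^[k] μ).nat 0 = μ.nat 0 ∧ (P.sem^[k] μ).nat 1 = μ.nat 1 := by
      intro k
      induction k with
      | zero => exact ⟨rfl, rfl⟩
      | succ k ih =>
        rw [Function.iterate_succ_apply', sem_nat P hok.1, sem_nat P hok.2]
        exact ih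
    have hval : ∀ k, N.val (P.sem^[k] μ) = N.val μ := fun k => by
      cases N <;> simp [Bound.val, (hsz k).1, (hsz k).2]
    have hsize : ∀ k, (P.sem^[k] μ).size = μ.size := fun k => by simp [Mem.size, (hsz k).1, (hsz k).2]
    let I : ℕ → Mem → Prop := fun i ν' => Sim (P.sem^[i] μ) ν' ∧ ν'.nat 103 d 0 = i ∧
      ∀ r < d, ν'.nat 103 r 0 = ν.nat 103 r 0
    have hput : ∀ μ' ν' z, Sim μ' ν' →
        Sim μ' { ν' with nat := setCell ν'.nat 103 d 0 z } := by
      rintro μ' ν' z ⟨h1, h2⟩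
      refine ⟨⟨fun a ha r c => ?_, h1.2⟩, fun k => ?_⟩
      all_goals
        simp only []
        rw [setCell_of_ne _ _ (by omega)]
      exacts [h1.1 a ha r c, h2 k]
    refine Run.seq (Q := I 0) (Run.putNat ⟨hput _ _ _ h, by simp [NExp.eval], fun r hr => ?_⟩
      (by simp [NExp.cost])) fun ν₁ h₁ => ?_
    · simp only []
      rw [setCell_of_ne _ _ (by omega)]
    have hb : (BExp.natLt (ncell 103 d) N.toNExp).cost ≤ 9 := by
      have := N.cost_le
      simp only [BExp.cost, ncell_cost]; omega
    have hholds : ∀ i ν', I i ν' →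
        ((BExp.natLt (ncell 103 d) N.toNExp).holds ν' ↔ i < N.val μ) := by
      rintro i ν' ⟨h1, h2, -⟩
      rw [BExp.holds, ncell_eval, N.eval_toNExp, h2, h1.1.val, hval]
    refine (Run.loop (I := I) (N := N.val μ) (C := P.time.eval S + 8) (fun i hi ν' hI =>
      ⟨(hholds i ν' hI).2 hi, ?_⟩) (fun ν' hI => ?_) h₁).mono ?_ fun ν' hI => ⟨hI.1, hI.2.2⟩
    · refine (run P hok (d + 1) _ ν' hI.1 S (hsize i ▸ hS)).seq fun ν'' h'' =>
        Run.putNat ?_ (by simp [NExp.cost])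
      have hi'' : ν''.nat 103 d 0 = i := (h''.2 d (by omega)).trans hI.2.1
      refine ⟨?_, by simp [NExp.eval, hi''], fun r hr => ?_⟩
      · rw [Function.iterate_succ_apply']
        exact hput _ _ _ h''.1
      · simp only []
        rw [setCell_of_ne _ _ (by omega), h''.2 r (by omega)]
        exact hI.2.2 r hr
    · rw [hholds _ _ hI]; exact lt_irrefl _
    · have := (N.val_le μ).trans hS
      gcongr

end St

end BivaluedChores

end
noncomputable section

namespace BivaluedChores

/-! ### Conditions -/

namespace NX

variable {μ : Mem} {ρ : ℕ → ℕ}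

/-- The expression is positive, and so counts as a true condition. -/
def Holds (μ : Mem) (ρ : ℕ → ℕ) (e : NX) : Prop := 0 < e.eval μ ρ

/-- Negation. -/
def not (e : NX) : NX := .lt e (.const 1)
/-- Conjunction. -/
def and (e f : NX) : NX := .ite e f (.const 0)
/-- Equality. -/
def eq (e f : NX) : NX := (not (.lt e f)).and (not (.lt f e))
/-- Bounded existential quantification. -/
def ex (k : ℕ) (N : Bound) (b : NX) : NX := .sum k N b
/-- Bounded universal quantification. -/
def all (k : ℕ) (N : Bound) (b : NX) : NX := not (ex k N (not b))
/-- The truth value as `0` or `1`. -/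
def bool (e : NX) : NX := .lt (.const 0) e
/-- The first index below the bound that satisfies `b`. -/
def first (N : Bound) (b : NX → NX) : NX :=
  .sum 2 N (all 3 N (.ite (.lt (.var 2) (.var 3)) (.const 1) (not (b (.var 3)))))

@[simp] theorem eval_const (z : ℕ) : (NX.const z).eval μ ρ = z := rfl
@[simp] theorem eval_var (k : ℕ) : (NX.var k).eval μ ρ = ρ k := rfl
@[simp] theorem eval_read (a : ℕ) (r c : NX) :
    (NX.read a r c).eval μ ρ = μ.nat (a % 100) (r.eval μ ρ) (c.eval μ ρ) := rfl
@[simp] theorem eval_add (e f : NX) : (NX.add e f).eval μ ρ = e.eval μ ρ + f.eval μ ρ := rfl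
@[simp] theorem eval_sub (e f : NX) : (NX.sub e f).eval μ ρ = e.eval μ ρ - f.eval μ ρ := rfl

open Classical in
theorem eval_ite (b e f : NX) :
    (NX.ite b e f).eval μ ρ = if b.Holds μ ρ then e.eval μ ρ else f.eval μ ρ := by
  rw [NX.eval]
  by_cases h : b.Holds μ ρ
  · rw [if_pos h]; exact if_pos h
  · rw [if_neg h]; exact if_neg h

@[simp] theorem holds_const (z : ℕ) : (NX.const z).Holds μ ρ ↔ 0 < z := Iff.rfl

@[simp] theorem holds_read (a : ℕ) (r c : NX) :
    (NX.read a r c).Holds μ ρ ↔ 0 < μ.nat (a % 100) (r.eval μ ρ) (c.eval μ ρ) := Iff.rfl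

@[simp] theorem holds_lt (e f : NX) : (NX.lt e f).Holds μ ρ ↔ e.eval μ ρ < f.eval μ ρ := by
  simp only [Holds, NX.eval]; split_ifs with h <;> simp [h]

@[simp] theorem holds_rlt (e f : RX) : (NX.rlt e f).Holds μ ρ ↔ e.eval μ ρ < f.eval μ ρ := by
  simp only [Holds, NX.eval]; split_ifs with h <;> simp [h]

@[simp] theorem holds_not (e : NX) : e.not.Holds μ ρ ↔ ¬ e.Holds μ ρ := by
  rw [not, holds_lt, Holds, eval_const]; omega

open Classical in
@[simp] theorem holds_ite (b e f : NX) :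
    (NX.ite b e f).Holds μ ρ ↔ if b.Holds μ ρ then e.Holds μ ρ else f.Holds μ ρ := by
  rw [Holds, eval_ite]; split_ifs <;> rfl

@[simp] theorem holds_and (e f : NX) : (e.and f).Holds μ ρ ↔ e.Holds μ ρ ∧ f.Holds μ ρ := by
  rw [and, holds_ite]; split_ifs with h <;> simp [h]

@[simp] theorem holds_eq (e f : NX) : (e.eq f).Holds μ ρ ↔ e.eval μ ρ = f.eval μ ρ := by
  simp only [eq, holds_and, holds_not, holds_lt]; omega

theorem holds_ex {N : Bound} {n : ℕ} (hN : N.val μ = n) (ρ : ℕ → ℕ) (k : ℕ) (b : NX) :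
    (ex k N b).Holds μ ρ ↔ ∃ i : Fin n, b.Holds μ (Function.update ρ k i) := by
  simp only [Holds, ex, NX.eval, Nat.pos_iff_ne_zero, ne_eq, Finset.sum_eq_zero_iff, hN,
    Finset.mem_range, not_forall, exists_prop, Fin.exists_iff]

theorem holds_all {N : Bound} {n : ℕ} (hN : N.val μ = n) (ρ : ℕ → ℕ) (k : ℕ) (b : NX) :
    (all k N b).Holds μ ρ ↔ ∀ i : Fin n, b.Holds μ (Function.update ρ k i) := by
  simp [all, holds_ex hN]

theorem eval_not (e : NX) [Decidable (e.Holds μ ρ)] :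
    e.not.eval μ ρ = if e.Holds μ ρ then 0 else 1 := by
  rw [not, NX.eval]
  by_cases h : e.Holds μ ρ
  · rw [if_pos h]; exact if_neg (Nat.not_lt.2 h)
  · rw [if_neg h]; exact if_pos (Nat.lt_succ_iff.2 (Nat.not_lt.1 h))

theorem eval_bool (e : NX) [Decidable (e.Holds μ ρ)] :
    e.bool.eval μ ρ = if e.Holds μ ρ then 1 else 0 := by
  simp only [bool, NX.eval]
  exact if_congr Iff.rfl rfl rfl

/-- The specification of `first`. -/
theorem exists_first {N : Bound} {b : NX → NX} {n : ℕ} (hN : N.val μ = n) {P : Fin n → Prop}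
    (hb : ∀ (i : ℕ) (j : Fin n), (b (.var 3)).Holds μ (Function.update (Function.update ρ 2 i) 3 j)
      ↔ P j) (hex : ∃ j, P j) :
    ∃ j : Fin n, (first N b).eval μ ρ = j ∧ P j ∧ ∀ i < j, ¬ P i := by
  classical
  obtain ⟨j, hj, hmin⟩ : ∃ j, P j ∧ ∀ i < j, ¬ P i := by
    obtain ⟨j, hj⟩ := WellFounded.has_min (wellFounded_lt (α := Fin n)) {j | P j} hex
    exact ⟨j, hj.1, fun i hi hP => hj.2 i hP hi⟩
  refine ⟨j, ?_, hj, hmin⟩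
  have key : ∀ i ∈ Finset.range n,
      (all 3 N (.ite (.lt (.var 2) (.var 3)) (.const 1) (not (b (.var 3))))).eval μ
        (Function.update ρ 2 i) = if i < j then 1 else 0 := by
    intro i _
    rw [all, eval_not]
    have : (ex 3 N (not (.ite (.lt (.var 2) (.var 3)) (.const 1) (not (b (.var 3)))))).Holds μ
        (Function.update ρ 2 i) ↔ ¬ i < j := by
      simp only [holds_ex hN, holds_not, holds_ite, holds_lt, eval_var, hb, holds_const]
      simp only [ne_eq, Nat.reduceEqDiff, not_false_eq_true, Function.update_of_ne,
        Function.update_self, zero_lt_one]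
      constructor
      · rintro ⟨a, ha⟩ hij
        by_cases h : i < (a : ℕ)
        · simp [h] at ha
        · simp only [h, if_false, not_not] at ha
          exact hmin a (by rw [Fin.lt_def]; omega) ha
      · intro hij
        exact ⟨j, by simp [hij, hj]⟩
    simp only [this, ite_not]
  rw [first, NX.eval, hN, Finset.sum_congr rfl key, ← Finset.sum_filter, Finset.sum_const,
    smul_eq_mul, mul_one]
  have : (Finset.range n).filter (· < (j : ℕ)) = Finset.range j := by
    ext i; simp; omega
  rw [this, Finset.card_range]

end NX

namespace RX

variable {μ : Mem} {ρ : ℕ → ℕ}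

@[simp] theorem eval_const (z : ℤ) : (RX.const z).eval μ ρ = z := rfl
@[simp] theorem eval_read (a : ℕ) (r c : NX) :
    (RX.read a r c).eval μ ρ = μ.real (a % 100) (r.eval μ ρ) (c.eval μ ρ) := rfl
@[simp] theorem eval_sub (e f : RX) : (RX.sub e f).eval μ ρ = e.eval μ ρ - f.eval μ ρ := rfl
@[simp] theorem eval_mul (e f : RX) : (RX.mul e f).eval μ ρ = e.eval μ ρ * f.eval μ ρ := rfl
@[simp] theorem eval_div (e f : RX) : (RX.div e f).eval μ ρ = e.eval μ ρ / f.eval μ ρ := rfl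

open Classical in
theorem eval_ite (b : NX) (e f : RX) :
    (RX.ite b e f).eval μ ρ = if b.Holds μ ρ then e.eval μ ρ else f.eval μ ρ := by
  rw [RX.eval]
  by_cases h : b.Holds μ ρ
  · rw [if_pos h]; exact if_pos h
  · rw [if_neg h]; exact if_neg h

end RX

end BivaluedChores

end
noncomputable section

namespace BivaluedChores

/-! ### Tables -/

@[simp] theorem cellVars_zero (r c : ℕ) : cellVars r c 0 = r := rfl
@[simp] theorem cellVars_one (r c : ℕ) : cellVars r c 1 = c := rfl

namespace Represents

variable {n m : ℕ} {w : Profile n m} {s : Config n m} {μ ν : Mem} (h : Represents w s μ)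
include h

theorem agents : Bound.agents.val μ = n := h.1
theorem items : Bound.items.val μ = m := h.2.1
theorem agentsSucc : Bound.agentsSucc.val μ = n + 1 := congrArg (· + 1) h.1
theorem owner (c : Fin m) : μ.nat 2 0 c = s.alloc c := h.2.2.1 c
theorem phase : μ.nat 3 0 0 = s.phase.code := h.2.2.2.1
theorem k : μ.nat 4 0 0 = s.k := h.2.2.2.2.1
theorem l : μ.nat 5 0 0 = s.l := h.2.2.2.2.2.1
theorem H (t : ℕ) (i : Fin n) : μ.nat 6 t i = if i ∈ s.H t then 1 else 0 :=
  h.2.2.2.2.2.2.1 t i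
theorem H_pos (t : ℕ) (i : Fin n) : 0 < μ.nat 6 t i ↔ i ∈ s.H t := by
  rw [h.H]; split_ifs with hi <;> simp [hi]
theorem entitled (i : Fin n) (c : Fin m) : μ.nat 7 i c = if c ∈ s.entitled i then 1 else 0 :=
  h.2.2.2.2.2.2.2.1 i c
theorem entitled_pos (i : Fin n) (c : Fin m) : 0 < μ.nat 7 i c ↔ c ∈ s.entitled i := by
  rw [h.entitled]; split_ifs with hi <;> simp [hi]
theorem util (i : Fin n) (c : Fin m) : μ.real 1 i c = w i c := h.2.2.2.2.2.2.2.2.1 i c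
theorem price (c : Fin m) : μ.real 2 0 c = s.price c := h.2.2.2.2.2.2.2.2.2 c

theorem congr (hnat : ∀ a < 8, ν.nat a = μ.nat a) (hreal : ∀ a < 3, ν.real a = μ.real a) :
    Represents w s ν := by
  unfold Represents
  rw [hnat 0 (by norm_num), hnat 1 (by norm_num), hnat 2 (by norm_num), hnat 3 (by norm_num),
    hnat 4 (by norm_num), hnat 5 (by norm_num), hnat 6 (by norm_num), hnat 7 (by norm_num),
    hreal 1 (by norm_num), hreal 2 (by norm_num)]
  exact h

theorem sem (P : St) (hnat : ∀ a < 8, P.keepsNat a = true) (hreal : ∀ a < 3, P.keepsReal a = true) :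
    Represents w s (P.sem μ) :=
  h.congr (fun a ha => P.sem_nat (hnat a ha) μ) fun a ha => P.sem_real (hreal a ha) μ

end Represents

/-- The data of the current bundles, prices and paths in memory. -/
structure Tables {n m : ℕ} (w : Profile n m) (s : Config n m) (μ : Mem) : Prop where
  spending : ∀ i : Fin n, μ.real 10 0 i = s.spending i
  upToOne : ∀ i : Fin n, μ.real 11 0 i = s.spendingUpToOne i
  mpb : ∀ (i : Fin n) (c : Fin m), 0 < μ.nat 10 i c ↔ IsMPBChore w s.price i c
  least : ∀ i : Fin n, 0 < μ.nat 11 0 i ↔ s.LeastSpender i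
  violator : ∀ i : Fin n, 0 < μ.nat 13 0 i ↔
    ∃ ls, s.LeastSpender ls ∧ s.spending ls < s.spendingUpToOne i
  reach : ∀ t ≤ n, ∀ i : Fin n, 0 < μ.nat 12 t i ↔
    ∃ ls, s.LeastSpender ls ∧ Config.AltPath w s ls t i

theorem Tables.congr {n m : ℕ} {w : Profile n m} {s : Config n m} {μ ν : Mem} (h : Tables w s μ)
    (hnat : ∀ a, 10 ≤ a → a < 14 → ν.nat a = μ.nat a)
    (hreal : ∀ a, 10 ≤ a → a < 12 → ν.real a = μ.real a) : Tables w s ν := by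
  obtain ⟨h1, h2, h3, h4, h5, h6⟩ := h
  constructor
  · rwa [hreal 10 (by norm_num) (by norm_num)]
  · rwa [hreal 11 (by norm_num) (by norm_num)]
  · rwa [hnat 10 (by norm_num) (by norm_num)]
  · rwa [hnat 11 (by norm_num) (by norm_num)]
  · rwa [hnat 13 (by norm_num) (by norm_num)]
  · rwa [hnat 12 (by norm_num) (by norm_num)]

theorem Tables.sem {n m : ℕ} {w : Profile n m} {s : Config n m} {μ : Mem} (h : Tables w s μ)
    (P : St) (hnat : ∀ a < 14, 10 ≤ a → P.keepsNat a = true)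
    (hreal : ∀ a < 12, 10 ≤ a → P.keepsReal a = true) : Tables w s (P.sem μ) :=
  h.congr (fun a h1 h2 => P.sem_nat (hnat a h2 h1) μ) fun a h1 h2 => P.sem_real (hreal a h2 h1) μ

namespace Machine

/-- The owner of a chore. -/
def owner (c : NX) : NX := .read 2 (.const 0) c
/-- The price of a chore. -/
def price (c : NX) : RX := .read 2 (.const 0) c
/-- The pain per buck ratio. -/
def ratio (i c : NX) : RX := .div (.sub (.const 0) (.read 1 i c)) (price c)
/-- The spending of an agent. -/
def spending (i : NX) : RX := .read 10 (.const 0) i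
/-- The spending up to one chore of an agent. -/
def upToOne (i : NX) : RX := .read 11 (.const 0) i
/-- `c` is an MPB chore of `i`. -/
def mpb (i c : NX) : NX := .read 10 i c
/-- `i` is a least spender. -/
def least (i : NX) : NX := .read 11 (.const 0) i
/-- There is a path of length `t` from `i` to a least spender. -/
def reach (t i : NX) : NX := .read 12 t i
/-- `i` spends more than a least spender, up to one chore. -/
def violator (i : NX) : NX := .read 13 (.const 0) i

def spendingTable : St := .fillReal 10 .one .agents
  (.sum 2 .items (.ite ((owner (.var 2)).eq (.var 1)) (price (.var 2)) (.const 0)))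

def upToOneTable : St := .fillReal 11 .one .agents
  (.ite (.ex 2 .items ((owner (.var 2)).eq (.var 1)))
    (.sub (spending (.var 1)) (price (.first .items fun c => ((owner c).eq (.var 1)).and
      (.all 4 .items (.not (((owner (.var 4)).eq (.var 1)).and
        (.rlt (price c) (price (.var 4)))))))))
    (.const 0))

def mpbTable : St := .fillNat 10 .agents .items
  (.bool (.all 2 .items (.not (.rlt (ratio (.var 0) (.var 2)) (ratio (.var 0) (.var 1))))))

def leastTable : St := .fillNat 11 .one .agents
  (.bool (.all 2 .agents (.not (.rlt (spending (.var 2)) (spending (.var 1))))))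

def violatorTable : St := .fillNat 13 .one .agents
  (.bool (.ex 2 .agents ((least (.var 2)).and (.rlt (spending (.var 2)) (upToOne (.var 1))))))

def reachTable : St := .iter .agentsSucc (.fillNat 12 .agentsSucc .agents
  (.bool (.ite ((NX.var 0).eq (.const 0)) (least (.var 1))
    (.ex 2 .agents ((reach (.sub (.var 0) (.const 1)) (.var 2)).and
      (.ex 3 .items (((owner (.var 3)).eq (.var 1)).and (mpb (.var 2) (.var 3)))))))))

/-- The program that fills all tables. -/
def tables : St := .seq spendingTable (.seq upToOneTable (.seq mpbTable (.seq leastTable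
  (.seq violatorTable reachTable))))

section

variable {n m : ℕ} {p : ℝ} {w : Profile n m} {s : Config n m} {μ : Mem}

theorem sem_seq (P Q : St) : (St.seq P Q).sem μ = Q.sem (P.sem μ) := rfl

theorem sem_ite_of_holds {b : NX} {P Q : St} (h : b.Holds μ fun _ => 0) :
    (St.ite b P Q).sem μ = P.sem μ := if_pos h

theorem sem_ite_of_not {b : NX} {P Q : St} (h : ¬ b.Holds μ fun _ => 0) :
    (St.ite b P Q).sem μ = Q.sem μ := if_neg h

theorem sem_fillNat {a : ℕ} {N M : Bound} {e : NX} {r c : ℕ} (hr : r < N.val μ)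
    (hc : c < M.val μ) (ha : a < 100) :
    ((St.fillNat a N M e).sem μ).nat a r c = e.eval μ (cellVars r c) :=
  if_pos ⟨(Nat.mod_eq_of_lt ha).symm, hr, hc⟩

theorem sem_fillReal {a : ℕ} {N M : Bound} {e : RX} {r c : ℕ} (hr : r < N.val μ)
    (hc : c < M.val μ) (ha : a < 100) :
    ((St.fillReal a N M e).sem μ).real a r c = e.eval μ (cellVars r c) :=
  if_pos ⟨(Nat.mod_eq_of_lt ha).symm, hr, hc⟩

theorem sem_fillNat_bool {a : ℕ} {N M : Bound} {e : NX} {r c : ℕ} (hr : r < N.val μ)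
    (hc : c < M.val μ) (ha : a < 100) :
    0 < ((St.fillNat a N M e.bool).sem μ).nat a r c ↔ e.Holds μ (cellVars r c) := by
  classical
  rw [sem_fillNat hr hc ha, NX.eval_bool]
  split_ifs with h <;> simp [h]

theorem setPrice_bundle (f : Fin m → ℝ) (x : Allocation n m) (i : Fin n) :
    setPrice f (bundle x i) = ∑ c, if x c = i then f c else 0 := by
  rw [setPrice, bundle, Finset.sum_filter]

theorem sem_spendingTable (h : Represents w s μ) (i : Fin n) :
    (spendingTable.sem μ).real 10 0 i = s.spending i := by
  rw [spendingTable, sem_fillReal (by simp [Bound.val]) (h.agents ▸ i.2) (by norm_num), RX.eval,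
    h.items, Finset.sum_range, Config.spending, setPrice_bundle]
  refine Finset.sum_congr rfl fun c _ => ?_
  simp [RX.eval_ite, owner, price, h.owner, h.price, Fin.val_inj]

theorem sem_upToOneTable (h : Represents w s μ)
    (hS : ∀ i : Fin n, μ.real 10 0 i = s.spending i) (i : Fin n) :
    (upToOneTable.sem μ).real 11 0 i = s.spendingUpToOne i := by
  rw [upToOneTable, sem_fillReal (by simp [Bound.val]) (h.agents ▸ i.2) (by norm_num),
    RX.eval_ite]
  have hne : (NX.ex 2 .items ((owner (.var 2)).eq (.var 1))).Holds μ (cellVars 0 i) ↔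
      (bundle s.alloc i).Nonempty := by
    simp [NX.holds_ex h.items, owner, h.owner, Fin.val_inj, Finset.Nonempty]
  rw [Config.spendingUpToOne, priceUpToOne]
  by_cases hb : (bundle s.alloc i).Nonempty
  · rw [if_pos (hne.2 hb), dif_pos hb]
    obtain ⟨c, hc, ⟨hc1, hc2⟩, -⟩ := NX.exists_first (μ := μ) (ρ := cellVars 0 i) h.items
      (b := fun c => ((owner c).eq (.var 1)).and (.all 4 .items (.not
        (((owner (.var 4)).eq (.var 1)).and (.rlt (price c) (price (.var 4)))))))
      (P := fun c => s.alloc c = i ∧ ∀ c', s.alloc c' = i → s.price c' ≤ s.price c)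
      (fun a c => by simp [NX.holds_all h.items, owner, price, h.owner, h.price, Fin.val_inj])
      (by
        obtain ⟨c, hc, hmax⟩ := (bundle s.alloc i).exists_max_image s.price hb
        exact ⟨c, mem_bundle.1 hc, fun c' hc' => hmax c' (mem_bundle.2 hc')⟩)
    have : (bundle s.alloc i).sup' hb s.price = s.price c :=
      le_antisymm (Finset.sup'_le _ _ fun c' hc' => hc2 c' (mem_bundle.1 hc'))
        (Finset.le_sup' _ (mem_bundle.2 hc1))
    rw [RX.eval_sub, price, RX.eval_read, hc, this]
    simp [spending, hS, h.price, Config.spending]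
  · rw [if_neg (mt hne.1 hb), dif_neg hb]; simp

theorem isMPBChore_iff_forall {f : Fin m → ℝ} {i : Fin n} {c : Fin m} :
    IsMPBChore w f i c ↔ ∀ c', painPerBuck w f i c ≤ painPerBuck w f i c' := by
  have : Nonempty (Fin m) := ⟨c⟩
  refine ⟨fun h c' => h.le.trans (ciInf_le (Set.finite_range _).bddBelow c'), fun h => ?_⟩
  exact le_antisymm (le_ciInf h) (ciInf_le (Set.finite_range _).bddBelow c)

theorem sem_mpbTable (hw : IsScaled p w) (h : Represents w s μ) (i : Fin n) (c : Fin m) :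
    0 < (mpbTable.sem μ).nat 10 i c ↔ IsMPBChore w s.price i c := by
  rw [mpbTable, sem_fillNat_bool (h.agents ▸ i.2) (h.items ▸ c.2) (by norm_num),
    isMPBChore_iff_forall]
  simp [NX.holds_all h.items, ratio, price, h.price, h.util, painPerBuck,
    hw.abs_eq_neg]

theorem sem_leastTable (h : Represents w s μ)
    (hS : ∀ i : Fin n, μ.real 10 0 i = s.spending i) (i : Fin n) :
    0 < (leastTable.sem μ).nat 11 0 i ↔ s.LeastSpender i := by
  rw [leastTable, sem_fillNat_bool (by simp [Bound.val]) (h.agents ▸ i.2) (by norm_num)]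
  simp [NX.holds_all h.agents, spending, hS, Config.LeastSpender]

theorem sem_violatorTable (h : Represents w s μ)
    (hS : ∀ i : Fin n, μ.real 10 0 i = s.spending i)
    (hU : ∀ i : Fin n, μ.real 11 0 i = s.spendingUpToOne i)
    (hL : ∀ i : Fin n, 0 < μ.nat 11 0 i ↔ s.LeastSpender i) (i : Fin n) :
    0 < (violatorTable.sem μ).nat 13 0 i ↔
      ∃ ls, s.LeastSpender ls ∧ s.spending ls < s.spendingUpToOne i := by
  rw [violatorTable, sem_fillNat_bool (by simp [Bound.val]) (h.agents ▸ i.2) (by norm_num)]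
  simp [NX.holds_ex h.agents, spending, upToOne, least, hS, hU, hL]

theorem altPath_succ_iff {ls i : Fin n} {d : ℕ} : Config.AltPath w s ls (d + 1) i ↔
    ∃ j, Config.AltPath w s ls d j ∧ ∃ c, s.alloc c = i ∧ IsMPBChore w s.price j c := by
  constructor
  · rintro (_ | ⟨hj, hc⟩)
    exact ⟨_, hj, _, hc⟩
  · rintro ⟨j, hj, c, hc⟩
    exact hj.snoc hc

theorem sem_reachTable (h : Represents w s μ)
    (hM : ∀ (i : Fin n) (c : Fin m), 0 < μ.nat 10 i c ↔ IsMPBChore w s.price i c)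
    (hL : ∀ i : Fin n, 0 < μ.nat 11 0 i ↔ s.LeastSpender i) (t : ℕ) (ht : t ≤ n) (i : Fin n) :
    0 < (reachTable.sem μ).nat 12 t i ↔
      ∃ ls, s.LeastSpender ls ∧ Config.AltPath w s ls t i := by
  rw [reachTable, St.sem, h.agentsSucc]
  generalize hP : St.fillNat 12 _ _ _ = P
  suffices H : ∀ a, Represents w s (P.sem^[a] μ) ∧ (P.sem^[a] μ).nat 10 = μ.nat 10 ∧
      (P.sem^[a] μ).nat 11 = μ.nat 11 ∧ ∀ t < a, t ≤ n → ∀ i : Fin n,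
        (0 < (P.sem^[a] μ).nat 12 t i ↔ ∃ ls, s.LeastSpender ls ∧ Config.AltPath w s ls t i) from
    (H (n + 1)).2.2.2 t (by omega) ht i
  clear t ht i
  intro a
  induction a with
  | zero => exact ⟨h, rfl, rfl, fun t ht => by omega⟩
  | succ a ih =>
    obtain ⟨h1, h2, h3, h4⟩ := ih
    rw [Function.iterate_succ_apply']
    generalize P.sem^[a] μ = ν at *
    refine ⟨h1.sem P (hP ▸ by decide) (hP ▸ by decide), (P.sem_nat (hP ▸ by decide) ν).trans h2,
      (P.sem_nat (hP ▸ by decide) ν).trans h3, fun t ht htn i => ?_⟩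
    rw [← hP, sem_fillNat_bool (by rw [h1.agentsSucc]; omega) (h1.agents ▸ i.2) (by norm_num)]
    rcases t with _ | t
    · simp only [NX.holds_ite, NX.holds_eq, NX.eval_var, NX.eval_const, cellVars_zero, if_true,
        least, NX.holds_read, cellVars_one, h3, Nat.reduceMod, hL]
      constructor
      · intro hi; exact ⟨i, hi, .refl⟩
      · rintro ⟨ls, hls, hi⟩; cases hi; exact hls
    · have h5 := h4 t (by omega) (by omega)
      simp [NX.holds_ex h1.agents, NX.holds_ex h1.items, reach, mpb, owner, h2, hM, h1.owner, h5,
        Fin.val_inj, altPath_succ_iff]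
      grind

theorem tables_sem (hw : IsScaled p w) (h : Represents w s μ) :
    Represents w s (tables.sem μ) ∧ Tables w s (tables.sem μ) := by
  refine ⟨h.sem _ (by decide) (by decide), ?_⟩
  simp only [tables, sem_seq]
  have h1 := sem_spendingTable h
  replace h := h.sem spendingTable (by decide) (by decide)
  generalize spendingTable.sem μ = μ at *
  have h2 := sem_upToOneTable h h1
  rw [← upToOneTable.sem_real (a := 10) rfl μ] at h1
  replace h := h.sem upToOneTable (by decide) (by decide)
  generalize upToOneTable.sem μ = μ at *
  have h3 := sem_mpbTable hw h
  rw [← mpbTable.sem_real (a := 10) rfl μ] at h1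
  rw [← mpbTable.sem_real (a := 11) rfl μ] at h2
  replace h := h.sem mpbTable (by decide) (by decide)
  generalize mpbTable.sem μ = μ at *
  have h4 := sem_leastTable h h1
  rw [← leastTable.sem_real (a := 10) rfl μ] at h1
  rw [← leastTable.sem_real (a := 11) rfl μ] at h2
  rw [← leastTable.sem_nat (a := 10) rfl μ] at h3
  replace h := h.sem leastTable (by decide) (by decide)
  generalize leastTable.sem μ = μ at *
  have h5 := sem_violatorTable h h1 h2 h4
  rw [← violatorTable.sem_real (a := 10) rfl μ] at h1
  rw [← violatorTable.sem_real (a := 11) rfl μ] at h2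
  rw [← violatorTable.sem_nat (a := 10) rfl μ] at h3
  rw [← violatorTable.sem_nat (a := 11) rfl μ] at h4
  replace h := h.sem violatorTable (by decide) (by decide)
  generalize violatorTable.sem μ = μ at *
  have h6 := sem_reachTable h h3 h4
  rw [← reachTable.sem_real (a := 10) rfl μ] at h1
  rw [← reachTable.sem_real (a := 11) rfl μ] at h2
  rw [← reachTable.sem_nat (a := 10) rfl μ] at h3
  rw [← reachTable.sem_nat (a := 11) rfl μ] at h4
  rw [← reachTable.sem_nat (a := 13) rfl μ] at h5
  exact ⟨h1, h2, h3, h4, h5, h6⟩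

end

end Machine

end BivaluedChores

end
noncomputable section

namespace BivaluedChores

namespace Machine

/-! ### One step of the algorithm -/

/-- The first cell of an integer array. -/
def cell (a : ℕ) : NX := .read a (.const 0) (.const 0)
/-- Write to the first cell of an integer array. -/
def put (a : ℕ) (e : NX) : St := .fillNat a .one .one e
/-- Agent `i` is in the set `H t`. -/
def inH (t i : NX) : NX := .read 6 t i
/-- Agent `j` is in one of the sets that come later in Phase 2a. -/
def later (j : NX) : NX := .read 14 (.const 0) j
/-- Agent `i` is in the new set `H k`. -/
def inHk (i : NX) : NX := .read 15 (.const 0) i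
/-- There is a path of length `t` from a violator to a least spender. -/
def badLength (t : NX) : NX := .ex 4 .agents ((reach t (.var 4)).and (violator (.var 4)))

/-- Give the chore in cell `33` to the agent in cell `31`. -/
def transfer : St :=
  .fillNat 2 .one .items (.ite ((NX.var 1).eq (cell 33)) (cell 31) (owner (.var 1)))

def chooseDonor : St := put 30 (.first .agents fun i => (inH (cell 5) i).and
  (.all 4 .agents (.not ((inH (cell 5) (.var 4)).and (.rlt (upToOne i) (upToOne (.var 4)))))))

def laterTable : St := .fillNat 14 .one .agents (.bool (.ex 2 .agentsSucc
  ((NX.lt (cell 5) (.var 2)).and ((NX.lt (.var 2) (cell 4)).and (inH (.var 2) (.var 1))))))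

def chooseRecipient : St := put 31 (.first .agents fun j => (later j).and
  (.all 4 .agents (.not ((later (.var 4)).and (.rlt (spending (.var 4)) (spending j))))))

def chooseFree : St := put 33 (.first .items fun c =>
  ((owner c).eq (cell 30)).and (.not (.read 7 (cell 30) c)))

def phase2a : St := .ite ((cell 5).eq (.const 0)) (put 3 (.const Phase.phase2b.code))
  (.seq chooseDonor (.seq laterTable (.seq chooseRecipient
    (.ite (.rlt (spending (cell 31)) (upToOne (cell 30))) (.seq chooseFree transfer)
      (put 5 (.sub (cell 5) (.const 1)))))))

def chooseLength : St := put 32 (.first .agentsSucc badLength)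

def chooseViolator : St := put 30 (.first .agents fun i => (reach (cell 32) i).and (violator i))

def choosePredecessor : St := put 31 (.first .agents fun j =>
  (reach (.sub (cell 32) (.const 1)) j).and
    (.ex 4 .items (((owner (.var 4)).eq (cell 30)).and (mpb j (.var 4)))))

def chooseChore : St := put 33 (.first .items fun c =>
  ((owner c).eq (cell 30)).and (mpb (cell 31) c))

def phase2b : St := .ite (.ex 5 .agentsSucc (badLength (.var 5)))
  (.seq chooseLength (.seq chooseViolator (.seq choosePredecessor (.seq chooseChore transfer))))
  (.ite (.all 2 .agents (.all 3 .agents (.not (.rlt (spending (.var 3)) (upToOne (.var 2))))))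
    (put 3 (.const Phase.done.code)) (put 3 (.const Phase.phase3.code)))

def setTable : St := .fillNat 15 .one .agents (.bool (.ex 2 .agentsSucc (reach (.var 2) (.var 1))))

def reducePrices : St := .fillReal 2 .one .items (.ite (inHk (owner (.var 1)))
  (.mul (.div (.const 1) (.read 3 (.const 0) (.const 0))) (price (.var 1))) (price (.var 1)))

def entitle : St := .fillNat 7 .agents .items
  (.bool (.ite (inHk (.var 0)) ((owner (.var 1)).eq (.var 0)) (.read 7 (.var 0) (.var 1))))

def addSet : St := .fillNat 6 .agentsSucc .agents
  (.bool (.ite ((NX.var 0).eq (cell 4)) (inHk (.var 1)) (inH (.var 0) (.var 1))))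

def phase3 : St := .seq setTable (.seq reducePrices (.seq entitle (.seq addSet
  (.seq (put 5 (.sub (.add (cell 4) (.const 1)) (.const 2)))
    (.seq (put 4 (.add (cell 4) (.const 1))) (put 3 (.const Phase.phase2a.code)))))))

/-- The program that carries out one step of the algorithm. -/
def body : St := .seq tables (.ite ((cell 3).eq (.const Phase.phase2a.code)) phase2a
  (.ite ((cell 3).eq (.const Phase.phase2b.code)) phase2b phase3))

variable {n m : ℕ} {p : ℝ} {w : Profile n m} {s : Config n m} {μ : Mem}

@[simp] theorem cell_eval (a : ℕ) (ρ : ℕ → ℕ) : (cell a).eval μ ρ = μ.nat (a % 100) 0 0 := rfl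

theorem sem_put {a : ℕ} (ha : a < 100) (e : NX) :
    ((put a e).sem μ).nat a 0 0 = e.eval μ (cellVars 0 0) :=
  sem_fillNat (by simp [Bound.val]) (by simp [Bound.val]) ha

/-- The specification of the choice of an index. -/
theorem sem_put_first {a : ℕ} (ha : a < 100) {N : Bound} {b : NX → NX} (hN : N.val μ = n)
    {P : Fin n → Prop} (hb : ∀ (ρ : ℕ → ℕ) (j : Fin n), ρ 3 = j → ((b (.var 3)).Holds μ ρ ↔ P j))
    (hex : ∃ j, P j) :
    ∃ j : Fin n, ((put a (.first N b)).sem μ).nat a 0 0 = j ∧ P j ∧ ∀ i < j, ¬ P i := by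
  rw [sem_put ha]
  exact NX.exists_first hN (fun i j => hb _ j (by simp)) hex

theorem sem_transfer (h : Represents w s μ) {c : Fin m} {j : Fin n} (hc : μ.nat 33 0 0 = c)
    (hj : μ.nat 31 0 0 = j) : Represents w (s.give c j) (transfer.sem μ) := by
  refine ⟨?_, ?_, fun c' => ?_, ?_⟩
  · rw [transfer.sem_nat (by decide)]; exact h.1
  · rw [transfer.sem_nat (by decide)]; exact h.2.1
  · rw [transfer, sem_fillNat (by simp [Bound.val]) (h.items ▸ c'.2) (by norm_num), NX.eval_ite]
    by_cases hcc : c' = c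
    · subst hcc; simp [hc, hj, Config.give]
    · have : (c' : ℕ) ≠ c := fun e => hcc (Fin.ext e)
      simp [hc, this, owner, h.owner, Config.give, Function.update_of_ne hcc]
  · rw [transfer.sem_nat (a := 3) rfl, transfer.sem_nat (a := 4) rfl, transfer.sem_nat (a := 5) rfl,
      transfer.sem_nat (a := 6) rfl, transfer.sem_nat (a := 7) rfl, transfer.sem_real (a := 1) rfl,
      transfer.sem_real (a := 2) rfl]
    exact h.2.2.2

theorem sem_setPhase (h : Represents w s μ) (ph : Phase) :
    Represents w { s with phase := ph } ((put 3 (.const ph.code)).sem μ) :=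
  ⟨h.1, h.2.1, h.2.2.1, sem_put (by norm_num) _, h.2.2.2.2⟩

theorem sem_setCounter (h : Represents w s μ) {e : NX} {z : ℕ}
    (he : e.eval μ (cellVars 0 0) = z) :
    Represents w { s with l := z } ((put 5 e).sem μ) :=
  ⟨h.1, h.2.1, h.2.2.1, h.2.2.2.1, h.2.2.2.2.1, (sem_put (by norm_num) _).trans he,
    h.2.2.2.2.2.2⟩

theorem sem_setIteration (h : Represents w s μ) {e : NX} {z : ℕ}
    (he : e.eval μ (cellVars 0 0) = z) :
    Represents w { s with k := z } ((put 4 e).sem μ) :=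
  ⟨h.1, h.2.1, h.2.2.1, h.2.2.2.1, (sem_put (by norm_num) _).trans he, h.2.2.2.2.2⟩

open Config in
theorem phase2a_sem (hw : IsScaled p w) (h : Represents w s μ) (hT : Tables w s μ)
    (hI : s.Inv p w) (hph : s.phase = Phase.phase2a) :
    ∃ s', Step w s s' ∧ Represents w s' (phase2a.sem μ) := by
  obtain ⟨hc, hq⟩ := hI
  rw [PhaseInv, hph] at hq
  obtain ⟨hlk, hbal⟩ := hq
  by_cases hl : s.l = 0
  · refine ⟨_, Step.end2a s hph hl, ?_⟩
    rw [phase2a, sem_ite_of_holds (by simp [h.l, hl])]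
    exact sem_setPhase h _
  rw [phase2a, sem_ite_of_not (by simp [h.l, hl])]
  have hlk : s.l + 2 ≤ s.k := hlk.resolve_right hl
  obtain ⟨i₀, j₀, hsel⟩ := hc.exists_selects (by omega) hlk
  simp only [sem_seq]
  obtain ⟨i, hi, ⟨hi1, hi2⟩, -⟩ := sem_put_first (μ := μ) (a := 30) (by norm_num) h.agents
    (b := fun i => (inH (cell 5) i).and
      (.all 4 .agents (.not ((inH (cell 5) (.var 4)).and (.rlt (upToOne i) (upToOne (.var 4)))))))
    (P := fun i => i ∈ s.H s.l ∧ ∀ i' ∈ s.H s.l, s.spendingUpToOne i' ≤ s.spendingUpToOne i)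
    (fun ρ i hρ => by
      simp [NX.holds_all h.agents, inH, h.l, hρ, h.H_pos, upToOne, hT.upToOne])
    ⟨i₀, hsel.1⟩
  change (chooseDonor.sem μ).nat 30 0 0 = i at hi
  replace h := h.sem chooseDonor (by decide) (by decide)
  replace hT := hT.sem chooseDonor (by decide) (by decide)
  generalize chooseDonor.sem μ = μ at *
  have hlater : ∀ j : Fin n, 0 < (laterTable.sem μ).nat 14 0 j ↔
      j ∈ (Finset.Ioo s.l s.k).biUnion s.H := by
    intro j
    rw [laterTable, sem_fillNat_bool (by simp [Bound.val]) (h.agents ▸ j.2) (by norm_num)]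
    have := hc.k_le
    simp [NX.holds_ex h.agentsSucc, h.l, h.k, inH, h.H_pos, Fin.exists_iff]
    grind
  rw [← laterTable.sem_nat (a := 30) rfl] at hi
  replace h := h.sem laterTable (by decide) (by decide)
  replace hT := hT.sem laterTable (by decide) (by decide)
  generalize laterTable.sem μ = μ at *
  obtain ⟨j, hj, ⟨hj1, hj2⟩, -⟩ := sem_put_first (μ := μ) (a := 31) (by norm_num) h.agents
    (b := fun j => (later j).and
      (.all 4 .agents (.not ((later (.var 4)).and (.rlt (spending (.var 4)) (spending j))))))
    (P := fun j => j ∈ (Finset.Ioo s.l s.k).biUnion s.H ∧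
      ∀ j' ∈ (Finset.Ioo s.l s.k).biUnion s.H, s.spending j ≤ s.spending j')
    (fun ρ j hρ => by
      simp only [NX.holds_and, later, NX.holds_read, NX.eval_const, NX.eval_var, Nat.reduceMod,
        hρ, hlater, NX.holds_all h.agents, NX.holds_not, Function.update_self, NX.holds_rlt,
        spending, RX.eval_read, hT.spending, not_and, not_lt, ne_eq, Nat.reduceEqDiff,
        not_false_eq_true, Function.update_of_ne])
    ⟨j₀, hsel.2⟩
  change (chooseRecipient.sem μ).nat 31 0 0 = j at hj
  rw [← chooseRecipient.sem_nat (a := 30) rfl] at hi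
  replace h := h.sem chooseRecipient (by decide) (by decide)
  replace hT := hT.sem chooseRecipient (by decide) (by decide)
  clear hlater
  generalize chooseRecipient.sem μ = μ at *
  have hsel' : s.Selects i j := ⟨⟨hi1, hi2⟩, hj1, hj2⟩
  have hb : (NX.rlt (spending (cell 31)) (upToOne (cell 30))).Holds μ (fun _ => 0) ↔
      s.spendingUpToOne i > s.spending j := by
    simp [spending, upToOne, hi, hj, hT.spending, hT.upToOne]
  by_cases hv : s.spendingUpToOne i > s.spending j
  · rw [sem_ite_of_holds (hb.2 hv), sem_seq]
    obtain ⟨c₀, hc₀⟩ := hc.exists_free hw hbal (by omega) hlk hsel' hv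
    obtain ⟨c, hc, ⟨hc1, hc2⟩, -⟩ := sem_put_first (μ := μ) (a := 33) (by norm_num) h.items
      (b := fun c => ((owner c).eq (cell 30)).and (.not (.read 7 (cell 30) c)))
      (P := fun c => s.alloc c = i ∧ c ∉ s.entitled i)
      (fun ρ c hρ => by
        simp [owner, hρ, hi, h.owner, h.entitled_pos, Fin.val_inj, -Nat.not_lt, - not_lt])
      ⟨c₀, by simpa using hc₀⟩
    change (chooseFree.sem μ).nat 33 0 0 = c at hc
    refine ⟨_, Step.transfer2a s i j c hph (by omega) hsel' hv (by simp [hc1, hc2]), ?_⟩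
    exact sem_transfer (h.sem chooseFree (by decide) (by decide)) hc
      (by rw [chooseFree.sem_nat (a := 31) rfl, hj])
  · rw [sem_ite_of_not (mt hb.1 hv)]
    exact ⟨_, Step.next2a s i j hph (by omega) hsel' hv, sem_setCounter h (by simp [h.l])⟩

theorem exists_violatorPath_iff {t : ℕ} :
    (∃ i, (∃ ls, s.LeastSpender ls ∧ Config.AltPath w s ls t i) ∧
      ∃ ls, s.LeastSpender ls ∧ s.spending ls < s.spendingUpToOne i) ↔
      ∃ ls i, s.ViolatorPath w ls t i := by
  constructor
  · rintro ⟨i, ⟨ls, h1, h2⟩, ls', h3, h4⟩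
    exact ⟨ls, i, h1, h2, h3.eq h1 ▸ h4⟩
  · rintro ⟨ls, i, h1, h2, h3⟩
    exact ⟨i, ⟨ls, h1, h2⟩, ls, h1, h3⟩

theorem holds_badLength (h : Represents w s μ) (hT : Tables w s μ) {t : NX} {ρ : ℕ → ℕ} {d : ℕ}
    (ht : ∀ i, t.eval μ (Function.update ρ 4 i) = d) (hd : d ≤ n) :
    (badLength t).Holds μ ρ ↔ ∃ ls i, s.ViolatorPath w ls d i := by
  rw [← exists_violatorPath_iff, badLength, NX.holds_ex h.agents]
  simp [reach, violator, ht, hT.reach d hd, hT.violator]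

open Config in
theorem phase2b_sem (hw : IsScaled p w) (h : Represents w s μ) (hT : Tables w s μ)
    (hI : s.Inv p w) (hph : s.phase = Phase.phase2b) :
    ∃ s', Step w s s' ∧ Represents w s' (phase2b.sem μ) := by
  obtain ⟨hc, -⟩ := hI
  have hpath : (NX.ex 5 .agentsSucc (badLength (.var 5))).Holds μ (fun _ => 0) ↔
      ∃ t : Fin (n + 1), ∃ ls i, s.ViolatorPath w ls t i := by
    rw [NX.holds_ex h.agentsSucc]
    exact exists_congr fun t =>
      holds_badLength h hT (fun i => by simp) (Nat.lt_succ_iff.1 t.2)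
  by_cases hv : ∃ ls d i, s.ViolatorPath w ls d i
  · obtain ⟨ls₀, j₀, c₀, d, hM⟩ := hc.exists_move hw hv
    have hdn := hM.lt
    have hex : ∃ t : Fin (n + 1), ∃ ls i, s.ViolatorPath w ls t i :=
      ⟨⟨d + 1, by omega⟩, ls₀, _, hM.violator⟩
    rw [phase2b, sem_ite_of_holds (hpath.2 hex)]
    simp only [sem_seq]
    clear hpath
    obtain ⟨t, ht, ⟨ls₁, i₁, ht1⟩, ht2⟩ := sem_put_first (μ := μ) (a := 32) (by norm_num)
      h.agentsSucc (b := badLength) (P := fun t => ∃ ls i, s.ViolatorPath w ls t i)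
      (fun ρ t hρ => holds_badLength h hT (fun i => by simp [hρ]) (Nat.lt_succ_iff.1 t.2)) hex
    change (chooseLength.sem μ).nat 32 0 0 = t at ht
    have htd : (t : ℕ) = d + 1 := by
      refine le_antisymm ?_ (hM.min _ _ _ ht1)
      by_contra hlt
      exact ht2 ⟨d + 1, by omega⟩ (not_le.1 hlt) ⟨ls₀, _, hM.violator⟩
    rw [htd] at ht ht1
    replace h := h.sem chooseLength (by decide) (by decide)
    replace hT := hT.sem chooseLength (by decide) (by decide)
    generalize chooseLength.sem μ = μ at *
    obtain ⟨i, hi, ⟨hi1, ls₂, hi2, hi3⟩, -⟩ := sem_put_first (μ := μ) (a := 30) (by norm_num)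
      h.agents (b := fun i => (reach (cell 32) i).and (violator i))
      (P := fun i => (∃ ls, s.LeastSpender ls ∧ AltPath w s ls (d + 1) i) ∧
        ∃ ls, s.LeastSpender ls ∧ s.spending ls < s.spendingUpToOne i)
      (fun ρ i hρ => by
        simp [reach, violator, ht, hρ, hT.reach (d + 1) (by omega), hT.violator])
      (exists_violatorPath_iff.2 ⟨_, _, ht1⟩)
    change (chooseViolator.sem μ).nat 30 0 0 = i at hi
    rw [← chooseViolator.sem_nat (a := 32) rfl] at ht
    replace h := h.sem chooseViolator (by decide) (by decide)
    replace hT := hT.sem chooseViolator (by decide) (by decide)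
    generalize chooseViolator.sem μ = μ at *
    obtain ⟨j, hj, ⟨⟨ls, hls, hP⟩, hj2⟩, -⟩ := sem_put_first (μ := μ) (a := 31) (by norm_num)
      h.agents (b := fun j => (reach (.sub (cell 32) (.const 1)) j).and
        (.ex 4 .items (((owner (.var 4)).eq (cell 30)).and (mpb j (.var 4)))))
      (P := fun j => (∃ ls, s.LeastSpender ls ∧ AltPath w s ls d j) ∧
        ∃ c, s.alloc c = i ∧ IsMPBChore w s.price j c)
      (fun ρ j hρ => by
        simp [reach, mpb, ht, hi, hρ, hT.reach d (by omega), hT.mpb, NX.holds_ex h.items, owner,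
          h.owner, Fin.val_inj])
      (by
        obtain ⟨ls, hls, hP⟩ := hi1
        obtain ⟨j, hj, hc⟩ := altPath_succ_iff.1 hP
        exact ⟨j, ⟨ls, hls, hj⟩, hc⟩)
    change (choosePredecessor.sem μ).nat 31 0 0 = j at hj
    rw [← choosePredecessor.sem_nat (a := 30) rfl] at hi
    replace h := h.sem choosePredecessor (by decide) (by decide)
    replace hT := hT.sem choosePredecessor (by decide) (by decide)
    generalize choosePredecessor.sem μ = μ at *
    obtain ⟨c, hc, ⟨hc1, hc2⟩, -⟩ := sem_put_first (μ := μ) (a := 33) (by norm_num) h.items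
      (b := fun c => ((owner c).eq (cell 30)).and (mpb (cell 31) c))
      (P := fun c => s.alloc c = i ∧ IsMPBChore w s.price j c)
      (fun ρ c hρ => by simp [mpb, hi, hj, hρ, hT.mpb, owner, h.owner, Fin.val_inj]) hj2
    change (chooseChore.sem μ).nat 33 0 0 = c at hc
    refine ⟨_, Step.transfer2b s ls j i c d hph hP ⟨hc1, hc2⟩
      ⟨hls, hP.snoc ⟨hc1, hc2⟩, hi2.eq hls ▸ hi3⟩ hM.min, ?_⟩
    exact sem_transfer (h.sem chooseChore (by decide) (by decide)) hc
      (by rw [chooseChore.sem_nat (a := 31) rfl, hj])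
  · rw [phase2b, sem_ite_of_not fun hh => hv (by
      obtain ⟨t, ls, i, hP⟩ := hpath.1 hh
      exact ⟨ls, t, i, hP⟩)]
    have hef : (NX.all 2 .agents (.all 3 .agents (.not
        (.rlt (spending (.var 3)) (upToOne (.var 2)))))).Holds μ (fun _ => 0) ↔
        PriceEF1 s.alloc s.price := by
      rw [priceEF1_iff (hc.price_pos hw)]
      simp [NX.holds_all h.agents, spending, upToOne, hT.spending, hT.upToOne, Config.spending,
        Config.spendingUpToOne]
    by_cases hE : PriceEF1 s.alloc s.price
    · rw [sem_ite_of_holds (hef.2 hE)]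
      exact ⟨_, Step.return2b s hph hv hE, sem_setPhase h _⟩
    · rw [sem_ite_of_not (mt hef.1 hE)]
      exact ⟨_, Step.break2b s hph hv hE, sem_setPhase h _⟩

open Config in
theorem exists_short_path {i : Fin n} : (∃ t : Fin (n + 1), ∃ ls, s.LeastSpender ls ∧
    AltPath w s ls t i) ↔ ∃ ls d, s.LeastSpender ls ∧ AltPath w s ls d i := by
  classical
  constructor
  · rintro ⟨t, ls, h1, h2⟩
    exact ⟨ls, t, h1, h2⟩
  · rintro ⟨ls, d, h1, h2⟩
    have hex : ∃ d, AltPath w s ls d i := ⟨d, h2⟩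
    have hlt := (Nat.find_spec hex).lt_of_shortest fun d' hd' => Nat.find_min' hex hd'
    exact ⟨⟨Nat.find hex, by omega⟩, ls, h1, Nat.find_spec hex⟩

section

variable {Hk : Finset (Fin n)}

open Classical in
theorem sem_reducePrices (h : Represents w s μ) (hp : μ.real 3 0 0 = p)
    (hset : ∀ i : Fin n, 0 < μ.nat 15 0 i ↔ i ∈ Hk) :
    Represents w
      { s with price := fun c => if s.alloc c ∈ Hk then 1 / p * s.price c else s.price c }
      (reducePrices.sem μ) := by
  refine ⟨h.1, h.2.1, h.2.2.1, h.2.2.2.1, h.2.2.2.2.1, h.2.2.2.2.2.1, h.2.2.2.2.2.2.1,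
    h.2.2.2.2.2.2.2.1, ?_, fun c => ?_⟩
  · rw [reducePrices.sem_real (a := 1) rfl]; exact h.util
  · rw [reducePrices, sem_fillReal (by simp [Bound.val]) (h.items ▸ c.2) (by norm_num),
      RX.eval_ite]
    simp [inHk, owner, h.owner, hset, price, h.price, hp]

open Classical in
theorem sem_entitle (h : Represents w s μ) (hset : ∀ i : Fin n, 0 < μ.nat 15 0 i ↔ i ∈ Hk) :
    Represents w
      { s with entitled := fun i => if i ∈ Hk then bundle s.alloc i else s.entitled i }
      (entitle.sem μ) := by
  have hent : ∀ (i : Fin n) (c : Fin m), (entitle.sem μ).nat 7 i c =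
      if c ∈ (if i ∈ Hk then bundle s.alloc i else s.entitled i) then 1 else 0 := by
    intro i c
    rw [entitle, sem_fillNat (h.agents ▸ i.2) (h.items ▸ c.2) (by norm_num), NX.eval_bool]
    by_cases hi : i ∈ Hk
    · simp [inHk, hset, hi, owner, h.owner, Fin.val_inj]
    · simp [inHk, hset, hi, h.entitled_pos]
  exact ⟨h.1, h.2.1, h.2.2.1, h.2.2.2.1, h.2.2.2.2.1, h.2.2.2.2.2.1, h.2.2.2.2.2.2.1,
    fun i c => (hent i c).trans (if_congr Iff.rfl rfl rfl), h.2.2.2.2.2.2.2.2⟩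

open Classical in
theorem sem_addSet (h : Represents w s μ) (hset : ∀ i : Fin n, 0 < μ.nat 15 0 i ↔ i ∈ Hk)
    (hk : s.k ≤ n) :
    Represents w { s with H := Function.update s.H s.k Hk } (addSet.sem μ) := by
  have hH : ∀ (t : ℕ) (i : Fin n), (addSet.sem μ).nat 6 t i =
      if i ∈ Function.update s.H s.k Hk t then 1 else 0 := by
    intro t i
    by_cases ht : t ≤ n
    · rw [addSet, sem_fillNat (h.agentsSucc ▸ by omega) (h.agents ▸ i.2) (by norm_num),
        NX.eval_bool]
      by_cases htk : t = s.k
      · subst htk; simp [inHk, hset, h.k]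
      · simp [h.k, htk, inH, h.H_pos]
    · rw [Function.update_of_ne (by omega), ← h.H]
      exact if_neg fun hh => ht (by have := hh.2.1; rw [h.agentsSucc] at this; omega)
  exact ⟨h.1, h.2.1, h.2.2.1, h.2.2.2.1, h.2.2.2.2.1, h.2.2.2.2.2.1, hH, h.2.2.2.2.2.2.2⟩

end

open Config in
theorem phase3_sem (hw : IsScaled p w) (h : Represents w s μ) (hT : Tables w s μ)
    (hp : μ.real 3 0 0 = p) (hI : s.Inv p w) (hph : s.phase = Phase.phase3) :
    ∃ s', Step w s s' ∧ Represents w s' (phase3.sem μ) := by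
  classical
  let Hk := Finset.univ.filter fun i => ∃ ls d, s.LeastSpender ls ∧ AltPath w s ls d i
  have hHk : ∀ i, i ∈ Hk ↔ ∃ ls d, s.LeastSpender ls ∧ AltPath w s ls d i := by simp [Hk]
  obtain ⟨ls, r, hB⟩ := exists_break hw hI hph hHk
  have hstep := Step.reduce s Hk p hph hHk hB.isLeast
  refine ⟨_, hstep, ?_⟩
  have hk : s.k ≤ n := by
    have := (hI.step hw hstep).1.1.k_le
    simpa using this
  rw [phase3]
  simp only [sem_seq]
  have hset : ∀ i : Fin n, 0 < (setTable.sem μ).nat 15 0 i ↔ i ∈ Hk := by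
    intro i
    rw [setTable, sem_fillNat_bool (by simp [Bound.val]) (h.agents ▸ i.2) (by norm_num), hHk,
      ← exists_short_path, NX.holds_ex h.agentsSucc]
    refine exists_congr fun t => ?_
    simp [reach, hT.reach t (Nat.lt_succ_iff.1 t.2)]
  clear hT hHk hB hstep hI
  replace h := h.sem setTable (by decide) (by decide)
  rw [← setTable.sem_real (a := 3) rfl] at hp
  generalize setTable.sem μ = μ at *
  have h1 := sem_reducePrices h hp hset
  rw [← reducePrices.sem_nat (a := 15) rfl] at hset
  generalize reducePrices.sem μ = μ at *
  have h2 := sem_entitle h1 hset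
  rw [← entitle.sem_nat (a := 15) rfl] at hset
  generalize entitle.sem μ = μ at *
  have h3 := sem_addSet h2 hset hk
  generalize addSet.sem μ = μ at *
  have h4 := sem_setCounter h3 (e := .sub (.add (cell 4) (.const 1)) (.const 2))
    (z := s.k + 1 - 2) (by simp [h3.k])
  generalize (put 5 (.sub (.add (cell 4) (.const 1)) (.const 2))).sem μ = μ at *
  have h5 := sem_setIteration h4 (e := .add (cell 4) (.const 1)) (z := s.k + 1) (by simp [h4.k])
  exact sem_setPhase h5 Phase.phase2a

/-- The program carries out one step of the algorithm. -/
theorem body_sem (hw : IsScaled p w) (h : Represents w s μ) (hp : μ.real 3 0 0 = p)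
    (hI : s.Inv p w) (hph : s.phase ≠ Phase.done) :
    ∃ s', Step w s s' ∧ Represents w s' (body.sem μ) ∧ (body.sem μ).real 3 0 0 = p := by
  suffices H : ∃ s', Step w s s' ∧ Represents w s' (body.sem μ) by
    obtain ⟨s', h1, h2⟩ := H
    exact ⟨s', h1, h2, by rwa [body.sem_real (a := 3) rfl]⟩
  rw [body, sem_seq]
  obtain ⟨h', hT⟩ := tables_sem hw h
  rw [← tables.sem_real (a := 3) rfl] at hp
  generalize tables.sem μ = μ at *
  cases hph' : s.phase with
  | phase2a =>
    rw [sem_ite_of_holds (by simp [h'.phase, hph'])]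
    exact phase2a_sem hw h' hT hI hph'
  | phase2b =>
    rw [sem_ite_of_not (by simp [h'.phase, hph', Phase.code]),
      sem_ite_of_holds (by simp [h'.phase, hph'])]
    exact phase2b_sem hw h' hT hI hph'
  | phase3 =>
    rw [sem_ite_of_not (by simp [h'.phase, hph', Phase.code]),
      sem_ite_of_not (by simp [h'.phase, hph', Phase.code])]
    exact phase3_sem hw h' hT hp hI hph'
  | done => exact absurd hph' hph

end Machine

end BivaluedChores

end
noncomputable section

namespace BivaluedChores

/-! ### Phase 1 on the machine -/

section

variable {n m : ℕ} {v w : Profile n m}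

/-- Dividing by the largest absolute utilities gives a scaling. -/
theorem IsBivaluedChores.normalize (hv : IsBivaluedChores v)
    (hw : ∀ i c, ∃ j, (∀ c', v i c' ≤ v i j) ∧ w i c = v i c / -v i j) :
    (∀ i, ∃ s : ℝ, 0 < s ∧ ∀ c, w i c = s * v i c) ∧
      (∃ r : ℝ, 1 < r ∧ ∀ i c, w i c = -1 ∨ w i c = -r) ∧
      ∀ i, 0 < m → ∃ c, w i c = -1 := by
  obtain ⟨a, b, ha, hab, hval⟩ := hv
  have hneg : ∀ i c, v i c < 0 := fun i c => by rcases hval i c with h | h <;> linarith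
  refine ⟨fun i => ?_, ⟨b / a, ?_, fun i c => ?_⟩, fun i hm => ?_⟩
  · rcases Nat.eq_zero_or_pos m with rfl | hm
    · exact ⟨1, one_pos, fun c => c.elim0⟩
    · obtain ⟨j, hj, -⟩ := hw i ⟨0, hm⟩
      refine ⟨1 / -v i j, one_div_pos.2 (neg_pos.2 (hneg i j)), fun c => ?_⟩
      obtain ⟨j', hj', h⟩ := hw i c
      rw [h, (hj j').antisymm (hj' j)]; ring
  · rw [one_lt_div_of_neg ha]; exact hab
  · obtain ⟨j, hj, h⟩ := hw i c
    have hb : b ≠ 0 := by linarith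
    have ha' : a ≠ 0 := by linarith
    rw [h]
    rcases hval i c with h1 | h1 <;> rcases hval i j with h2 | h2 <;> rw [h1, h2]
    · left; field_simp
    · exact absurd (hj c) (by rw [h1, h2]; exact not_le.2 hab)
    · right; field_simp
    · left; field_simp
  · obtain ⟨j, hj, -⟩ := hw i ⟨0, hm⟩
    obtain ⟨j', hj', h⟩ := hw i j
    refine ⟨j, ?_⟩
    rw [h, (hj j').antisymm (hj' j), div_neg, div_self (hneg i j).ne]

/-- Giving every chore to an agent with maximum utility maximizes welfare. -/
theorem isInitial_of_max {p : ℝ} (hw : IsScaled p w) {x : Allocation n m} {f : Fin m → ℝ}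
    (hx : ∀ c i, w i c ≤ w (x c) c) (hf : ∀ c, f c = p * -w (x c) c) :
    IsInitial p w ⟨Phase.phase2a, x, f, 1, 0, fun _ => ∅, fun _ => ∅⟩ := by
  refine ⟨rfl, rfl, rfl, fun _ => rfl, fun _ => rfl, fun c => ?_, fun y => ?_⟩
  · have : Nonempty (Fin n) := ⟨x c⟩
    have : ⨆ i, w i c = w (x c) c :=
      le_antisymm (ciSup_le (hx c))
        (le_ciSup (f := fun i => w i c) (Set.finite_range _).bddAbove (x c))
    rw [this, hw.abs_eq_neg]; exact hf c
  · simp only [utility, Config.sum_utility_bundle]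
    exact Finset.sum_le_sum fun c _ => hx c (y c)

end

namespace Machine

/-- The utilities of the input. -/
def input (i c : NX) : RX := .read 0 i c
/-- The scaled utilities. -/
def util (i c : NX) : RX := .read 1 i c
/-- The scaled utility is less than `-1`. -/
def hard (i c : NX) : NX := .rlt (util i c) (.const (-1))

def scaleTable : St := .fillReal 1 .agents .items (.div (input (.var 0) (.var 1))
  (.sub (.const 0) (input (.var 0) (.first .items fun c =>
    .all 4 .items (.not (.rlt (input (.var 0) c) (input (.var 0) (.var 4))))))))

def chooseHardAgent : St := put 30 (.first .agents fun i => .ex 4 .items (hard i (.var 4)))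

def chooseHardChore : St := put 31 (.first .items fun c => hard (cell 30) c)

def setFactor : St := .fillReal 3 .one .one
  (.ite (.ex 4 .agents (.ex 5 .items (hard (.var 4) (.var 5))))
    (.sub (.const 0) (util (cell 30) (cell 31))) (.const 2))

def allocTable : St := .fillNat 2 .one .items (.first .agents fun i =>
  .all 4 .agents (.not (.rlt (util i (.var 1)) (util (.var 4) (.var 1)))))

def priceTable : St := .fillReal 2 .one .items (.mul (.read 3 (.const 0) (.const 0))
  (.sub (.const 0) (util (owner (.var 1)) (.var 1))))

/-- The program for the scaling and Phase 1. -/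
def start : St := .seq scaleTable (.seq chooseHardAgent (.seq chooseHardChore (.seq setFactor
  (.seq allocTable (.seq priceTable (put 4 (.const 1)))))))

variable {n m : ℕ} {p : ℝ} {v w : Profile n m} {μ : Mem}

theorem sem_scaleTable (hN : Bound.agents.val μ = n) (hM : Bound.items.val μ = m)
    (hv : ∀ (i : Fin n) (c : Fin m), μ.real 0 i c = v i c) (i : Fin n) (c : Fin m) :
    ∃ j, (∀ c', v i c' ≤ v i j) ∧ (scaleTable.sem μ).real 1 i c = v i c / -v i j := by
  obtain ⟨j, hj, hmax, -⟩ := NX.exists_first (μ := μ) (ρ := cellVars i c) hM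
    (b := fun c => .all 4 .items (.not (.rlt (input (.var 0) c) (input (.var 0) (.var 4)))))
    (P := fun c => ∀ c', v i c' ≤ v i c)
    (fun a c => by simp [NX.holds_all hM, input, hv])
    (by
      have : Nonempty (Fin m) := ⟨c⟩
      exact Finite.exists_max fun c => v i c)
  refine ⟨j, hmax, ?_⟩
  rw [scaleTable, sem_fillReal (hN ▸ i.2) (hM ▸ c.2) (by norm_num)]
  simp only [RX.eval_div, RX.eval_sub]
  rw [input, input, RX.eval_read, RX.eval_read, hj]
  simp [hv]

theorem sem_setFactor (hN : Bound.agents.val μ = n) (hM : Bound.items.val μ = m)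
    (hw : ∀ (i : Fin n) (c : Fin m), μ.real 1 i c = w i c)
    (hval : ∃ r : ℝ, 1 < r ∧ ∀ i c, w i c = -1 ∨ w i c = -r) :
    ∃ p, 1 < p ∧ (∀ i c, w i c = -1 ∨ w i c = -p) ∧
      (setFactor.sem (chooseHardChore.sem (chooseHardAgent.sem μ))).real 3 0 0 = p := by
  obtain ⟨r, hr, hval⟩ := hval
  have heval : ∀ {μ : Mem}, Bound.agents.val μ = n → Bound.items.val μ = m →
      (∀ (i : Fin n) (c : Fin m), μ.real 1 i c = w i c) →
      ((NX.ex 4 .agents (.ex 5 .items (hard (.var 4) (.var 5)))).Holds μ (cellVars 0 0) ↔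
        ∃ i c, w i c < -1) := by
    intro μ hN hM hw
    simp [NX.holds_ex hN, NX.holds_ex hM, hard, util, hw]
  by_cases hex : ∃ i c, w i c < -1
  · refine ⟨r, hr, hval, ?_⟩
    obtain ⟨i, hi, hic, -⟩ := sem_put_first (μ := μ) (a := 30) (by norm_num) hN
      (b := fun i => .ex 4 .items (hard i (.var 4))) (P := fun i => ∃ c, w i c < -1)
      (fun ρ i hρ => by simp [NX.holds_ex hM, hard, util, hw, hρ]) hex
    change (chooseHardAgent.sem μ).nat 30 0 0 = i at hi
    have hN1 : Bound.agents.val (chooseHardAgent.sem μ) = n := hN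
    have hM1 : Bound.items.val (chooseHardAgent.sem μ) = m := hM
    replace hw : ∀ (i : Fin n) (c : Fin m), (chooseHardAgent.sem μ).real 1 i c = w i c := hw
    generalize chooseHardAgent.sem μ = μ at *
    obtain ⟨c, hc, hlt, -⟩ := sem_put_first (μ := μ) (a := 31) (by norm_num) hM1
      (b := fun c => hard (cell 30) c) (P := fun c => w i c < -1)
      (fun ρ c hρ => by simp [hard, util, hi, hw, hρ]) hic
    change (chooseHardChore.sem μ).nat 31 0 0 = c at hc
    rw [← chooseHardChore.sem_nat (a := 30) rfl] at hi
    have hN2 : Bound.agents.val (chooseHardChore.sem μ) = n := hN1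
    have hM2 : Bound.items.val (chooseHardChore.sem μ) = m := hM1
    replace hw : ∀ (i : Fin n) (c : Fin m), (chooseHardChore.sem μ).real 1 i c = w i c := hw
    generalize chooseHardChore.sem μ = μ at *
    rw [setFactor, sem_fillReal (by simp [Bound.val]) (by simp [Bound.val]) (by norm_num),
      RX.eval_ite, if_pos ((heval hN2 hM2 hw).2 hex)]
    rcases hval i c with h | h
    · linarith
    · simp [util, hi, hc, hw, h]
  · refine ⟨2, by norm_num, fun i c => ?_, ?_⟩
    · rcases hval i c with h | h
      · exact Or.inl h
      · exact absurd ⟨i, c, by linarith⟩ hex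
    · rw [setFactor, sem_fillReal (by simp [Bound.val]) (by simp [Bound.val]) (by norm_num),
        RX.eval_ite, if_neg fun hh => hex ((heval (μ := chooseHardChore.sem (chooseHardAgent.sem μ))
          hN hM hw).1 hh)]
      simp

theorem sem_allocTable (hN : Bound.agents.val μ = n) (hM : Bound.items.val μ = m)
    (hw : ∀ (i : Fin n) (c : Fin m), μ.real 1 i c = w i c) (hn : 0 < n) (c : Fin m) :
    ∃ j, (∀ i, w i c ≤ w j c) ∧ (allocTable.sem μ).nat 2 0 c = j := by
  obtain ⟨j, hj, hmax, -⟩ := NX.exists_first (μ := μ) (ρ := cellVars 0 c) hN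
    (b := fun i => .all 4 .agents (.not (.rlt (util i (.var 1)) (util (.var 4) (.var 1)))))
    (P := fun j => ∀ i, w i c ≤ w j c)
    (fun a c => by simp [NX.holds_all hN, util, hw])
    (by
      have : Nonempty (Fin n) := ⟨⟨0, hn⟩⟩
      exact Finite.exists_max fun i => w i c)
  refine ⟨j, hmax, ?_⟩
  rw [allocTable, sem_fillNat (by simp [Bound.val]) (hM ▸ c.2) (by norm_num), hj]

theorem inputMem_nat {a : ℕ} (ha : 2 ≤ a) (r c : ℕ) : (inputMem v).nat a r c = 0 := by
  simp only [inputMem]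
  rw [setCell_of_ne _ _ (by omega), setCell_of_ne _ _ (by omega)]

/-- The program `start` carries out the scaling and Phase 1. -/
theorem start_sem (hn : 0 < n) (hv : IsBivaluedChores v) :
    ∃ (p : ℝ) (w : Profile n m) (s : Config n m), IsScaling v p w ∧ IsInitial p w s ∧
      Represents w s (start.sem (inputMem v)) ∧ (start.sem (inputMem v)).real 3 0 0 = p := by
  have hzero : ∀ a, 2 ≤ a → start.keepsNat a = true → ∀ r c,
      (start.sem (inputMem v)).nat a r c = 0 := fun a ha hk r c => by
    rw [start.sem_nat hk, inputMem_nat ha]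
  have hN : Bound.agents.val (inputMem v) = n := by simp [Bound.val, inputMem, setCell]
  have hM : Bound.items.val (inputMem v) = m := by simp [Bound.val, inputMem, setCell]
  have hN' : Bound.agents.val (start.sem (inputMem v)) = n := hN
  have hM' : Bound.items.val (start.sem (inputMem v)) = m := hM
  have h3 := hzero 3 (by norm_num) rfl
  have h5 := hzero 5 (by norm_num) rfl
  have h6 := hzero 6 (by norm_num) rfl
  have h7 := hzero 7 (by norm_num) rfl
  clear hzero
  have hv0 : ∀ (i : Fin n) (c : Fin m), (inputMem v).real 0 i c = v i c := fun i c => by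
    simp [inputMem]
  rw [start] at *
  simp only [sem_seq] at *
  generalize inputMem v = μ at *
  have hw := sem_scaleTable hN hM hv0
  let w : Profile n m := fun i c => (scaleTable.sem μ).real 1 i c
  obtain ⟨hscale, hval, heasy⟩ := hv.normalize (w := w) hw
  obtain ⟨p, hp1, hpval, hp⟩ := sem_setFactor (μ := scaleTable.sem μ) (w := w) hN hM
    (fun _ _ => rfl) hval
  have hsc : IsScaling v p w := ⟨hp1, hscale, hpval, heasy⟩
  have hw1 : ∀ (i : Fin n) (c : Fin m), (setFactor.sem (chooseHardChore.sem
      (chooseHardAgent.sem (scaleTable.sem μ)))).real 1 i c = w i c := fun i c => by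
    rw [setFactor.sem_real (a := 1) rfl]; rfl
  have hN1 : Bound.agents.val (setFactor.sem (chooseHardChore.sem
      (chooseHardAgent.sem (scaleTable.sem μ)))) = n := hN
  have hM1 : Bound.items.val (setFactor.sem (chooseHardChore.sem
      (chooseHardAgent.sem (scaleTable.sem μ)))) = m := hM
  generalize setFactor.sem (chooseHardChore.sem (chooseHardAgent.sem (scaleTable.sem μ))) = ν at *
  choose x hx hx' using sem_allocTable hN1 hM1 hw1 hn
  have hprice : ∀ c : Fin m, (priceTable.sem (allocTable.sem ν)).real 2 0 c = p * -w (x c) c := by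
    intro c
    have hM2 : Bound.items.val (allocTable.sem ν) = m := hM1
    rw [priceTable, sem_fillReal (by simp [Bound.val]) (hM2 ▸ c.2) (by norm_num)]
    have h1 := hw1 (x c) c
    have h3 := hp
    rw [← allocTable.sem_real (a := 1) rfl] at h1
    rw [← allocTable.sem_real (a := 3) rfl] at h3
    simp [util, owner, hx', h1, h3]
  refine ⟨p, w, _, hsc, isInitial_of_max hsc.isScaled (fun c i => hx c i) (fun c => rfl),
    ⟨hN', hM', fun c => ?_, h3 _ _, sem_put (by norm_num) _, h5 _ _, fun t i => by simp [h6],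
      fun i c => by simp [h7], fun i c => ?_, fun c => ?_⟩, ?_⟩
  · rw [(put 4 (.const 1)).sem_nat (a := 2) rfl, priceTable.sem_nat (a := 2) rfl]
    exact hx' c
  · rw [(put 4 (.const 1)).sem_real (a := 1) rfl, priceTable.sem_real (a := 1) rfl,
      allocTable.sem_real (a := 1) rfl]
    exact hw1 i c
  · rw [(put 4 (.const 1)).sem_real (a := 2) rfl]
    exact hprice c
  · rw [(put 4 (.const 1)).sem_real (a := 3) rfl, priceTable.sem_real (a := 3) rfl,
      allocTable.sem_real (a := 3) rfl]
    exact hp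

end Machine

end BivaluedChores

end
noncomputable section

namespace BivaluedChores

/-! ### The running time -/

namespace Machine

variable {n m : ℕ} {p : ℝ} {v w : Profile n m} {s : Config n m}

theorem _root_.BivaluedChores.Represents.size {μ : Mem} (h : Represents w s μ) :
    μ.size = n + m + 1 := by
  rw [Mem.size, h.1, h.2.1]

theorem _root_.BivaluedChores.Represents.of_sim {μ ν : Mem} (h : Represents w s μ)
    (hs : St.Sim μ ν) : Represents w s ν :=
  h.congr (fun a ha => funext fun r => funext fun c => hs.1.1 a (by omega) r c)
    fun a ha => funext fun r => funext fun c => hs.1.2 a (by omega) r c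

theorem running_iff {ν : Mem} (h : Represents w s ν) :
    running.holds ν ↔ s.phase ≠ Phase.done := by
  simp only [running, BExp.holds, NExp.eval, h.phase]
  cases s.phase <;> simp [Phase.code]

/-- The main loop carries out the algorithm. -/
theorem exec_loop (hw : IsScaled p w) : ∀ (N : ℕ) (s : Config n m) (μ ν : Mem),
    Config.measure p w s = N → s.Inv p w → Represents w s μ → μ.real 3 0 0 = p → St.Sim μ ν →
    ∃ (L : ℕ) (σ : ℕ → Config n m) (mem : ℕ → Mem) (T : ℕ), σ 0 = s ∧ mem 0 = ν ∧
      (∀ t < L, Step w (σ t) (σ (t + 1))) ∧ (σ L).phase = Phase.done ∧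
      (∀ t < L, ∃ T', Exec (body.compile 0) (mem t) (mem (t + 1)) T') ∧
      (∀ t ≤ L, Represents w (σ t) (mem t)) ∧
      Exec (Prog.loop running (body.compile 0)) ν (mem L) T ∧
      T ≤ L * (body.time.eval (n + m + 1) + running.cost) + running.cost := by
  intro N
  induction N using Nat.strong_induction_on with | _ N ih
  intro s μ ν hN hI hR hp hS
  by_cases hph : s.phase = Phase.done
  · exact ⟨0, fun _ => s, fun _ => ν, _, rfl, rfl, fun t ht => by omega, hph,
      fun t ht => by omega, fun _ _ => hR.of_sim hS,
      .loopDone (by simp [running_iff (hR.of_sim hS), hph]), by omega⟩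
  · obtain ⟨s', hs', hR', hp'⟩ := body_sem hw hR hp hI hph
    obtain ⟨hI', hlt⟩ := hI.step hw hs'
    rw [hN] at hlt
    obtain ⟨ν', t, hE, ht, hS', -⟩ := body.run ⟨rfl, rfl⟩ 0 μ ν hS _ hR.size.le
    obtain ⟨L, σ, mem, T, h1, h2, h3, h4, h5, h6, h7, h8⟩ :=
      ih _ hlt s' _ ν' rfl hI' hR' hp' hS'
    refine ⟨L + 1, fun k => k.casesOn s σ, fun k => k.casesOn ν mem, _, rfl, rfl, ?_, h4, ?_, ?_,
      .loopStep ((running_iff (hR.of_sim hS)).2 hph) hE h7, ?_⟩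
    · rintro (_ | k) hk
      · change Step w s (σ 0)
        rwa [h1]
      · exact h3 k (by omega)
    · rintro (_ | k) hk
      · change ∃ T', Exec _ ν (mem 0) T'
        exact ⟨t, h2 ▸ hE⟩
      · exact h5 k (by omega)
    · rintro (_ | k) hk
      · exact hR.of_sim hS
      · exact h6 k (by omega)
    · rw [Nat.succ_mul]; omega

open Polynomial in
/-- A bound for the length of all runs and for the running time of the machine. -/
def timePoly : ℕ[X] :=
  runPoly + (start.time.comp (X + 1) +
    (runPoly * (body.time.comp (X + 1) + C running.cost) + C running.cost))

theorem eval_timePoly (k : ℕ) : timePoly.eval k = runPoly.eval k + (start.time.eval (k + 1) +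
    (runPoly.eval k * (body.time.eval (k + 1) + running.cost) + running.cost)) := by
  simp only [timePoly, Polynomial.eval_add, Polynomial.eval_mul, Polynomial.eval_comp,
    Polynomial.eval_X, Polynomial.eval_one, Polynomial.eval_C]

/-- The machine carries out the algorithm in polynomial time. -/
theorem exists_exec (hn : 0 < n) (hv : IsBivaluedChores v) :
    ∃ (p : ℝ) (w : Profile n m) (L : ℕ) (σ : ℕ → Config n m) (mem : ℕ → Mem) (T : ℕ),
      IsScaling v p w ∧ IsRun p w L σ ∧ (σ L).phase = Phase.done ∧
      Implements (start.compile 0) (body.compile 0) v w L σ mem ∧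
      Exec (mainProgram (start.compile 0) (body.compile 0)) (inputMem v) (mem L) T ∧
      T ≤ timePoly.eval (n + m) := by
  obtain ⟨p, w, s, hsc, hinit, hR, hp⟩ := start_sem hn hv
  have hw := hsc.isScaled
  have hS : St.Sim (inputMem v) (inputMem v) :=
    ⟨⟨fun _ _ _ _ => rfl, fun _ _ _ _ => rfl⟩, fun k => inputMem_nat (by norm_num) _ _⟩
  have hsize : (inputMem v).size ≤ n + m + 1 := by
    rw [← St.sem_size (P := start) ⟨rfl, rfl⟩, hR.size]
  obtain ⟨ν, t, hE, ht, hS', -⟩ := start.run ⟨rfl, rfl⟩ 0 _ _ hS _ hsize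
  obtain ⟨L, σ, mem, T, h1, h2, h3, h4, h5, h6, h7, h8⟩ :=
    exec_loop hw _ s _ ν rfl (hinit.inv hw) hR hp hS'
  have hrun : IsRun p w L σ := ⟨h1 ▸ hinit, h3⟩
  refine ⟨p, w, L, σ, mem, t + T, hsc, hrun, h4, ⟨⟨t, h2 ▸ hE⟩, h5, h6⟩, hE.seq h7, ?_⟩
  have hL := Nat.mul_le_mul_right (body.time.eval (n + m + 1) + running.cost) (hrun.length_le hw)
  rw [eval_timePoly]
  omega

end Machine

end BivaluedChores

end
theorem mainTheorem1 :
    ∃ (q : Polynomial ℕ) (start body : Prog),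
      ∀ (n m : ℕ), 0 < n → ∀ v : Profile n m, IsBivaluedChores v →
        -- every execution is correct and short, however open choices are made
        (∀ (p : ℝ) (w : Profile n m), IsScaling v p w →
          (∃ s : Config n m, IsInitial p w s) ∧
          ∀ (L : ℕ) (σ : ℕ → Config n m), IsRun p w L σ →
            L ≤ q.eval (n + m) ∧
            ((σ L).phase = Phase.done ∨ ∃ s' : Config n m, Step w (σ L) s') ∧
            ((σ L).phase = Phase.done →
              EF1 v (σ L).alloc ∧ ParetoOptimal v (σ L).alloc)) ∧
        -- the algorithm is carried out step by step on a machine, in polynomial time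
        (∃ (p : ℝ) (w : Profile n m) (L : ℕ) (σ : ℕ → Config n m) (mem : ℕ → Mem) (T : ℕ),
          IsScaling v p w ∧ IsRun p w L σ ∧ (σ L).phase = Phase.done ∧
          Implements start body v w L σ mem ∧
          Exec (mainProgram start body) (inputMem v) (mem L) T ∧ T ≤ q.eval (n + m) ∧
          EF1 v (σ L).alloc ∧ ParetoOptimal v (σ L).alloc) ∧
        -- in particular
        ∃ x : Allocation n m, EF1 v x ∧ ParetoOptimal v x := by
  refine ⟨Machine.timePoly, Machine.start.compile 0, Machine.body.compile 0, ?_⟩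
  intro n m hn v hv
  obtain ⟨p, w, L, σ, mem, T, hsc, hrun, hdone, himp, hexec, hT⟩ := Machine.exists_exec hn hv
  have hcorrect := (hrun.inv hsc.isScaled L le_rfl).1.correct hsc hdone
  refine ⟨fun p w hsc => ⟨exists_isInitial hn p w, fun L σ hrun => ⟨?_, ?_, ?_⟩⟩,
    ⟨p, w, L, σ, mem, T, hsc, hrun, hdone, himp, hexec, hT, hcorrect⟩, _, hcorrect⟩
  · refine (hrun.length_le hsc.isScaled).trans ?_
    rw [Machine.eval_timePoly]
    omega
  · exact (hrun.inv hsc.isScaled L le_rfl).1.exists_step hsc.isScaled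
  · exact (hrun.inv hsc.isScaled L le_rfl).1.correct hsc
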